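/- Conventions. The contact graph $\mathcal{C}X$ of a CAT(0) cube complex $X$ has the hyperplanes of $X$ as vertices, and two distinct hyperplanes are joined by an edge when their carriers intersect; it carries the graph metric. An action of a group $G$ on a metric space $(M,d)$ is acylindrical if for every $\epsilon>0$ there are $R,N>0$ such that whenever $d(x,y)\ge R$ there are at most $N$ elements $g\in G$ with $d(x,gx)<\epsilon$ and $d(y,gy)<\epsilon$. (1) There is a group $G$ with a proper cocompact action on a CAT(0) cube complex $X$ (of dimension at most two) such that the induced action of $G$ on $\mathcal{C}X$ is not acylindrical. (2) Concretely, let $T_1,T_2$ be locally finite trees and let $\Gamma$ be a group acting freely and cocompactly on $T_1\times T_2$. Let $g_1,g_2\in\Gamma$ form an anti-torus: there are bi-infinite geodesics $\ell_1\subset T_1$, $\ell_2\subset T_2$ and vertices $p_1\in\ell_1$, $p_2\in\ell_2$ such that $g_1$ translates non-trivially along $\ell_1\times\{p_2\}$ and $g_2$ translates non-trivially along $\{p_1\}\times\ell_2$, and no non-zero powers of $g_1$ and $g_2$ commute. Suppose also that neither $g_1$ nor $g_2$ is a proper power in $\Gamma$. Let $w_1$ be the closed edge path in $(T_1\times T_2)/\Gamma$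 that is the image of the segment of $\ell_1\times\{p_2\}$ from $(p_1,p_2)$ to $g_1(p_1,p_2)$, and let $|w_1|$ be its length. Attach to $(T_1\times T_2)/\Gamma$ an annulus, subdivided into $|w_1|$ squares, by gluing both of its boundary circles, with matching orientations, along $w_1$, and let $Y$ be the universal cover of the resulting square complex. Then $Y$ is a CAT(0) cube complex, its group of deck transformations is isomorphic to the HNN extension $$\Lambda=\Gamma*_{\langle g_1\rangle}=\langle \Gamma,t\mid t g_1 t^{-1}=g_1\rangle,$$ and the resulting action of $\Lambda$ on $Y$ by deck transformations is free and cocompact, but the induced action of $\Lambda$ on the contact graph $\mathcal{C}Y$ is not acylindrical. -/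

import Mathlib

universe u v

/-- `SameSquare inv a b c d a' b' c' d'`: the closed edge paths `abcd` and `a'b'c'd'` bound the same
square, i.e. they differ by a cyclic shift and/or a reversal (`inv` reverses oriented edges). -/
inductive SameSquare {E : Type u} (inv : E → E) (a b c d : E) : E → E → E → E → Prop
  | refl : SameSquare inv a b c d a b c d
  | rot {e f g h : E} : SameSquare inv a b c d e f g h → SameSquare inv a b c d f g h e
  | rev {e f g h : E} : SameSquare inv a b c d e f g h →
      SameSquare inv a b c d (inv h) (inv g) (inv f) (inv e)

theorem SameSquare.closed {E : Type u} {V : Type v} {inv : E → E} (src : E → V)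
    (hinv : ∀ e, inv (inv e) = e) {a b c d e f g h : E}
    (hs : SameSquare inv a b c d e f g h)
    (h1 : src (inv a) = src b) (h2 : src (inv b) = src c)
    (h3 : src (inv c) = src d) (h4 : src (inv d) = src a) :
    src (inv e) = src f ∧ src (inv f) = src g ∧ src (inv g) = src h ∧ src (inv h) = src e := by
  induction hs with
  | refl => exact ⟨h1, h2, h3, h4⟩
  | rot _ ih => exact ⟨ih.2.1, ih.2.2.1, ih.2.2.2, ih.1⟩
  | rev _ ih =>
    simp only [hinv]
    exact ⟨ih.2.2.1.symm, ih.2.1.symm, ih.1.symm, ih.2.2.2.symm⟩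

/-- A square complex (a cube complex of dimension at most two), given combinatorially.
`V` is the set of vertices and `E` the set of oriented edges; every edge occurs with both of its
orientations `e ≠ inv e`, and `src e` is the initial vertex of `e`. A square is recorded by its
boundary: `Sq a b c d` says that the closed edge path `abcd` runs once around a square. -/
structure SquareComplex where
  V : Type u
  E : Type u
  src : E → V
  inv : E → E
  inv_inv : ∀ e, inv (inv e) = e
  inv_ne : ∀ e, inv e ≠ e
  Sq : E → E → E → E → Prop
  sq_path : ∀ a b c d, Sq a b c d → src (inv a) = src b
  sq_rot : ∀ a b c d, Sq a b c d → Sq b c d a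
  sq_rev : ∀ a b c d, Sq a b c d → Sq (inv d) (inv c) (inv b) (inv a)

namespace SquareComplex

/-- Terminal vertex of an oriented edge. -/
def tgt (X : SquareComplex.{u}) (e : X.E) : X.V := X.src (X.inv e)

/-! ### Edge paths, homotopy, the CAT(0) condition -/

/-- `l` is an edge path from `x` to `y`. -/
def IsPath (X : SquareComplex.{u}) (x : X.V) : List X.E → X.V → Prop
  | [], y => x = y
  | e :: l, y => X.src e = x ∧ X.IsPath (X.tgt e) l y

theorem IsPath.snoc {X : SquareComplex.{u}} {l : List X.E} :
    ∀ {x : X.V} (e : X.E), X.IsPath x l (X.src e) → X.IsPath x (l ++ [e]) (X.tgt e) := by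
  induction l with
  | nil => intro x e h; exact ⟨h.symm, rfl⟩
  | cons a l ih => intro x e h; exact ⟨h.1, ih e h.2⟩

/-- Elementary homotopies: removing a backtrack or the boundary of a square. -/
inductive Step (X : SquareComplex.{u}) : List X.E → List X.E → Prop
  | backtrack (l l' : List X.E) (e : X.E) : X.Step (l ++ [e, X.inv e] ++ l') (l ++ l')
  | square (l l' : List X.E) (a b c d : X.E) : X.Sq a b c d →
      X.Step (l ++ [a, b, c, d] ++ l') (l ++ l')

/-- Edge paths from `x` to `y`. -/
def Path (X : SquareComplex.{u}) (x y : X.V) : Type u := {l : List X.E // X.IsPath x l y}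

/-- Homotopy classes, relative to the end points, of edge paths from `x` to `y`. -/
def PathClass (X : SquareComplex.{u}) (x y : X.V) : Type u :=
  Quot (fun p q : X.Path x y => X.Step p.1 q.1)

/-- The homotopy class of an edge path. -/
def pathClass (X : SquareComplex.{u}) {x y : X.V} (l : List X.E) (h : X.IsPath x l y) :
    X.PathClass x y :=
  Quot.mk _ ⟨l, h⟩

/-- Connected, with every closed edge path null-homotopic. -/
def IsSimplyConnected (X : SquareComplex.{u}) : Prop :=
  Nonempty X.V ∧ (∀ x y, ∃ l, X.IsPath x l y) ∧
    ∀ (x : X.V) (l : List X.E) (h : X.IsPath x l x), X.pathClass l h = X.pathClass [] rfl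

/-- Adjacency in the link of a vertex `v`. The vertices of the link are the oriented edges issuing
from `v`; the edges of the link are the corners of squares at `v`. -/
def LinkAdj (X : SquareComplex.{u}) (e f : X.E) : Prop := ∃ c d, X.Sq (X.inv e) f c d

/-- Non-positive curvature: every vertex link is a flag simplicial complex. As links are graphs,
this means that links have no loops, no multiple edges (different squares do not share
a corner, and two corners of one square are not the same corner) and no triangles. -/
structure IsNonPositivelyCurved (X : SquareComplex.{u}) : Prop where
  no_loop : ∀ e, ¬ X.LinkAdj e e
  no_double : ∀ a b c d c' d', X.Sq a b c d → X.Sq a b c' d' → c = c' ∧ d = d'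
  no_fold : ∀ a b c d, X.Sq a b c d → ¬ (a = c ∧ b = d)
  no_triangle : ∀ e f g, ¬ (X.LinkAdj e f ∧ X.LinkAdj f g ∧ X.LinkAdj g e)

/-- CAT(0): simply connected with flag links (Gromov's condition). -/
def IsCAT0 (X : SquareComplex.{u}) : Prop := X.IsSimplyConnected ∧ X.IsNonPositivelyCurved

/-! ### Automorphisms and group actions -/

/-- The group of cellular automorphisms. -/
def Aut (X : SquareComplex.{u}) : Subgroup (Equiv.Perm X.V × Equiv.Perm X.E) where
  carrier := {f | (∀ e, X.src (f.2 e) = f.1 (X.src e)) ∧ (∀ e, f.2 (X.inv e) = X.inv (f.2 e)) ∧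
    ∀ a b c d, X.Sq (f.2 a) (f.2 b) (f.2 c) (f.2 d) ↔ X.Sq a b c d}
  one_mem' := by simp
  mul_mem' := by
    rintro f g ⟨h1, h2, h3⟩ ⟨k1, k2, k3⟩
    refine ⟨fun e => ?_, fun e => ?_, fun a b c d => ?_⟩
    · simp [h1, k1]
    · simp [h2, k2]
    · simp [h3, k3]
  inv_mem' := by
    rintro f ⟨h1, h2, h3⟩
    refine ⟨fun e => ?_, fun e => ?_, fun a b c d => ?_⟩
    · have := h1 (f.2.symm e)
      rw [Equiv.apply_symm_apply] at this
      exact ((Equiv.symm_apply_eq f.1).2 this).symm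
    · have := h2 (f.2.symm e)
      rw [Equiv.apply_symm_apply] at this
      exact (Equiv.symm_apply_eq f.2).2 this.symm
    · have := h3 (f.2.symm a) (f.2.symm b) (f.2.symm c) (f.2.symm d)
      simpa using this.symm

/-- Automorphisms act on vertices. -/
instance (X : SquareComplex.{u}) : MulAction X.Aut X.V where
  smul f x := f.1.1 x
  one_smul _ := rfl
  mul_smul _ _ _ := rfl

/-- Automorphisms act on oriented edges. -/
instance (X : SquareComplex.{u}) : MulAction X.Aut X.E where
  smul f e := f.1.2 e
  one_smul _ := rfl
  mul_smul _ _ _ := rfl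

theorem src_smul {X : SquareComplex.{u}} (f : X.Aut) (e : X.E) : X.src (f • e) = f • X.src e :=
  f.2.1 e

theorem inv_smul {X : SquareComplex.{u}} (f : X.Aut) (e : X.E) : X.inv (f • e) = f • X.inv e :=
  (f.2.2.1 e).symm

theorem sq_smul {X : SquareComplex.{u}} (f : X.Aut) (a b c d : X.E) :
    X.Sq (f • a) (f • b) (f • c) (f • d) ↔ X.Sq a b c d :=
  f.2.2.2 a b c d

/-- The action has no fixed point: no nontrivial element fixes a vertex, reverses an edge, or
carries a square to itself. -/
structure IsFree {G : Type v} [Group G] {X : SquareComplex.{u}} (ρ : G →* X.Aut) : Prop where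
  vertex : ∀ g, g ≠ 1 → ∀ x : X.V, ρ g • x ≠ x
  edge : ∀ g, g ≠ 1 → ∀ e : X.E, ρ g • e ≠ X.inv e
  square : ∀ g, g ≠ 1 → ∀ a b c d : X.E, X.Sq a b c d →
    ¬ SameSquare X.inv a b c d (ρ g • a) (ρ g • b) (ρ g • c) (ρ g • d)

/-- Finite cell stabilizers. (It suffices to ask this of the vertices; for cocompact actions it is
properness.) -/
def IsProper {G : Type v} [Group G] {X : SquareComplex.{u}} (ρ : G →* X.Aut) : Prop :=
  ∀ x : X.V, {g : G | ρ g • x = x}.Finite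

/-- Cocompactness: there are finitely many orbits of vertices, of edges and of squares. -/
def IsCocompact {G : Type v} [Group G] {X : SquareComplex.{u}} (ρ : G →* X.Aut) : Prop :=
  (∃ A : Set X.V, A.Finite ∧ ∀ x, ∃ g, ρ g • x ∈ A) ∧
  (∃ B : Set X.E, B.Finite ∧ ∀ e, ∃ g, ρ g • e ∈ B) ∧
  (∃ C : Set (X.E × X.E × X.E × X.E), C.Finite ∧
    ∀ a b c d, X.Sq a b c d → ∃ g, (ρ g • a, ρ g • b, ρ g • c, ρ g • d) ∈ C)

/-! ### Hyperplanes and the contact graph -/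

/-- Elementary parallelism of edges: the two orientations of an edge, or two opposite edges of
a square. -/
def Parallel (X : SquareComplex.{u}) (e f : X.E) : Prop := f = X.inv e ∨ ∃ b d, X.Sq e b f d

/-- Hyperplanes, as the classes of edges under the equivalence relation generated by elementary
parallelism; a hyperplane corresponds to the class of the edges dual to it. -/
def Hyperplane (X : SquareComplex.{u}) : Type u := Quot X.Parallel

/-- The hyperplane dual to an edge. -/
def dual (X : SquareComplex.{u}) (e : X.E) : X.Hyperplane := Quot.mk _ e

/-- The contact graph: distinct hyperplanes are adjacent when their carriers intersect. Carriers
are subcomplexes, and the vertices of the carrier of `H` are the end points of the edges dual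
to `H`, so this says that some edges dual to `H` and to `K` have a common end point. -/
def contactGraph (X : SquareComplex.{u}) : SimpleGraph X.Hyperplane where
  Adj H K := H ≠ K ∧ ∃ e f, X.dual e = H ∧ X.dual f = K ∧ X.src e = X.src f
  symm := ⟨fun _ _ ⟨h, e, f, he, hf, hef⟩ => ⟨h.symm, f, e, hf, he, hef.symm⟩⟩
  loopless := ⟨fun _ h => h.1 rfl⟩

/-- The induced action of automorphisms on hyperplanes. -/
instance (X : SquareComplex.{u}) : MulAction X.Aut X.Hyperplane where
  smul f := Quot.map (fun e => f • e) (by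
    rintro e e' (h | ⟨b, d, h⟩)
    · left; subst h; exact (inv_smul f e).symm
    · exact Or.inr ⟨f • b, f • d, (sq_smul f e b e' d).2 h⟩)
  one_smul := by rintro ⟨e⟩; rfl
  mul_smul := by rintro f g ⟨e⟩; rfl

end SquareComplex

/-- An action of a group `G` on a set `M` with distance function `dist` is acylindrical. -/
def IsAcylindrical {G : Type v} [Group G] {M : Type u} (act : G →* Equiv.Perm M)
    (dist : M → M → ℝ) : Prop :=
  ∀ ε : ℝ, 0 < ε → ∃ R : ℝ, 0 < R ∧ ∃ N : ℕ, 0 < N ∧ ∀ x y : M, R ≤ dist x y →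
    {g : G | dist x (act g x) < ε ∧ dist y (act g y) < ε}.encard ≤ N

namespace SquareComplex

/-- The action on (the vertices of) the contact graph, with its graph metric, that is induced by an
action on a connected square complex is acylindrical. -/
def IsAcylindricalOnContactGraph {G : Type v} [Group G] {X : SquareComplex.{u}}
    (ρ : G →* X.Aut) : Prop :=
  IsAcylindrical ((MulAction.toPermHom X.Aut X.Hyperplane).comp ρ)
    (fun H K => (X.contactGraph.dist H K : ℝ))

/-! ### Products of graphs -/

/-- The product of two graphs. Edges are `e × y` and `x × f`, squares are `e × f`. -/
def prod {V₁ V₂ : Type u} (T₁ : SimpleGraph V₁) (T₂ : SimpleGraph V₂) : SquareComplex.{u} where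
  V := V₁ × V₂
  E := (T₁.Dart × V₂) ⊕ (V₁ × T₂.Dart)
  src := Sum.elim (fun e => (e.1.fst, e.2)) (fun f => (f.1, f.2.fst))
  inv := Sum.map (fun e => (e.1.symm, e.2)) (fun f => (f.1, f.2.symm))
  inv_inv := by rintro (e | f) <;> simp
  inv_ne := by
    rintro (⟨e, y⟩ | ⟨x, f⟩) h
    · exact e.symm_ne (Prod.ext_iff.1 (Sum.inl_injective h)).1
    · exact f.symm_ne (Prod.ext_iff.1 (Sum.inr_injective h)).2
  Sq a b c d := ∃ (e : T₁.Dart) (f : T₂.Dart),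
    SameSquare (Sum.map (fun e => (e.1.symm, e.2)) (fun f => (f.1, f.2.symm)))
      (Sum.inl (e, f.fst)) (Sum.inr (e.snd, f)) (Sum.inl (e.symm, f.snd)) (Sum.inr (e.fst, f.symm))
      a b c d
  sq_path := by
    rintro a b c d ⟨e, f, h⟩
    exact (h.closed (Sum.elim (fun e => (e.1.fst, e.2)) (fun f => (f.1, f.2.fst)))
      (by rintro (e | f) <;> simp) rfl rfl rfl rfl).1
  sq_rot := by
    rintro a b c d ⟨e, f, h⟩
    exact ⟨e, f, h.rot⟩
  sq_rev := by
    rintro a b c d ⟨e, f, h⟩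
    exact ⟨e, f, h.rev⟩

/-- The vertex `(x, y)` of a product. -/
def prodVertex {V₁ V₂ : Type u} (T₁ : SimpleGraph V₁) (T₂ : SimpleGraph V₂) (x : V₁) (y : V₂) :
    (prod T₁ T₂).V :=
  (x, y)

/-! ### The quotient by a free action -/

/-- Lying in the same orbit of vertices. -/
def vertexOrbit {G : Type v} [Group G] {X : SquareComplex.{u}} (ρ : G →* X.Aut) : Setoid X.V where
  r x y := ∃ g, ρ g • x = y
  iseqv :=
    { refl := fun x => ⟨1, by simp⟩
      symm := by rintro x _ ⟨g, rfl⟩; exact ⟨g⁻¹, by simp⟩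
      trans := by rintro x _ _ ⟨g, rfl⟩ ⟨h, rfl⟩; exact ⟨h * g, by simp [mul_smul]⟩ }

/-- Lying in the same orbit of oriented edges. -/
def edgeOrbit {G : Type v} [Group G] {X : SquareComplex.{u}} (ρ : G →* X.Aut) : Setoid X.E where
  r x y := ∃ g, ρ g • x = y
  iseqv :=
    { refl := fun x => ⟨1, by simp⟩
      symm := by rintro x _ ⟨g, rfl⟩; exact ⟨g⁻¹, by simp⟩
      trans := by rintro x _ _ ⟨g, rfl⟩ ⟨h, rfl⟩; exact ⟨h * g, by simp [mul_smul]⟩ }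

/-- The quotient of a square complex by a free action. -/
def quotient {G : Type v} [Group G] {X : SquareComplex.{u}} (ρ : G →* X.Aut) (hρ : IsFree ρ) :
    SquareComplex.{u} where
  V := Quotient (vertexOrbit ρ)
  E := Quotient (edgeOrbit ρ)
  src := Quotient.map X.src (by rintro e _ ⟨g, rfl⟩; exact ⟨g, (src_smul _ _).symm⟩)
  inv := Quotient.map X.inv (by rintro e _ ⟨g, rfl⟩; exact ⟨g, (inv_smul _ _).symm⟩)
  inv_inv := by
    rintro ⟨e⟩
    exact congrArg (Quotient.mk (edgeOrbit ρ)) (X.inv_inv e)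
  inv_ne := by
    rintro ⟨e⟩ h
    obtain ⟨g, hg⟩ : ∃ g, ρ g • e = X.inv e := Quotient.exact h.symm
    by_cases h1 : g = 1
    · subst h1
      exact X.inv_ne e (by simpa using hg.symm)
    · exact hρ.edge g h1 e hg
  Sq a b c d := ∃ a' b' c' d', X.Sq a' b' c' d' ∧
    a = Quotient.mk _ a' ∧ b = Quotient.mk _ b' ∧ c = Quotient.mk _ c' ∧ d = Quotient.mk _ d'
  sq_path := by
    rintro _ _ _ _ ⟨a, b, c, d, h, rfl, rfl, rfl, rfl⟩
    exact congrArg (Quotient.mk (vertexOrbit ρ)) (X.sq_path _ _ _ _ h)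
  sq_rot := by
    rintro _ _ _ _ ⟨a, b, c, d, h, rfl, rfl, rfl, rfl⟩
    exact ⟨b, c, d, a, X.sq_rot _ _ _ _ h, rfl, rfl, rfl, rfl⟩
  sq_rev := by
    rintro _ _ _ _ ⟨a, b, c, d, h, rfl, rfl, rfl, rfl⟩
    exact ⟨_, _, _, _, X.sq_rev _ _ _ _ h, rfl, rfl, rfl, rfl⟩

/-! ### Attaching an annulus along a loop -/

/-- Let `w` be a closed edge path of length `m`. Take the annulus `(circle of length m) × [0,1]`,
subdivided into `m` squares, and glue both boundary circles to `Z` along `w`, with the same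
orientation. The new edges `t i = (i, true)`, with inverses `(i, false)`, cross the annulus; both
ends of `t i` are glued to the `i`-th vertex of `w`. The new squares have boundaries
`(w i) (t (i+1)) (w i)⁻¹ (t i)⁻¹`. -/
def attachAnnulus (Z : SquareComplex.{u}) (m : ℕ) (w : ZMod m → Z.E)
    (hw : ∀ i, Z.tgt (w i) = Z.src (w (i + 1))) : SquareComplex.{u} where
  V := Z.V
  E := Z.E ⊕ (ZMod m × Bool)
  src := Sum.elim Z.src (fun t => Z.src (w t.1))
  inv := Sum.map Z.inv (fun t => (t.1, !t.2))
  inv_inv := by rintro (e | t) <;> simp [Z.inv_inv]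
  inv_ne := by
    rintro (e | ⟨i, b⟩) h
    · exact Z.inv_ne e (Sum.inl_injective h)
    · cases b <;> simp at h
  Sq a b c d :=
    (∃ a' b' c' d', Z.Sq a' b' c' d' ∧
      a = Sum.inl a' ∧ b = Sum.inl b' ∧ c = Sum.inl c' ∧ d = Sum.inl d') ∨
    ∃ i : ZMod m, SameSquare (Sum.map Z.inv (fun t => (t.1, !t.2)))
      (Sum.inl (w i)) (Sum.inr (i + 1, true)) (Sum.inl (Z.inv (w i))) (Sum.inr (i, false)) a b c d
  sq_path := by
    rintro a b c d (⟨a', b', c', d', h, rfl, rfl, rfl, rfl⟩ | ⟨i, h⟩)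
    · exact Z.sq_path _ _ _ _ h
    · refine (h.closed (Sum.elim Z.src (fun t : ZMod m × Bool => Z.src (w t.1)))
        (by rintro (e | t) <;> simp [Z.inv_inv]) (hw i) (hw i).symm ?_ rfl).1
      simp [Z.inv_inv]
  sq_rot := by
    rintro a b c d (⟨a', b', c', d', h, rfl, rfl, rfl, rfl⟩ | ⟨i, h⟩)
    · exact Or.inl ⟨_, _, _, _, Z.sq_rot _ _ _ _ h, rfl, rfl, rfl, rfl⟩
    · exact Or.inr ⟨i, h.rot⟩
  sq_rev := by
    rintro a b c d (⟨a', b', c', d', h, rfl, rfl, rfl, rfl⟩ | ⟨i, h⟩)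
    · exact Or.inl ⟨_, _, _, _, Z.sq_rev _ _ _ _ h, rfl, rfl, rfl, rfl⟩
    · exact Or.inr ⟨i, h.rev⟩

/-! ### The universal cover -/

/-- The vertex of the universal cover given by an edge path from the base point `z`. -/
def coverVertex (Z : SquareComplex.{u}) (z : Z.V) (y : Z.V) (l : List Z.E) (h : Z.IsPath z l y) :
    Σ y, Z.PathClass z y :=
  ⟨y, Z.pathClass l h⟩

/-- `x`, `y` are the classes of `l` and `le`, for some edge path `l` from `z` to the initial vertex
of `e`; that is, the lift of `e` to the universal cover that begins at `x` ends at `y`. -/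
def CoverEdge (Z : SquareComplex.{u}) (z : Z.V) (x : Σ y, Z.PathClass z y) (e : Z.E)
    (y : Σ y, Z.PathClass z y) : Prop :=
  ∃ (l : List Z.E) (h : Z.IsPath z l (Z.src e)),
    x = Z.coverVertex z (Z.src e) l h ∧ y = Z.coverVertex z (Z.tgt e) (l ++ [e]) (h.snoc e)

theorem coverVertex_eq (Z : SquareComplex.{u}) (z : Z.V) {y y' : Z.V} {l l' : List Z.E}
    (h : Z.IsPath z l y) (h' : Z.IsPath z l' y') (hy : y = y') (hl : Z.Step l l') :
    Z.coverVertex z y l h = Z.coverVertex z y' l' h' := by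
  subst hy
  have : Z.pathClass l h = Z.pathClass l' h' := Quot.sound hl
  simp [coverVertex, this]

theorem CoverEdge.inv {Z : SquareComplex.{u}} {z : Z.V} {x y : Σ y, Z.PathClass z y} {e : Z.E}
    (h : Z.CoverEdge z x e y) : Z.CoverEdge z y (Z.inv e) x := by
  obtain ⟨l, h, rfl, rfl⟩ := h
  refine ⟨l ++ [e], h.snoc e, rfl, ?_⟩
  refine (coverVertex_eq Z z _ h ?_ ?_).symm
  · simp [tgt, Z.inv_inv]
  · simpa using Step.backtrack l [] e

/-- The universal cover of a connected square complex with base point `z`: the vertices are the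
homotopy classes of edge paths starting at `z`, and the edges and squares are the lifts of those
of `Z`. -/
def universalCover (Z : SquareComplex.{u}) (z : Z.V) : SquareComplex.{u} where
  V := Σ y, Z.PathClass z y
  E := {t : (Σ y, Z.PathClass z y) × Z.E × (Σ y, Z.PathClass z y) //
    Z.CoverEdge z t.1 t.2.1 t.2.2}
  src t := t.1.1
  inv t := ⟨(t.1.2.2, Z.inv t.1.2.1, t.1.1), t.2.inv⟩
  inv_inv := by rintro ⟨⟨x, e, y⟩, h⟩; simp [Z.inv_inv]
  inv_ne := by
    rintro ⟨⟨x, e, y⟩, h⟩ h'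
    simp only [Subtype.mk.injEq, Prod.mk.injEq] at h'
    exact Z.inv_ne e h'.2.1
  Sq a b c d := Z.Sq a.1.2.1 b.1.2.1 c.1.2.1 d.1.2.1 ∧
    a.1.2.2 = b.1.1 ∧ b.1.2.2 = c.1.1 ∧ c.1.2.2 = d.1.1 ∧ d.1.2.2 = a.1.1
  sq_path := fun _ _ _ _ h => h.2.1
  sq_rot := fun _ _ _ _ h => ⟨Z.sq_rot _ _ _ _ h.1, h.2.2.1, h.2.2.2.1, h.2.2.2.2, h.2.1⟩
  sq_rev := fun _ _ _ _ h =>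
    ⟨Z.sq_rev _ _ _ _ h.1, h.2.2.2.1.symm, h.2.2.1.symm, h.2.1.symm, h.2.2.2.2.symm⟩

/-- The deck transformations of the universal cover: the automorphisms that commute with the
covering map, which sends the class of a path to its end point, and a lift of an edge to
that edge. -/
def deck (Z : SquareComplex.{u}) (z : Z.V) : Subgroup (Z.universalCover z).Aut where
  carrier := {f | (∀ x : (Z.universalCover z).V, (f • x).1 = x.1) ∧
    ∀ t : (Z.universalCover z).E, (f • t).1.2.1 = t.1.2.1}
  one_mem' := by simp
  mul_mem' := by
    rintro f g ⟨h1, h2⟩ ⟨k1, k2⟩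
    exact ⟨fun x => by rw [mul_smul, h1, k1], fun t => by rw [mul_smul, h2, k2]⟩
  inv_mem' := by
    rintro f ⟨h1, h2⟩
    refine ⟨fun x => ?_, fun t => ?_⟩
    · have := h1 (f⁻¹ • x)
      rw [smul_inv_smul] at this
      exact this.symm
    · have := h2 (f⁻¹ • t)
      rw [smul_inv_smul] at this
      exact this.symm

end SquareComplex

/-! ### Anti-tori and the complex built from one -/

/-- Elements `g₁`, `g₂` of a group acting on a product of trees form an anti-torus, with axes
`ℓ₁ × {p₂}` and `{p₁} × ℓ₂`, where `p₁ = ℓ₁ 0` and `p₂ = ℓ₂ 0`: they translate along these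
axes by the positive distances `m₁`, `m₂`, and no nonzero powers of them commute. -/
structure IsAntiTorus {Γ : Type v} [Group Γ] {V₁ V₂ : Type u} {T₁ : SimpleGraph V₁}
    {T₂ : SimpleGraph V₂} (ρ : Γ →* (SquareComplex.prod T₁ T₂).Aut) (g₁ g₂ : Γ)
    (ℓ₁ : ℤ → V₁) (ℓ₂ : ℤ → V₂) (m₁ m₂ : ℕ) : Prop where
  inj₁ : Function.Injective ℓ₁
  inj₂ : Function.Injective ℓ₂
  adj₁ : ∀ n, T₁.Adj (ℓ₁ n) (ℓ₁ (n + 1))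
  adj₂ : ∀ n, T₂.Adj (ℓ₂ n) (ℓ₂ (n + 1))
  pos₁ : 0 < m₁
  pos₂ : 0 < m₂
  translate₁ : ∀ n : ℤ, ρ g₁ • SquareComplex.prodVertex T₁ T₂ (ℓ₁ n) (ℓ₂ 0) =
    SquareComplex.prodVertex T₁ T₂ (ℓ₁ (n + m₁)) (ℓ₂ 0)
  translate₂ : ∀ n : ℤ, ρ g₂ • SquareComplex.prodVertex T₁ T₂ (ℓ₁ 0) (ℓ₂ n) =
    SquareComplex.prodVertex T₁ T₂ (ℓ₁ 0) (ℓ₂ (n + m₂))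
  not_commute : ∀ a b : ℤ, a ≠ 0 → b ≠ 0 → ¬ Commute (g₁ ^ a) (g₂ ^ b)

/-- `g` is a proper power. -/
def IsProperPower {Γ : Type v} [Group Γ] (g : Γ) : Prop := ∃ (h : Γ) (n : ℕ), 2 ≤ n ∧ h ^ n = g

namespace IsAntiTorus

variable {Γ : Type v} [Group Γ] {V₁ V₂ : Type u} {T₁ : SimpleGraph V₁} {T₂ : SimpleGraph V₂}
  {ρ : Γ →* (SquareComplex.prod T₁ T₂).Aut} {g₁ g₂ : Γ} {ℓ₁ : ℤ → V₁} {ℓ₂ : ℤ → V₂} {m₁ m₂ : ℕ}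

/-- The `w₁`-loop: the image in the quotient of the segment of `ℓ₁ × {p₂}` from `(p₁, p₂)` to
`g₁ (p₁, p₂)`. -/
def loop (h : IsAntiTorus ρ g₁ g₂ ℓ₁ ℓ₂ m₁ m₂) (hρ : SquareComplex.IsFree ρ) (i : ZMod m₁) :
    (SquareComplex.quotient ρ hρ).E :=
  Quotient.mk _ (Sum.inl (⟨(ℓ₁ (i.val : ℤ), ℓ₁ ((i.val : ℤ) + 1)), h.adj₁ _⟩, ℓ₂ 0))

theorem loop_closed (h : IsAntiTorus ρ g₁ g₂ ℓ₁ ℓ₂ m₁ m₂) (hρ : SquareComplex.IsFree ρ)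
    (i : ZMod m₁) :
    (SquareComplex.quotient ρ hρ).tgt (h.loop hρ i) =
      (SquareComplex.quotient ρ hρ).src (h.loop hρ (i + 1)) := by
  have : NeZero m₁ := ⟨h.pos₁.ne'⟩
  have hlt : i.val < m₁ := ZMod.val_lt i
  have hv : (i + 1).val = (i.val + 1) % m₁ := by
    rw [ZMod.val_add, ZMod.val_one_eq_one_mod, Nat.add_mod_mod]
  change Quotient.mk (SquareComplex.vertexOrbit ρ)
      (SquareComplex.prodVertex T₁ T₂ (ℓ₁ ((i.val : ℤ) + 1)) (ℓ₂ 0)) =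
    Quotient.mk (SquareComplex.vertexOrbit ρ)
      (SquareComplex.prodVertex T₁ T₂ (ℓ₁ (((i + 1).val : ℕ) : ℤ)) (ℓ₂ 0))
  rcases Nat.lt_or_ge (i.val + 1) m₁ with hi | hi
  · rw [hv, Nat.mod_eq_of_lt hi]
    push_cast
    rfl
  · have hm : i.val + 1 = m₁ := by omega
    rw [hv, hm, Nat.mod_self]
    symm
    apply Quotient.sound
    change ∃ g, ρ g • _ = _
    refine ⟨g₁, ?_⟩
    have h0 : ((0 : ℤ) + (m₁ : ℤ)) = (i.val : ℤ) + 1 := by omega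
    have h1 := h.translate₁ 0
    rw [h0] at h1
    exact_mod_cast h1

/-- The complex `Y / Λ`: an annulus is attached to the quotient of the product of trees, with both of
its boundary circles glued along the `w₁`-loop. -/
def base (h : IsAntiTorus ρ g₁ g₂ ℓ₁ ℓ₂ m₁ m₂) (hρ : SquareComplex.IsFree ρ) :
    SquareComplex.{u} :=
  (SquareComplex.quotient ρ hρ).attachAnnulus m₁ (h.loop hρ) (h.loop_closed hρ)

/-- The base point of `Y / Λ`: the image of `(p₁, p₂)`. -/
def basePoint (h : IsAntiTorus ρ g₁ g₂ ℓ₁ ℓ₂ m₁ m₂) (hρ : SquareComplex.IsFree ρ) :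
    (h.base hρ).V :=
  Quotient.mk (SquareComplex.vertexOrbit ρ) (SquareComplex.prodVertex T₁ T₂ (ℓ₁ 0) (ℓ₂ 0))

/-- The complex `Y`: the universal cover. -/
def Y (h : IsAntiTorus ρ g₁ g₂ ℓ₁ ℓ₂ m₁ m₂) (hρ : SquareComplex.IsFree ρ) :
    SquareComplex.{u} :=
  (h.base hρ).universalCover (h.basePoint hρ)

/-- The group of deck transformations of `Y`. -/
def deck (h : IsAntiTorus ρ g₁ g₂ ℓ₁ ℓ₂ m₁ m₂) (hρ : SquareComplex.IsFree ρ) :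
    Subgroup (h.Y hρ).Aut :=
  (h.base hρ).deck (h.basePoint hρ)

end IsAntiTorus

/-! Write X for the product of the two trees. By the link condition `Y` is CAT(0): the loop `w₁` is
the image of a geodesic of X, so gluing the annulus along it creates no double edges or triangles in
links. The deck group is found by labelling the edges of the base with elements of `Λ` so that the
product around each square is trivial. Products of labels along paths then form an equivariant map
from the vertices of `Y` to `Λ` (`lab_smul`), which gives freeness and injectivity. Surjectivity
holds because the translates of one lifted copy of X contain all vertices of `Y`
(`exists_smul_liftV`).

Acylindricity is refuted by the powers of h = g₁ t c, where c = g₂ⁿ and n is such that c fixes a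
long segment of `ℓ₁`; such n exists because `g₂` fixes `p₁` and `T₁` is locally finite. Let W be the
hyperplane dual to the edges that cross the strip over the axis of `g₁`, and let the walls be the
translates hᵏW.

Small displacement: c fixes the hyperplanes dual to the edges of the fixed segment, t fixes those
dual to the edges of the axis since they run across the strip, and `g₁` shifts the axis. So hⁱ
carries the hyperplane of the edge 0 of the axis to that of the edge i·m₁, as long as the fixed
segment reaches that far (`elt_pow_smul_dual_liftE`). Both of these edges start on the strip, so W
and hⁱW are in contact with one and the same hyperplane, and hⁱ moves every wall by at most 2
(`dist_wall_le`).

Large distance: the walls do not cross each other and separate the successive translates of the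
origin (`side_elt_pow`), so a path in the contact graph between two walls meets the star of every
wall in between (`exists_mem_support_crosses`). Unless walls that are M apart have disjoint stars,
some hyperplane crosses more than M consecutive walls. Killing t folds `Y` onto X, and the image of
such a hyperplane shows that g₁c carries edges of `ℓ₁` to edges of `ℓ₁`, M times in succession
(`exists_shift_of_crosses`). In the tree `T₁` this forces c to fix `ℓ₁` as far as g₁ˢp₁ or g₁⁻ˢp₁,
where s depends on n only and is chosen such that g₁ˢ fixes g₂⁻ⁿp₂. Then a corner of a rectangle
closes up and g₁^±ˢ commutes with g₂ⁿ (`apply_ne_of_zpow_smul_eq`), contrary to the definition of an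
anti-torus. Hence distances between walls are unbounded (`le_dist_wall`).

Existence of an example: rational rotations given by quaternions of norm 3 and of norm 5 generate a
group that acts simply transitively on the vertices of a product of two trees (`interchange`). One
rotation of each kind gives an anti-torus (`not_commute`), and the concrete construction applies. -/

theorem SameSquare.cases_eq {E : Type u} {inv : E → E} (hinv : ∀ e, inv (inv e) = e)
    {a b c d e f g h : E} (hs : SameSquare inv a b c d e f g h) :
    (e = a ∧ f = b ∧ g = c ∧ h = d) ∨ (e = b ∧ f = c ∧ g = d ∧ h = a) ∨
    (e = c ∧ f = d ∧ g = a ∧ h = b) ∨ (e = d ∧ f = a ∧ g = b ∧ h = c) ∨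
    (e = inv d ∧ f = inv c ∧ g = inv b ∧ h = inv a) ∨
    (e = inv c ∧ f = inv b ∧ g = inv a ∧ h = inv d) ∨
    (e = inv b ∧ f = inv a ∧ g = inv d ∧ h = inv c) ∨
    (e = inv a ∧ f = inv d ∧ g = inv c ∧ h = inv b) := by
  induction hs with
  | refl => simp
  | rot _ ih =>
    rcases ih with ⟨rfl, rfl, rfl, rfl⟩ | ⟨rfl, rfl, rfl, rfl⟩ | ⟨rfl, rfl, rfl, rfl⟩ |
      ⟨rfl, rfl, rfl, rfl⟩ | ⟨rfl, rfl, rfl, rfl⟩ | ⟨rfl, rfl, rfl, rfl⟩ | ⟨rfl, rfl, rfl, rfl⟩ |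
      ⟨rfl, rfl, rfl, rfl⟩ <;> simp
  | rev _ ih =>
    rcases ih with ⟨rfl, rfl, rfl, rfl⟩ | ⟨rfl, rfl, rfl, rfl⟩ | ⟨rfl, rfl, rfl, rfl⟩ |
      ⟨rfl, rfl, rfl, rfl⟩ | ⟨rfl, rfl, rfl, rfl⟩ | ⟨rfl, rfl, rfl, rfl⟩ | ⟨rfl, rfl, rfl, rfl⟩ |
      ⟨rfl, rfl, rfl, rfl⟩ <;> simp [hinv]

namespace SquareComplex

/-! ### Calculus of edge paths up to homotopy -/

section Homotopy

variable {X : SquareComplex.{u}}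

theorem tgt_inv (e : X.E) : X.tgt (X.inv e) = X.src e := by simp [tgt, X.inv_inv]

theorem Sq.tgt_eq {a b c d : X.E} (h : X.Sq a b c d) :
    X.tgt a = X.src b ∧ X.tgt b = X.src c ∧ X.tgt c = X.src d ∧ X.tgt d = X.src a :=
  ⟨X.sq_path _ _ _ _ h, X.sq_path _ _ _ _ (X.sq_rot _ _ _ _ h),
    X.sq_path _ _ _ _ (X.sq_rot _ _ _ _ (X.sq_rot _ _ _ _ h)),
    X.sq_path _ _ _ _ (X.sq_rot _ _ _ _ (X.sq_rot _ _ _ _ (X.sq_rot _ _ _ _ h)))⟩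

theorem isPath_nil (x : X.V) : X.IsPath x [] x := rfl

theorem isPath_append {l l' : List X.E} : ∀ {x z : X.V},
    X.IsPath x (l ++ l') z ↔ ∃ y, X.IsPath x l y ∧ X.IsPath y l' z := by
  induction l with
  | nil => intro x z; simp [IsPath]
  | cons a l ih => intro x z; simp [IsPath, ih, and_assoc]

theorem IsPath.append {l l' : List X.E} {x y z : X.V} (h : X.IsPath x l y)
    (h' : X.IsPath y l' z) : X.IsPath x (l ++ l') z :=
  isPath_append.2 ⟨y, h, h'⟩

theorem IsPath.end_unique {l : List X.E} : ∀ {x y z : X.V}, X.IsPath x l y → X.IsPath x l z →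
    y = z := by
  induction l with
  | nil => intro x y z h h'; exact h.symm.trans h'
  | cons a l ih => intro x y z h h'; exact ih h.2 h'.2

theorem isPath_singleton {e : X.E} {x y : X.V} :
    X.IsPath x [e] y ↔ X.src e = x ∧ X.tgt e = y := Iff.rfl

theorem IsPath.step {l l' : List X.E} {x y : X.V} (hs : X.Step l l') (h : X.IsPath x l y) :
    X.IsPath x l' y := by
  cases hs with
  | backtrack l l' e =>
    obtain ⟨a, ⟨b, h1, h2⟩, h3⟩ := by simpa only [isPath_append] using h
    obtain ⟨rfl, -, h5⟩ := h2
    rw [← h5, tgt_inv] at h3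
    exact h1.append h3
  | square l l' a b c d hq =>
    obtain ⟨z, ⟨t, h1, h2⟩, h3⟩ := by simpa only [isPath_append] using h
    obtain ⟨rfl, -, -, -, h5⟩ := h2
    rw [← h5, (Sq.tgt_eq hq).2.2.2] at h3
    exact h1.append h3

/-- Homotopy, relative to the end points, of edge paths from `x` to `y`. -/
def Htpy (X : SquareComplex.{u}) (x y : X.V) (l l' : List X.E) : Prop :=
  ∃ (h : X.IsPath x l y) (h' : X.IsPath x l' y), X.pathClass l h = X.pathClass l' h'

namespace Htpy

variable {x y z : X.V} {l l' l'' m m' : List X.E}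

theorem left (h : X.Htpy x y l l') : X.IsPath x l y := h.1

theorem right (h : X.Htpy x y l l') : X.IsPath x l' y := h.2.1

theorem refl (h : X.IsPath x l y) : X.Htpy x y l l := ⟨h, h, rfl⟩

theorem symm (h : X.Htpy x y l l') : X.Htpy x y l' l := ⟨h.2.1, h.1, h.2.2.symm⟩

theorem trans (h : X.Htpy x y l l') (h' : X.Htpy x y l' l'') : X.Htpy x y l l'' :=
  ⟨h.1, h'.2.1, h.2.2.trans h'.2.2⟩

theorem of_step (hs : X.Step l l') (h : X.IsPath x l y) : X.Htpy x y l l' :=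
  ⟨h, h.step hs, Quot.sound hs⟩

/-- Equality of classes is a zigzag of elementary homotopies between paths with the same two ends,
so an equivalence relation on paths that contains these contains homotopy. -/
theorem induction {r : List X.E → List X.E → Prop} (hrefl : ∀ l, X.IsPath x l y → r l l)
    (hsymm : ∀ l l', r l l' → r l' l) (htrans : ∀ l l' l'', r l l' → r l' l'' → r l l'')
    (hstep : ∀ l l', X.IsPath x l y → X.Step l l' → r l l') (h : X.Htpy x y l l') : r l l' := by
  obtain ⟨h, h', e⟩ := h
  have key : ∀ p q : X.Path x y,
      Relation.EqvGen (fun p q : X.Path x y => X.Step p.1 q.1) p q → r p.1 q.1 := by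
    intro p q hpq
    induction hpq with
    | rel p q h => exact hstep _ _ p.2 h
    | refl p => exact hrefl _ p.2
    | symm p q _ ih => exact hsymm _ _ ih
    | trans p q s _ _ ih ih' => exact htrans _ _ _ ih ih'
  exact key ⟨l, h⟩ ⟨l', h'⟩ (Quot.eqvGen_exact e)

theorem _root_.SquareComplex.Step.append_left (hs : X.Step l l') (m : List X.E) :
    X.Step (m ++ l) (m ++ l') := by
  cases hs with
  | backtrack k k' e => simpa using Step.backtrack (m ++ k) k' e
  | square k k' a b c d h => simpa using Step.square (m ++ k) k' a b c d h

theorem _root_.SquareComplex.Step.append_right (hs : X.Step l l') (m : List X.E) :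
    X.Step (l ++ m) (l' ++ m) := by
  cases hs with
  | backtrack k k' e => simpa using Step.backtrack k (k' ++ m) e
  | square k k' a b c d h => simpa using Step.square k (k' ++ m) a b c d h

theorem append_left (hm : X.IsPath x m y) (h : X.Htpy y z l l') :
    X.Htpy x z (m ++ l) (m ++ l') :=
  induction (r := fun l l' => X.Htpy x z (m ++ l) (m ++ l')) (fun _ h => refl (hm.append h))
    (fun _ _ => symm) (fun _ _ _ => trans)
    (fun _ _ h hs => of_step (hs.append_left m) (hm.append h)) h

theorem append_right (h : X.Htpy x y l l') (hm : X.IsPath y m z) :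
    X.Htpy x z (l ++ m) (l' ++ m) :=
  induction (r := fun l l' => X.Htpy x z (l ++ m) (l' ++ m)) (fun _ h => refl (h.append hm))
    (fun _ _ => symm) (fun _ _ _ => trans)
    (fun _ _ h hs => of_step (hs.append_right m) (h.append hm)) h

theorem backtrack {e : X.E} (h : X.src e = x) : X.Htpy x x [e, X.inv e] [] := by
  subst h
  exact of_step (Step.backtrack [] [] e) ⟨rfl, rfl, tgt_inv e⟩

theorem backtrack' {e : X.E} (h : X.tgt e = x) : X.Htpy x x [X.inv e, e] [] := by
  have := backtrack (e := X.inv e) (x := x) h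
  rwa [X.inv_inv] at this

end Htpy

/-- The reversed edge path. -/
def invPath (X : SquareComplex.{u}) (l : List X.E) : List X.E := (l.map X.inv).reverse

theorem IsPath.inv {l : List X.E} : ∀ {x y : X.V}, X.IsPath x l y →
    X.IsPath y (X.invPath l) x := by
  induction l with
  | nil => intro x y h; exact h.symm
  | cons a l ih =>
    intro x y h
    simp only [invPath, List.map_cons, List.reverse_cons]
    refine (ih h.2).append (isPath_singleton.2 ⟨rfl, ?_⟩)
    rw [tgt_inv, h.1]

theorem Htpy.append_inv {l : List X.E} : ∀ {x y : X.V}, X.IsPath x l y →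
    X.Htpy x x (l ++ X.invPath l) [] := by
  induction l with
  | nil => intro x y h; exact .refl rfl
  | cons a l ih =>
    intro x y h
    have h1 := ((ih h.2).append_left (m := [a]) (isPath_singleton.2 ⟨h.1, rfl⟩)).append_right
      (m := [X.inv a]) (z := x) (isPath_singleton.2 ⟨rfl, by rw [tgt_inv, h.1]⟩)
    have h2 := h1.trans (Htpy.backtrack h.1)
    simpa [invPath] using h2

theorem invPath_invPath (l : List X.E) : X.invPath (X.invPath l) = l := by
  simp [invPath, List.map_reverse, Function.comp_def, X.inv_inv]

theorem Htpy.inv_append {l : List X.E} {x y : X.V} (h : X.IsPath x l y) :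
    X.Htpy y y (X.invPath l ++ l) [] := by
  have := Htpy.append_inv h.inv
  rwa [invPath_invPath] at this

theorem Htpy.of_append_inv {l l' : List X.E} {x y : X.V} (h' : X.IsPath x l' y)
    (h : X.Htpy x x (l ++ X.invPath l') []) : X.Htpy x y l l' := by
  obtain ⟨y', hl, hl'⟩ := isPath_append.1 h.left
  obtain rfl : y = y' := by
    have h1 := hl'.inv
    rw [invPath_invPath] at h1
    exact h'.end_unique h1
  have h1 := h.append_right h'
  have h2 := (Htpy.inv_append h').append_left hl
  simp only [List.append_nil, List.append_assoc, List.nil_append] at h1 h2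
  exact h2.symm.trans h1

theorem Htpy.cancel_left {m l l' : List X.E} {x y z : X.V} (hm : X.IsPath x m y)
    (h : X.Htpy x z (m ++ l) (m ++ l')) : X.Htpy y z l l' := by
  have h0 := h.append_left hm.inv
  have key : ∀ k, X.IsPath x (m ++ k) z → X.Htpy y z (X.invPath m ++ (m ++ k)) k := by
    intro k hk
    obtain ⟨y', h1, h2⟩ := isPath_append.1 hk
    obtain rfl := hm.end_unique h1
    simpa using (Htpy.inv_append hm).append_right h2
  exact (key _ h.left).symm.trans (h0.trans (key _ h.right))

theorem Htpy.of_sq {a b c d : X.E} (h : X.Sq a b c d) :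
    X.Htpy (X.src a) (X.src a) [a, b, c, d] [] := by
  obtain ⟨h1, h2, h3, h4⟩ := Sq.tgt_eq h
  exact .of_step (.square [] [] a b c d h) ⟨rfl, h1.symm, h2.symm, h3.symm, h4⟩

/-- Two adjacent sides of a square are homotopic to the other two. -/
theorem Htpy.of_sq_half {a b c d : X.E} (h : X.Sq a b (X.inv c) (X.inv d)) :
    X.Htpy (X.src a) (X.tgt b) [a, b] [d, c] := by
  obtain ⟨h1, h2, h3, h4⟩ := Sq.tgt_eq h
  refine .of_append_inv ?_ (by simpa [invPath] using Htpy.of_sq h)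
  rw [tgt_inv] at h3 h4
  exact ⟨h4, h3, h2.symm⟩

/-- Products of edge labels are homotopy invariant, if they are trivial around squares. -/
theorem Htpy.prod_eq {G : Type*} [Group G] {f : X.E → G} (hinv : ∀ e, f (X.inv e) = (f e)⁻¹)
    (hsq : ∀ a b c d, X.Sq a b c d → f a * f b * f c * f d = 1) {x y : X.V} {l l' : List X.E}
    (h : X.Htpy x y l l') : (l.map f).prod = (l'.map f).prod := by
  refine Htpy.induction (r := fun l l' => (l.map f).prod = (l'.map f).prod) (fun _ _ => rfl)
    (fun _ _ => Eq.symm) (fun _ _ _ => Eq.trans) ?_ h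
  rintro _ _ - (⟨l, l', e⟩ | ⟨l, l', a, b, c, d, hq⟩)
  · simp [hinv]
  · have := hsq _ _ _ _ hq
    simp [← mul_assoc, this]

theorem IsSimplyConnected.htpy (hX : X.IsSimplyConnected) {x y : X.V} {l l' : List X.E}
    (h : X.IsPath x l y) (h' : X.IsPath x l' y) : X.Htpy x y l l' :=
  .of_append_inv h' ⟨_, _, hX.2.2 x _ (h.append h'.inv)⟩

/-- A complex is simply connected if there are paths from a base point to all vertices that are
compatible, up to homotopy, with the edges. -/
theorem isSimplyConnected_of_paths (x₀ : X.V) (c : X.V → List X.E)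
    (hc : ∀ x, X.IsPath x₀ (c x) x)
    (he : ∀ e, X.Htpy x₀ (X.tgt e) (c (X.src e) ++ [e]) (c (X.tgt e))) :
    X.IsSimplyConnected := by
  -- Compatibility with single edges telescopes along a path. For a closed path at `x` the factor `c
  -- x` can then be cancelled on the left.
  have key : ∀ (l : List X.E) (x y : X.V), X.IsPath x l y → X.Htpy x₀ y (c x ++ l) (c y) := by
    intro l
    induction l with
    | nil => rintro x _ rfl; simpa using Htpy.refl (hc x)
    | cons a l ih =>
      rintro x y ⟨rfl, h⟩
      have h1 := ((he a).append_right h).trans (ih _ _ h)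
      simpa using h1
  refine ⟨⟨x₀⟩, fun x y => ⟨_, (hc x).inv.append (hc y)⟩, fun x l h => ?_⟩
  have h1 := key l x x h
  obtain ⟨_, _, h2⟩ := Htpy.cancel_left (l' := []) (hc x) (by simpa using h1)
  exact h2

end Homotopy

/-! ### Morphisms -/

/-- Cellular maps that send edges to edges and squares to squares. -/
structure Hom (X : SquareComplex.{u}) (Y : SquareComplex.{v}) where
  onV : X.V → Y.V
  onE : X.E → Y.E
  src : ∀ e, Y.src (onE e) = onV (X.src e)
  inv : ∀ e, onE (X.inv e) = Y.inv (onE e)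
  sq : ∀ a b c d, X.Sq a b c d → Y.Sq (onE a) (onE b) (onE c) (onE d)

namespace Hom

variable {X : SquareComplex.{u}} {Y : SquareComplex.{v}} (f : Hom X Y)

theorem tgt (e : X.E) : Y.tgt (f.onE e) = f.onV (X.tgt e) := by
  rw [SquareComplex.tgt, ← f.inv, f.src]; rfl

theorem isPath {l : List X.E} : ∀ {x y : X.V}, X.IsPath x l y →
    Y.IsPath (f.onV x) (l.map f.onE) (f.onV y) := by
  induction l with
  | nil => intro x y h; exact congrArg f.onV h
  | cons a l ih =>
    rintro x y ⟨rfl, h⟩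
    refine ⟨f.src a, ?_⟩
    rw [f.tgt]
    exact ih h

theorem htpy {x y : X.V} {l l' : List X.E} (h : X.Htpy x y l l') :
    Y.Htpy (f.onV x) (f.onV y) (l.map f.onE) (l'.map f.onE) := by
  refine h.induction (r := fun l l' => Y.Htpy (f.onV x) (f.onV y) (l.map f.onE) (l'.map f.onE))
    (fun _ h => .refl (f.isPath h)) (fun _ _ => .symm) (fun _ _ _ => .trans) ?_
  intro l l' h hs
  refine .of_step ?_ (f.isPath h)
  cases hs with
  | backtrack k k' e => simpa [f.inv] using Step.backtrack (k.map f.onE) (k'.map f.onE) (f.onE e)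
  | square k k' a b c d hq =>
    simpa using Step.square (k.map f.onE) (k'.map f.onE) _ _ _ _ (f.sq _ _ _ _ hq)

theorem dual_eq {e e' : X.E} (h : X.dual e = X.dual e') : Y.dual (f.onE e) = Y.dual (f.onE e') := by
  have key := Quot.eqvGen_exact h
  clear h
  induction key with
  | rel a b h =>
    rcases h with rfl | ⟨c, d, h⟩
    · rw [f.inv]; exact Quot.sound (.inl rfl)
    · exact Quot.sound (.inr ⟨_, _, f.sq _ _ _ _ h⟩)
  | refl => rfl
  | symm _ _ _ ih => exact ih.symm
  | trans _ _ _ _ _ ih ih' => exact ih.trans ih'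

/-- Composition of cellular maps. -/
def comp {Z : SquareComplex.{u}} (g : Hom Y Z) (f : Hom X Y) : Hom X Z where
  onV := g.onV ∘ f.onV
  onE := g.onE ∘ f.onE
  src e := by simp [f.src, g.src]
  inv e := by simp [f.inv, g.inv]
  sq a b c d h := g.sq _ _ _ _ (f.sq _ _ _ _ h)

/-- An automorphism as a cellular map. -/
def ofAut (a : X.Aut) : Hom X X where
  onV x := a • x
  onE e := a • e
  src e := src_smul a e
  inv e := (inv_smul a e).symm
  sq _ _ _ _ h := (sq_smul a _ _ _ _).2 h

end Hom

/-! ### Hyperplanes separate -/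

section Separation

variable {X : SquareComplex.{u}}

theorem dual_inv (e : X.E) : X.dual (X.inv e) = X.dual e := (Quot.sound (.inl rfl)).symm

theorem Sq.dual_eq {a b c d : X.E} (h : X.Sq a b c d) : X.dual a = X.dual c ∧ X.dual b = X.dual d :=
  ⟨Quot.sound (.inr ⟨b, d, h⟩), Quot.sound (.inr ⟨c, a, X.sq_rot _ _ _ _ h⟩)⟩

theorem tgt_smul (f : X.Aut) (e : X.E) : X.tgt (f • e) = f • X.tgt e := by
  rw [tgt, inv_smul, src_smul]; rfl

theorem smul_dual (f : X.Aut) (e : X.E) : f • X.dual e = X.dual (f • e) := rfl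

/-- Functions on edges that agree on parallel edges are functions of the dual hyperplane. -/
theorem eq_of_dual_eq {α : Type*} (f : X.E → α) (hinv : ∀ e, f (X.inv e) = f e)
    (hsq : ∀ a b c d, X.Sq a b c d → f c = f a) {e e' : X.E} (h : X.dual e = X.dual e') :
    f e = f e' := by
  have : ∀ a b, X.Parallel a b → f a = f b := by
    rintro a b (rfl | ⟨c, d, h⟩)
    · exact (hinv a).symm
    · exact (hsq _ _ _ _ h).symm
  exact congrArg (Quot.lift f this) h

open Classical in
/-- In a simply connected complex, each hyperplane has two sides. -/
theorem IsSimplyConnected.exists_side (hX : X.IsSimplyConnected) (K : X.Hyperplane) :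
    ∃ σ : X.V → ZMod 2, ∀ e, σ (X.tgt e) = σ (X.src e) + if X.dual e = K then 1 else 0 := by
  obtain ⟨x₀⟩ := hX.1
  choose c hc using hX.2.1 x₀
  -- The side of a vertex is the parity of the number of crossings of `K` on a path to it from `x₀`.
  -- The parity is independent of the path because opposite sides of a square are dual to the same
  -- hyperplane, so a square contributes an even number of crossings. It is written multiplicatively
  -- to suit `Htpy.prod_eq`.
  let f : X.E → Multiplicative (ZMod 2) := fun e => .ofAdd (if X.dual e = K then 1 else 0)
  have hf : ∀ e, f e * f e = 1 := by
    intro e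
    change Multiplicative.ofAdd ((if X.dual e = K then 1 else 0 : ZMod 2) +
      (if X.dual e = K then 1 else 0)) = Multiplicative.ofAdd 0
    rw [CharTwo.add_self_eq_zero]
  refine ⟨fun x => (((c x).map f).prod).toAdd, fun e => ?_⟩
  have h := Htpy.prod_eq (f := f) (fun e => ?_) (fun a b c d h => ?_)
    (hX.htpy (hc (X.tgt e)) ((hc (X.src e)).snoc e))
  · simp only [h, List.map_append, List.prod_append, List.map_cons, List.map_nil,
      List.prod_singleton, toAdd_mul]
    rfl
  · have : f (X.inv e) = f e := by simp only [f, dual_inv]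
    rw [this, eq_inv_iff_mul_eq_one, hf]
  · have h1 : f c = f a := by simp only [f, (Sq.dual_eq h).1]
    have h2 : f d = f b := by simp only [f, (Sq.dual_eq h).2]
    rw [h1, h2, mul_assoc, mul_assoc, mul_left_comm (f b), hf, mul_one, hf]

/-- Two hyperplanes cross. -/
def Crosses (X : SquareComplex.{u}) (H K : X.Hyperplane) : Prop :=
  ∃ a b c d, X.Sq a b c d ∧ X.dual a = H ∧ X.dual b = K

open Classical in
/-- The carrier of a hyperplane that does not cross `K` lies on one side of `K`. -/
theorem side_eq_of_not_crosses {H K : X.Hyperplane} {σ : X.V → ZMod 2}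
    (hσ : ∀ e, σ (X.tgt e) = σ (X.src e) + if X.dual e = K then 1 else 0)
    (hne : H ≠ K) (hc : ¬ X.Crosses H K) {e f : X.E} (he : X.dual e = H) (hf : X.dual f = H) :
    σ (X.src e) = σ (X.src f) := by
  have key := Quot.eqvGen_exact (he.trans hf.symm)
  clear hf
  induction key with
  | rel a b h =>
    rcases h with rfl | ⟨c, d, h⟩
    · have := hσ a
      rw [he, if_neg hne, add_zero] at this
      exact this.symm
    · have h1 := hσ a
      have h2 := hσ c
      rw [he, if_neg hne, add_zero] at h1
      rw [if_neg (fun hK => hc ⟨a, c, b, d, h, he, hK⟩), add_zero, (Sq.tgt_eq h).2.1,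
        ← (Sq.tgt_eq h).1] at h2
      rw [h2, h1]
  | refl => rfl
  | symm a b h ih => exact (ih ((Quot.eqvGen_sound h).trans he)).symm
  | trans a b c h h' ih ih' => exact (ih he).trans (ih' ((Quot.eqvGen_sound h).symm.trans he))

open Classical in
/-- A path in the contact graph between carriers on different sides of `K` meets the star
of `K`. -/
theorem exists_mem_support_crosses {K : X.Hyperplane} {σ : X.V → ZMod 2}
    (hσ : ∀ e, σ (X.tgt e) = σ (X.src e) + if X.dual e = K then 1 else 0)
    {H H' : X.Hyperplane} (w : X.contactGraph.Walk H H') : ∀ {e f : X.E}, X.dual e = H →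
    X.dual f = H' → σ (X.src e) ≠ σ (X.src f) → ∃ L ∈ w.support, L = K ∨ X.Crosses L K := by
  induction w with
  | @nil H =>
    intro e f he hf hne
    refine ⟨H, by simp, ?_⟩
    by_contra! h
    exact hne (side_eq_of_not_crosses hσ h.1 h.2 he hf)
  | @cons H L H' hadj w ih =>
    intro e f he hf hne
    have hadj' := hadj
    obtain ⟨-, a, b, ha, hb, hab⟩ := hadj'
    -- If `H` is not in the star of `K`, its carrier lies on one side of `K`. The starting vertex
    -- can therefore be moved to the point of contact with the next hyperplane.
    by_cases h : H = K ∨ X.Crosses H K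
    · exact ⟨H, by simp, h⟩
    · push Not at h
      rw [side_eq_of_not_crosses hσ h.1 h.2 he ha, hab] at hne
      obtain ⟨M, hM, h'⟩ := ih hb hf hne
      exact ⟨M, by simp [hM], h'⟩

/-- Reachability is recorded along with the bound since `dist` takes the value 0 between different
components, where a bound from above says nothing. -/
theorem contactGraph_dist_le_one {e f : X.E} (h : X.src e = X.src f) :
    X.contactGraph.Reachable (X.dual e) (X.dual f) ∧
      X.contactGraph.dist (X.dual e) (X.dual f) ≤ 1 := by
  by_cases hne : X.dual e = X.dual f
  · rw [hne]; simp
  · have hadj : X.contactGraph.Adj (X.dual e) (X.dual f) := ⟨hne, e, f, rfl, rfl, h⟩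
    exact ⟨hadj.reachable, (SimpleGraph.dist_eq_one_iff_adj.2 hadj).le⟩

theorem contactGraph_reachable (hX : X.IsSimplyConnected) (e f : X.E) :
    X.contactGraph.Reachable (X.dual e) (X.dual f) := by
  obtain ⟨l, hl⟩ := hX.2.1 (X.src e) (X.src f)
  induction l generalizing e with
  | nil => exact (contactGraph_dist_le_one hl).1
  | cons a l ih =>
    have h1 := (contactGraph_dist_le_one hl.1.symm).1
    have h2 := ih (X.inv a) hl.2
    rw [dual_inv] at h2
    exact h1.trans h2

theorem contactGraph_dist_le_two {e e' f f' : X.E} (h : X.src e = X.src f)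
    (hf : X.dual f = X.dual f') (h' : X.src f' = X.src e') :
    X.contactGraph.dist (X.dual e) (X.dual e') ≤ 2 := by
  obtain ⟨r, h1⟩ := contactGraph_dist_le_one h
  obtain ⟨r', h2⟩ := contactGraph_dist_le_one h'
  rw [hf] at r h1
  obtain ⟨p, hp⟩ := r.exists_walk_length_eq_dist
  obtain ⟨q, hq⟩ := r'.exists_walk_length_eq_dist
  have := SimpleGraph.dist_le (p.append q)
  rw [SimpleGraph.Walk.length_append] at this
  omega

end Separation

end SquareComplex

namespace SquareComplex

/-! ### Universal covers: unique lifting, homotopy lifting, simple connectedness -/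

namespace Cover

variable {Z : SquareComplex.{u}} {z : Z.V}

/-- The vertex of the universal cover given by an edge path from the base point. -/
def vtx {y : Z.V} (l : List Z.E) (h : Z.IsPath z l y) : (Z.universalCover z).V :=
  Z.coverVertex z y l h

/-- The vertex of `Z` below a vertex of the universal cover. -/
def endpt (x : (Z.universalCover z).V) : Z.V := x.1

theorem vtx_eq_iff {y : Z.V} {l l' : List Z.E} (h : Z.IsPath z l y)
    (h' : Z.IsPath z l' y) : vtx l h = vtx l' h' ↔ Z.Htpy z y l l' := by
  refine ⟨fun e => ⟨h, h', ?_⟩, fun e => congrArg (Sigma.mk y) e.2.2⟩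
  exact eq_of_heq (Sigma.mk.inj e).2

theorem exists_eq_vtx (x : (Z.universalCover z).V) :
    ∃ (l : List Z.E) (h : Z.IsPath z l (endpt x)), x = vtx l h := by
  obtain ⟨y, ⟨l, h⟩⟩ := x
  exact ⟨l, h, rfl⟩

/-- The base vertex of the universal cover. -/
def baseVertex (Z : SquareComplex.{u}) (z : Z.V) : (Z.universalCover z).V :=
  vtx (y := z) [] rfl

/-- The edge of `Z` below an edge of the universal cover. -/
def label (t : (Z.universalCover z).E) : Z.E := t.1.2.1

theorem src_label (t : (Z.universalCover z).E) :
    Z.src (label t) = endpt ((Z.universalCover z).src t) := by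
  obtain ⟨⟨x, e, y⟩, l, h, h1, -⟩ := t
  exact (congrArg Sigma.fst h1).symm

/-- The covering map. -/
def proj (Z : SquareComplex.{u}) (z : Z.V) : Hom (Z.universalCover z) Z where
  onV := endpt
  onE := label
  src := src_label
  inv _ := rfl
  sq _ _ _ _ h := h.1

/-- Uniqueness of lifts: the terminal vertex is the class of a path to the initial vertex followed
by the label, and appending an edge respects homotopy. -/
theorem edge_ext {a b : (Z.universalCover z).E}
    (h : (Z.universalCover z).src a = (Z.universalCover z).src b) (hl : label a = label b) :
    a = b := by
  obtain ⟨⟨x, e, y⟩, l, h1, hx, hy⟩ := a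
  obtain ⟨⟨x', e', y'⟩, l', h2, hx', hy'⟩ := b
  obtain rfl : e = e' := hl
  dsimp only at h1 hx hy h2 hx' hy'
  subst hx hx'
  have h3 : Z.Htpy z (Z.src e) l l' := (vtx_eq_iff h1 h2).1 h
  have h4 : vtx (l ++ [e]) (h1.snoc e) =
      vtx (l' ++ [e]) (h2.snoc e) :=
    (vtx_eq_iff _ _).2 (h3.append_right ⟨rfl, rfl⟩)
  apply Subtype.ext
  exact Prod.ext h (Prod.ext rfl (hy.trans (h4.trans hy'.symm)))

theorem exists_edge_vtx {y : Z.V} (l : List Z.E) (h : Z.IsPath z l y) (e : Z.E)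
    (he : Z.src e = y) : ∃ t : (Z.universalCover z).E,
      (Z.universalCover z).src t = vtx l h ∧ label t = e ∧
      (Z.universalCover z).tgt t =
        vtx (l ++ [e]) (h.append (isPath_singleton.2 ⟨he, rfl⟩)) := by
  subst he
  exact ⟨⟨(_, e, _), l, h, rfl, rfl⟩, rfl, rfl, rfl⟩

theorem exists_edge (x : (Z.universalCover z).V) (e : Z.E) (he : Z.src e = endpt x) :
    ∃ t : (Z.universalCover z).E, (Z.universalCover z).src t = x ∧ label t = e := by
  obtain ⟨l, h, hx⟩ := exists_eq_vtx x
  obtain ⟨t, h1, h2, -⟩ := exists_edge_vtx l h e he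
  exact ⟨t, h1.trans hx.symm, h2⟩

theorem exists_lift (l : List Z.E) : ∀ (x : (Z.universalCover z).V) {y : Z.V},
    Z.IsPath (endpt x) l y → ∃ (L : List (Z.universalCover z).E) (x' : (Z.universalCover z).V),
      (Z.universalCover z).IsPath x L x' ∧ L.map label = l := by
  induction l with
  | nil => intro x y _; exact ⟨[], x, rfl, rfl⟩
  | cons e l ih =>
    rintro x y ⟨he, h⟩
    obtain ⟨t, rfl, rfl⟩ := exists_edge x e he
    have h1 : endpt ((Z.universalCover z).tgt t) = Z.tgt (label t) := ((proj Z z).tgt t).symm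
    rw [← h1] at h
    obtain ⟨L, x', hL, hl⟩ := ih _ h
    exact ⟨t :: L, x', ⟨rfl, hL⟩, by simp [hl]⟩

theorem lift_unique (L : List (Z.universalCover z).E) : ∀ (L' : List (Z.universalCover z).E)
    {x a b : (Z.universalCover z).V}, (Z.universalCover z).IsPath x L a →
      (Z.universalCover z).IsPath x L' b → L.map label = L'.map label → L = L' := by
  induction L with
  | nil =>
    intro L' x a b _ _ h
    exact (List.map_eq_nil_iff.1 h.symm).symm
  | cons e L ih =>
    intro L' x a b h h' hl
    cases L' with
    | nil => simp at hl
    | cons e' L' =>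
      simp only [List.map_cons, List.cons.injEq] at hl
      obtain rfl := edge_ext (h.1.trans h'.1.symm) hl.1
      rw [ih L' h.2 h'.2 hl.2]

theorem lift_end (L : List (Z.universalCover z).E) :
    ∀ (l : List Z.E) {y : Z.V} (h : Z.IsPath z l y) {x : (Z.universalCover z).V},
    (Z.universalCover z).IsPath (vtx l h) L x →
      ∃ h', x = vtx (y := endpt x) (l ++ L.map label) h' := by
  induction L with
  | nil =>
    rintro l y h _ rfl
    have key : ∀ k, k = l → ∃ h', vtx l h = vtx (y := endpt (vtx l h)) k h' := by
      rintro _ rfl; exact ⟨h, rfl⟩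
    exact key _ (by simp)
  | cons e L ih =>
    rintro l y h x ⟨h1, h2⟩
    obtain ⟨t, h3, h4, h5⟩ := exists_edge_vtx l h (label e) (by rw [src_label, h1]; rfl)
    obtain rfl := edge_ext (h1.trans h3.symm) h4.symm
    rw [h5] at h2
    obtain ⟨h6, h7⟩ := ih _ _ h2
    simp only [List.append_assoc, List.singleton_append] at h6 h7
    exact ⟨h6, by simpa using h7⟩

/-- Homotopies lift one elementary step at a time. The two lifts are not assumed to have the same
end, since the lift of an intermediate path has an end that is not known beforehand; equality of the
ends is part of the conclusion. -/
theorem htpy_of_htpy_label {x : (Z.universalCover z).V} {y : Z.V} {p q : List Z.E}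
    (h : Z.Htpy (endpt x) y p q) :
    ∀ {L L' : List (Z.universalCover z).E} {a b : (Z.universalCover z).V},
      (Z.universalCover z).IsPath x L a → (Z.universalCover z).IsPath x L' b → L.map label = p →
      L'.map label = q → (Z.universalCover z).Htpy x a L L' := by
  have key := h.induction (r := fun p q => Z.IsPath (endpt x) p y ∧ Z.IsPath (endpt x) q y ∧
    ∀ {L L' : List (Z.universalCover z).E} {a b : (Z.universalCover z).V},
      (Z.universalCover z).IsPath x L a → (Z.universalCover z).IsPath x L' b → L.map label = p →
      L'.map label = q → (Z.universalCover z).Htpy x a L L')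
    (fun l hl => ⟨hl, hl, ?_⟩) (fun l l' hr => ⟨hr.2.1, hr.1, ?_⟩)
    (fun l l' l'' hr hr' => ⟨hr.1, hr'.2.1, ?_⟩) (fun l l' hl hs => ⟨hl, hl.step hs, ?_⟩)
  · intro L L' a b
    exact key.2.2
  · rintro L L' a b h1 h2 rfl h3
    obtain rfl := lift_unique _ _ h1 h2 h3.symm
    exact .refl h1
  · intro L L' a b h1 h2 h3 h4
    have h5 := hr.2.2 h2 h1 h4 h3
    obtain rfl := h5.right.end_unique h1
    exact h5.symm
  · intro L L' a b h1 h2 h3 h4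
    obtain ⟨M, c, hM, hM'⟩ := exists_lift l' x hr.2.1
    have h5 := hr.2.2 h1 hM h3 hM'
    exact h5.trans (hr'.2.2 h5.right h2 hM' h4)
  · intro L L' a b h1 h2 h3 h4
    have hstep : ∃ L'', (Z.universalCover z).Step L L'' ∧ L''.map label = l' := by
      cases hs with
      | backtrack k k' e =>
        obtain ⟨K, K', rfl, hK, rfl⟩ := List.map_eq_append_iff.1 h3
        obtain ⟨K₁, K₂, rfl, rfl, hK₂⟩ := List.map_eq_append_iff.1 hK
        obtain ⟨A, K₃, rfl, rfl, hK₃⟩ := List.map_eq_cons_iff.1 hK₂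
        obtain ⟨B, K₄, rfl, hB, hK₄⟩ := List.map_eq_cons_iff.1 hK₃
        obtain rfl := List.map_eq_nil_iff.1 hK₄
        obtain ⟨_, ⟨_, _, hp⟩, _⟩ := by simpa only [isPath_append] using h1
        obtain rfl : B = (Z.universalCover z).inv A := edge_ext hp.2.1 hB
        exact ⟨_, .backtrack _ _ _, by simp⟩
      | square k k' e f g i hq =>
        obtain ⟨K, K', rfl, hK, rfl⟩ := List.map_eq_append_iff.1 h3
        obtain ⟨K₁, K₂, rfl, rfl, hK₂⟩ := List.map_eq_append_iff.1 hK
        obtain ⟨A, K₃, rfl, rfl, hK₃⟩ := List.map_eq_cons_iff.1 hK₂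
        obtain ⟨B, K₄, rfl, rfl, hK₄⟩ := List.map_eq_cons_iff.1 hK₃
        obtain ⟨C, K₅, rfl, rfl, hK₅⟩ := List.map_eq_cons_iff.1 hK₄
        obtain ⟨D, K₆, rfl, rfl, hK₆⟩ := List.map_eq_cons_iff.1 hK₅
        obtain rfl := List.map_eq_nil_iff.1 hK₆
        obtain ⟨_, ⟨w, _, hp⟩, _⟩ := by simpa only [isPath_append] using h1
        obtain ⟨m, hm, hw⟩ := exists_eq_vtx w
        have hp' := hp
        rw [hw] at hp
        obtain ⟨h5, h6⟩ := lift_end _ _ _ hp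
        obtain ⟨hp1, hp2, hp3, hp4, hp5⟩ := hp'
        -- The lift of a square boundary closes up because appending such a boundary to a path does
        -- not change its class.
        have hend : (Z.universalCover z).tgt D = (Z.universalCover z).src A := by
          rw [hp5, hp1, h6, hw]
          have h7 : Z.src (label A) = endpt w := by rw [src_label, hp1]
          refine coverVertex_eq Z z _ _ ?_ (by simpa using Step.square m [] _ _ _ _ hq)
          have h8 := ((proj Z z).tgt D).symm
          rw [hp5] at h8
          exact h8.trans ((Sq.tgt_eq hq).2.2.2.trans h7)
        exact ⟨_, .square _ _ A B C D ⟨hq, hp2.symm, hp3.symm, hp4.symm, hend⟩, by simp⟩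
    obtain ⟨L'', hst, hl''⟩ := hstep
    obtain rfl := lift_unique _ _ (h1.step hst) h2 (hl''.trans h4.symm)
    exact .of_step hst h1

theorem isPath_of_label {y : Z.V} {l : List Z.E} (h : Z.IsPath z l y) :
    ∃ L, (Z.universalCover z).IsPath (baseVertex Z z) L (vtx l h) ∧
      L.map label = l := by
  obtain ⟨L, x, hL, rfl⟩ := exists_lift l (baseVertex Z z) h
  obtain ⟨h1, h2⟩ := lift_end L _ _ hL
  have h3 : y = endpt x := h.end_unique h1
  subst h3
  exact ⟨L, by rwa [h2] at hL, rfl⟩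

theorem exists_isPath (x y : (Z.universalCover z).V) :
    ∃ L, (Z.universalCover z).IsPath x L y := by
  have key : ∀ x, ∃ L, (Z.universalCover z).IsPath (baseVertex Z z) L x := by
    intro x
    obtain ⟨l, h, hx⟩ := exists_eq_vtx x
    obtain ⟨L, hL, -⟩ := isPath_of_label h
    exact ⟨L, hx ▸ hL⟩
  obtain ⟨L, hL⟩ := key x
  obtain ⟨L', hL'⟩ := key y
  exact ⟨_, hL.inv.append hL'⟩

/-- Let `l` represent `x`. A closed path at `x` with labels `k` ends at the class of `l ++ k`, so
its being closed says that `l ++ k` is homotopic to `l`. Cancelling `l` shows that `k` is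
null-homotopic, and this homotopy lifts. -/
theorem isSimplyConnected (Z : SquareComplex.{u}) (z : Z.V) :
    (Z.universalCover z).IsSimplyConnected := by
  refine ⟨⟨baseVertex Z z⟩, exists_isPath, fun x L h => ?_⟩
  obtain ⟨l, hl, hx⟩ := exists_eq_vtx x
  have h' := h
  nth_rw 1 [hx] at h'
  obtain ⟨h1, h2⟩ := lift_end L _ _ h'
  have h3 : Z.Htpy z (endpt x) (l ++ L.map label) (l ++ []) := by
    rw [List.append_nil, ← vtx_eq_iff h1 hl, ← h2, ← hx]
  exact (htpy_of_htpy_label (Htpy.cancel_left hl h3) h (L' := []) rfl rfl rfl).2.2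

theorem isNonPositivelyCurved (hZ : Z.IsNonPositivelyCurved) :
    (Z.universalCover z).IsNonPositivelyCurved := by
  have key : ∀ e f, (Z.universalCover z).LinkAdj e f → Z.LinkAdj (label e) (label f) := by
    rintro e f ⟨c, d, h⟩
    exact ⟨_, _, h.1⟩
  refine ⟨fun e h => hZ.no_loop _ (key _ _ h), ?_, ?_, ?_⟩
  · intro a b c d c' d' h h'
    obtain ⟨h1, h2⟩ := hZ.no_double _ _ _ _ _ _ h.1 h'.1
    obtain rfl : c = c' := edge_ext (h.2.2.1.symm.trans h'.2.2.1) h1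
    exact ⟨rfl, edge_ext (h.2.2.2.1.symm.trans h'.2.2.2.1) h2⟩
  · rintro a b c d h ⟨rfl, rfl⟩
    exact hZ.no_fold _ _ _ _ h.1 ⟨rfl, rfl⟩
  · rintro e f g ⟨h1, h2, h3⟩
    exact hZ.no_triangle _ _ _ ⟨key _ _ h1, key _ _ h2, key _ _ h3⟩

/-! ### Deck transformations -/

/-- Left translation of the vertices of the universal cover by a loop. -/
def translV (m : List Z.E) (hm : Z.IsPath z m z) (x : (Z.universalCover z).V) :
    (Z.universalCover z).V :=
  ⟨x.1, Quot.map (fun p => ⟨m ++ p.1, hm.append p.2⟩) (fun _ _ h => h.append_left m) x.2⟩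

theorem translV_vtx {m : List Z.E} (hm : Z.IsPath z m z) {y : Z.V} (l : List Z.E)
    (h : Z.IsPath z l y) : translV m hm (vtx l h) =
      vtx (m ++ l) (hm.append h) := rfl

theorem translV_translV {m m' : List Z.E} (hm : Z.IsPath z m z) (hm' : Z.IsPath z m' z)
    (h : Z.Htpy z z (m ++ m') []) (x : (Z.universalCover z).V) :
    translV m hm (translV m' hm' x) = x := by
  obtain ⟨l, hl, hx⟩ := exists_eq_vtx x
  rw [hx, translV_vtx, translV_vtx, vtx_eq_iff]
  simpa using h.append_right hl

theorem coverEdge_translV {m : List Z.E} (hm : Z.IsPath z m z) {x y : (Z.universalCover z).V}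
    {e : Z.E} (h : Z.CoverEdge z x e y) :
    Z.CoverEdge z (translV m hm x) e (translV m hm y) := by
  obtain ⟨l, hl, rfl, rfl⟩ := h
  refine ⟨m ++ l, hm.append hl, rfl, ?_⟩
  simp only [List.append_assoc]
  rfl

/-- Left translation of the edges of the universal cover by a loop. -/
def translE (m : List Z.E) (hm : Z.IsPath z m z) (t : (Z.universalCover z).E) :
    (Z.universalCover z).E :=
  ⟨(translV m hm t.1.1, t.1.2.1, translV m hm t.1.2.2), coverEdge_translV hm t.2⟩

theorem translE_translE {m m' : List Z.E} (hm : Z.IsPath z m z) (hm' : Z.IsPath z m' z)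
    (h : Z.Htpy z z (m ++ m') []) (t : (Z.universalCover z).E) :
    translE m hm (translE m' hm' t) = t :=
  edge_ext (translV_translV hm hm' h t.1.1) rfl

/-- Left translation by a loop, as a deck transformation. -/
def transl (m : List Z.E) (hm : Z.IsPath z m z) : Z.deck z :=
  ⟨⟨(⟨translV m hm, translV _ hm.inv, translV_translV _ _ (Htpy.inv_append hm),
      translV_translV _ _ (Htpy.append_inv hm)⟩,
    ⟨translE m hm, translE _ hm.inv, translE_translE _ _ (Htpy.inv_append hm),
      translE_translE _ _ (Htpy.append_inv hm)⟩), by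
    refine ⟨fun e => rfl, fun e => rfl, fun a b c d => ?_⟩
    have hinj : Function.Injective (translV m hm) :=
      Function.LeftInverse.injective (translV_translV hm.inv hm (Htpy.inv_append hm))
    change (_ ∧ translV m hm _ = translV m hm _ ∧ translV m hm _ = translV m hm _ ∧
      translV m hm _ = translV m hm _ ∧ translV m hm _ = translV m hm _) ↔ _
    exact and_congr Iff.rfl (and_congr hinj.eq_iff (and_congr hinj.eq_iff
      (and_congr hinj.eq_iff hinj.eq_iff)))⟩, fun _ => rfl, fun _ => rfl⟩

theorem transl_smul {m : List Z.E} (hm : Z.IsPath z m z) {y : Z.V} (l : List Z.E)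
    (h : Z.IsPath z l y) : (transl m hm).1 • (vtx l h : (Z.universalCover z).V) =
      vtx (m ++ l) (hm.append h) := rfl

theorem label_smul {f : (Z.universalCover z).Aut} (hf : f ∈ Z.deck z)
    (t : (Z.universalCover z).E) : label (f • t) = label t := hf.2 t

theorem smul_eq_of_path {f g : (Z.universalCover z).Aut} (hf : f ∈ Z.deck z)
    (hg : g ∈ Z.deck z) {L : List (Z.universalCover z).E} :
    ∀ {x y : (Z.universalCover z).V}, (Z.universalCover z).IsPath x L y → f • x = g • x →
      f • y = g • y := by
  induction L with
  | nil => rintro x _ rfl h; exact h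
  | cons e L ih =>
    rintro x y ⟨rfl, h⟩ hx
    refine ih h ?_
    rw [← tgt_smul, ← tgt_smul]
    congr 1
    exact edge_ext (by rw [src_smul, src_smul, hx]) (by rw [label_smul hf, label_smul hg])

/-- Paths lift uniquely from a given starting point, so the image of one vertex determines the
images of all vertices, and hence of all edges. -/
theorem deck_ext {f g : Z.deck z} (x : (Z.universalCover z).V) (h : f.1 • x = g.1 • x) :
    f = g := by
  have hV : ∀ y : (Z.universalCover z).V, f.1 • y = g.1 • y := fun y => by
    obtain ⟨L, hL⟩ := exists_isPath x y
    exact smul_eq_of_path f.2 g.2 hL h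
  apply Subtype.ext
  apply Subtype.ext
  refine Prod.ext (Equiv.ext hV) (Equiv.ext fun e => ?_)
  change f.1 • e = g.1 • e
  exact edge_ext (by rw [src_smul, src_smul, hV]) (by rw [label_smul f.2, label_smul g.2])

theorem transl_mul {m m' : List Z.E} (hm : Z.IsPath z m z) (hm' : Z.IsPath z m' z) :
    transl m hm * transl m' hm' = transl (m ++ m') (hm.append hm') := by
  refine deck_ext (baseVertex Z z) ?_
  refine (vtx_eq_iff (hm.append (hm'.append (isPath_nil z)))
    ((hm.append hm').append (isPath_nil z))).2 ?_
  rw [List.append_assoc]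
  exact .refl (hm.append (hm'.append (isPath_nil z)))

theorem transl_eq {m m' : List Z.E} (h : Z.Htpy z z m m') :
    transl m h.left = transl m' h.right := by
  refine deck_ext (baseVertex Z z) ?_
  exact (vtx_eq_iff (h.left.append (isPath_nil z)) (h.right.append (isPath_nil z))).2
    (h.append_right (isPath_nil z))

/-- Deck transformations preserve labels. An inverted edge would have a label equal to its own
inverse. A square carried to itself other than by the identity would have a label that is folded,
has a loop in a link, or contains an inverted edge. So freeness on vertices is the only thing to
assume. -/
theorem isFree_of_deck {G : Type v} [Group G] {ρ : G →* (Z.universalCover z).Aut}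
    (hZ : Z.IsNonPositivelyCurved) (hρ : ∀ g, ρ g ∈ Z.deck z)
    (h : ∀ g, g ≠ 1 → ∀ x : (Z.universalCover z).V, ρ g • x ≠ x) : IsFree ρ := by
  refine ⟨h, fun g _ e he => ?_, fun g hg a b c d hq hs => ?_⟩
  · have h1 := label_smul (hρ g) e
    rw [he] at h1
    exact Z.inv_ne _ h1
  · have hl := label_smul (hρ g)
    have hli : ∀ t, label ((Z.universalCover z).inv t) = Z.inv (label t) := fun _ => rfl
    have hqZ : Z.Sq (label a) (label b) (label c) (label d) := hq.1
    have hinv : ∀ {s t : (Z.universalCover z).E}, ρ g • s = (Z.universalCover z).inv t →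
        label s = Z.inv (label t) := fun {s t} h => by rw [← hli, ← h, hl]
    have hinv' : ∀ {s t : (Z.universalCover z).E}, ρ g • s = t → label s = label t :=
      fun {s t} h => by rw [← h, hl]
    rcases hs.cases_eq (Z.universalCover z).inv_inv with k | k | k | k | k | k | k | k
    · exact h g hg ((Z.universalCover z).src a) (by rw [← src_smul, k.1])
    · have h1 := hinv' k.1
      have h2 := hinv' k.2.1
      have h3 := hinv' k.2.2.1
      exact hZ.no_fold _ _ _ _ hqZ ⟨h1.trans h2, h2.trans h3⟩
    · exact hZ.no_fold _ _ _ _ hqZ ⟨hinv' k.1, hinv' k.2.1⟩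
    · have h1 := hinv' k.2.1
      have h2 := hinv' k.2.2.1
      have h3 := hinv' k.2.2.2
      exact hZ.no_fold _ _ _ _ hqZ ⟨(h2.trans h1).symm, (h3.trans h2).symm⟩
    · have h1 := hinv k.2.1
      rw [h1] at hqZ
      have h2 := Z.sq_rot _ _ _ _ hqZ
      exact hZ.no_loop _ ⟨_, _, h2⟩
    · exact Z.inv_ne _ (hinv k.2.1).symm
    · have h1 := hinv k.1
      rw [h1] at hqZ
      exact hZ.no_loop _ ⟨_, _, hqZ⟩
    · exact Z.inv_ne _ (hinv k.1).symm

/-- Transitivity on the fibres over vertices gives transitivity on the fibres over edges and squares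
by unique lifting. One chosen lift of each cell that has a lift therefore represents all orbits. -/
theorem isCocompact_of_deck {G : Type v} [Group G] {ρ : G →* (Z.universalCover z).Aut}
    [Finite Z.V] [Finite Z.E] (hρ : ∀ g, ρ g ∈ Z.deck z)
    (h : ∀ x y : (Z.universalCover z).V, endpt x = endpt y → ∃ g, ρ g • x = y) : IsCocompact ρ := by
  have hE : ∀ a b : (Z.universalCover z).E, label a = label b → ∃ g, ρ g • a = b := by
    intro a b hab
    obtain ⟨g, hg⟩ := h ((Z.universalCover z).src a) ((Z.universalCover z).src b)
      (by rw [← src_label, ← src_label, hab])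
    exact ⟨g, edge_ext (by rw [src_smul, hg]) (by rw [label_smul (hρ g), hab])⟩
  refine ⟨?_, ?_, ?_⟩
  · let s : {y : Z.V // ∃ x : (Z.universalCover z).V, endpt x = y} → (Z.universalCover z).V :=
      fun y => y.2.choose
    refine ⟨Set.range s, Set.finite_range s, fun x => ?_⟩
    obtain ⟨g, hg⟩ := h x (s ⟨endpt x, x, rfl⟩)
      (Exists.choose_spec (p := fun w => endpt w = endpt x) _).symm
    exact ⟨g, hg ▸ Set.mem_range_self _⟩
  · let s : {y : Z.E // ∃ x : (Z.universalCover z).E, label x = y} → (Z.universalCover z).E :=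
      fun y => y.2.choose
    refine ⟨Set.range s, Set.finite_range s, fun x => ?_⟩
    obtain ⟨g, hg⟩ := hE x (s ⟨label x, x, rfl⟩)
      (Exists.choose_spec (p := fun w => label w = label x) _).symm
    exact ⟨g, hg ▸ Set.mem_range_self _⟩
  · let E := (Z.universalCover z).E
    let P : (E × E × E × E) → (Z.E × Z.E × Z.E × Z.E) → Prop := fun t y =>
      (Z.universalCover z).Sq t.1 t.2.1 t.2.2.1 t.2.2.2 ∧
        (label t.1, label t.2.1, label t.2.2.1, label t.2.2.2) = y
    let s : {y : Z.E × Z.E × Z.E × Z.E // ∃ t, P t y} → (E × E × E × E) := fun y => y.2.choose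
    refine ⟨Set.range s, Set.finite_range s, fun a b c d hq => ?_⟩
    let y : {y : Z.E × Z.E × Z.E × Z.E // ∃ t, P t y} := ⟨_, (a, b, c, d), hq, rfl⟩
    have hy : P (s y) y.1 := y.2.choose_spec
    generalize hs : s y = t at hy
    obtain ⟨a', b', c', d'⟩ := t
    obtain ⟨hq', hl⟩ := hy
    simp only [y, Prod.mk.injEq] at hl
    obtain ⟨g, hg⟩ := hE a a' hl.1.symm
    refine ⟨g, y, ?_⟩
    rw [hs]
    have hq'' := (sq_smul (ρ g) a b c d).2 hq
    have hb : b' = ρ g • b := edge_ext (by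
      rw [← (Sq.tgt_eq hq').1, ← (Sq.tgt_eq hq'').1, hg]) (by rw [label_smul (hρ g), hl.2.1])
    have hc : c' = ρ g • c := edge_ext (by
      rw [← (Sq.tgt_eq hq').2.1, ← (Sq.tgt_eq hq'').2.1, hb])
        (by rw [label_smul (hρ g), hl.2.2.1])
    have hd : d' = ρ g • d := edge_ext (by
      rw [← (Sq.tgt_eq hq').2.2.1, ← (Sq.tgt_eq hq'').2.2.1, hc])
        (by rw [label_smul (hρ g), hl.2.2.2])
    rw [hb, hc, hd, hg]

end Cover

end SquareComplex

namespace SquareComplex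

theorem LinkAdj.symm {X : SquareComplex.{u}} {e f : X.E} (h : X.LinkAdj e f) : X.LinkAdj f e := by
  obtain ⟨c, d, h⟩ := h
  have := X.sq_rot _ _ _ _ (X.sq_rot _ _ _ _ (X.sq_rev _ _ _ _ h))
  rw [X.inv_inv] at this
  exact ⟨_, _, this⟩

/-! ### Quotients by free actions -/

section Quotient

variable {Γ : Type v} [Group Γ] {X : SquareComplex.{u}} {ρ : Γ →* X.Aut}

theorem IsFree.eq_one (hρ : IsFree ρ) {g : Γ} {x : X.V} (h : ρ g • x = x) : g = 1 := by
  by_contra hg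
  exact hρ.vertex g hg x h

theorem IsFree.eq_of_smul_eq (hρ : IsFree ρ) {g g' : Γ} {x : X.V} (h : ρ g • x = ρ g' • x) :
    g = g' := by
  rw [← inv_mul_eq_one]
  refine (inv_mul_eq_one.2 (Eq.symm ?_)) 
  have : g'⁻¹ * g = 1 := hρ.eq_one (x := x) (by rw [map_mul, map_inv, mul_smul, h, inv_smul_smul])
  exact (inv_mul_eq_one.1 this)

/-- The quotient map of a free action. -/
def quotientMap (ρ : Γ →* X.Aut) (hρ : IsFree ρ) : Hom X (quotient ρ hρ) where
  onV := Quotient.mk (vertexOrbit ρ)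
  onE := Quotient.mk (edgeOrbit ρ)
  src _ := rfl
  inv _ := rfl
  sq a b c d h := ⟨a, b, c, d, h, rfl, rfl, rfl, rfl⟩

variable (hρ : IsFree ρ)

theorem quotientMap_onV_eq {x y : X.V} :
    (quotientMap ρ hρ).onV x = (quotientMap ρ hρ).onV y ↔ ∃ g, ρ g • x = y :=
  ⟨fun h => Quotient.exact h, fun h => Quotient.sound (s := vertexOrbit ρ) h⟩

theorem quotientMap_onE_eq {x y : X.E} :
    (quotientMap ρ hρ).onE x = (quotientMap ρ hρ).onE y ↔ ∃ g, ρ g • x = y :=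
  ⟨fun h => Quotient.exact h, fun h => Quotient.sound (s := edgeOrbit ρ) h⟩

theorem quotientMap_onV_surjective : Function.Surjective (quotientMap ρ hρ).onV :=
  Quotient.mk_surjective

theorem quotientMap_onE_surjective : Function.Surjective (quotientMap ρ hρ).onE :=
  Quotient.mk_surjective

/-- By freeness on vertices the quotient map is injective on the edges that issue from one vertex.
This lets conditions on links be checked upstairs. -/
theorem quotientMap_onE_inj {a b : X.E} (h : (quotientMap ρ hρ).onE a = (quotientMap ρ hρ).onE b)
    (hs : X.src a = X.src b) : a = b := by
  obtain ⟨g, rfl⟩ := (quotientMap_onE_eq hρ).1 h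
  rw [src_smul] at hs
  obtain rfl := hρ.eq_one hs.symm
  simp

theorem quotient_sq_lift {a : X.E} {b c d : (quotient ρ hρ).E}
    (h : (quotient ρ hρ).Sq ((quotientMap ρ hρ).onE a) b c d) :
    ∃ b' c' d', X.Sq a b' c' d' ∧ b = (quotientMap ρ hρ).onE b' ∧
      c = (quotientMap ρ hρ).onE c' ∧ d = (quotientMap ρ hρ).onE d' := by
  obtain ⟨a', b', c', d', h, ha, rfl, rfl, rfl⟩ := h
  obtain ⟨g, rfl⟩ := (quotientMap_onE_eq hρ).1 ha.symm
  exact ⟨ρ g • b', ρ g • c', ρ g • d', (sq_smul _ _ _ _ _).2 h,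
    (quotientMap_onE_eq hρ).2 ⟨g, rfl⟩, (quotientMap_onE_eq hρ).2 ⟨g, rfl⟩,
    (quotientMap_onE_eq hρ).2 ⟨g, rfl⟩⟩

theorem quotient_linkAdj_lift {e : X.E} {f : (quotient ρ hρ).E}
    (h : (quotient ρ hρ).LinkAdj ((quotientMap ρ hρ).onE e) f) :
    ∃ f', X.src f' = X.src e ∧ X.LinkAdj e f' ∧ f = (quotientMap ρ hρ).onE f' := by
  obtain ⟨c, d, h⟩ := h
  rw [← (quotientMap ρ hρ).inv] at h
  obtain ⟨b', c', d', h', rfl, rfl, rfl⟩ := quotient_sq_lift hρ h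
  refine ⟨b', ?_, ⟨_, _, h'⟩, rfl⟩
  rw [← (Sq.tgt_eq h').1, tgt_inv]

/-- Loops, double edges and triangles in links lift to links of `X`. The exception is folding: a
square that folds in the quotient without folding in `X` is turned by a half-turn by some group
element, and freeness on squares forbids this. -/
theorem quotient_isNonPositivelyCurved (hX : X.IsNonPositivelyCurved) :
    (quotient ρ hρ).IsNonPositivelyCurved := by
  refine ⟨fun e h => ?_, fun a b c d c' d' h h' => ?_, fun a b c d h hf => ?_, ?_⟩
  · obtain ⟨e, rfl⟩ := quotientMap_onE_surjective hρ e
    obtain ⟨f, hs, h', hf⟩ := quotient_linkAdj_lift hρ h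
    obtain rfl := quotientMap_onE_inj hρ hf hs.symm
    exact hX.no_loop _ h'
  · obtain ⟨a, rfl⟩ := quotientMap_onE_surjective hρ a
    obtain ⟨b₁, c₁, d₁, h1, rfl, rfl, rfl⟩ := quotient_sq_lift hρ h
    obtain ⟨b₂, c₂, d₂, h2, hb, rfl, rfl⟩ := quotient_sq_lift hρ h'
    obtain rfl := quotientMap_onE_inj hρ hb (by rw [← (Sq.tgt_eq h1).1, ← (Sq.tgt_eq h2).1])
    obtain ⟨rfl, rfl⟩ := hX.no_double _ _ _ _ _ _ h1 h2
    exact ⟨rfl, rfl⟩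
  · obtain ⟨a, b, c, d, h, rfl, rfl, rfl, rfl⟩ := h
    obtain ⟨hac, hbd⟩ := hf
    obtain ⟨g, hg⟩ := (quotientMap_onE_eq hρ).1 hac
    obtain ⟨g', hg'⟩ := (quotientMap_onE_eq hρ).1 hbd
    obtain ⟨h1, h2, h3, h4⟩ := Sq.tgt_eq h
    obtain rfl : g = g' := hρ.eq_of_smul_eq (x := X.src b) (by
      rw [← src_smul (ρ g'), hg', ← h1, ← tgt_smul, hg, h3])
    have hsq : ρ g • ρ g • X.src a = X.src a := by
      rw [← src_smul, hg, ← h2, ← tgt_smul, hg', h4]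
    have hone : g * g = 1 := hρ.eq_one (x := X.src a) (by rw [map_mul, mul_smul, hsq])
    have hc : ρ g • c = a := by
      rw [← hg, ← mul_smul, ← map_mul, hone, map_one, one_smul]
    have hd : ρ g • d = b := by
      rw [← hg', ← mul_smul, ← map_mul, hone, map_one, one_smul]
    have hne : g ≠ 1 := by
      rintro rfl
      rw [map_one, one_smul] at hg hg'
      exact hX.no_fold _ _ _ _ h ⟨hg, hg'⟩
    refine hρ.square g hne a b c d h ?_
    rw [hg, hg', hc, hd]
    exact (SameSquare.refl.rot).rot
  · rintro e f k ⟨h1, h2, h3⟩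
    obtain ⟨e, rfl⟩ := quotientMap_onE_surjective hρ e
    obtain ⟨f, hf, h1', rfl⟩ := quotient_linkAdj_lift hρ h1
    obtain ⟨k, hk, h2', rfl⟩ := quotient_linkAdj_lift hρ h2
    obtain ⟨e', he, h3', hee⟩ := quotient_linkAdj_lift hρ h3
    obtain rfl := quotientMap_onE_inj hρ hee (by rw [he, hk, hf])
    exact hX.no_triangle _ _ _ ⟨h1', h2', h3'⟩

/-- A free action admits an equivariant map from vertices to the group. -/
theorem IsFree.exists_equivariant (hρ : IsFree ρ) (p : X.V) :
    ∃ k : X.V → Γ, k p = 1 ∧ ∀ g x, k (ρ g • x) = g * k x := by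
  have h : ∀ x, ∃ g, ρ g • (Quotient.mk (vertexOrbit ρ) x).out = x := fun x =>
    Quotient.exact (s := vertexOrbit ρ) (Quotient.out_eq _)
  choose k hk using h
  have hk' : ∀ g x, k (ρ g • x) = g * k x := by
    intro g x
    have hq : Quotient.mk (vertexOrbit ρ) (ρ g • x) = Quotient.mk (vertexOrbit ρ) x :=
      (Quotient.sound (s := vertexOrbit ρ) ⟨g, rfl⟩).symm
    apply hρ.eq_of_smul_eq (x := (Quotient.mk (vertexOrbit ρ) x).out)
    rw [map_mul, mul_smul, hk, ← hq, hk]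
  exact ⟨fun x => k x * (k p)⁻¹, mul_inv_cancel _, fun g x => by simp only [hk', mul_assoc]⟩

theorem quotient_finite_V (hc : IsCocompact ρ) : Finite (quotient ρ hρ).V := by
  obtain ⟨A, hA, h⟩ := hc.1
  have := hA.to_subtype
  refine Finite.of_surjective (fun a : A => (quotientMap ρ hρ).onV a) fun x => ?_
  obtain ⟨x, rfl⟩ := quotientMap_onV_surjective hρ x
  obtain ⟨g, hg⟩ := h x
  exact ⟨⟨_, hg⟩, ((quotientMap_onV_eq hρ).2 ⟨g, rfl⟩).symm⟩

theorem quotient_finite_E (hc : IsCocompact ρ) : Finite (quotient ρ hρ).E := by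
  obtain ⟨A, hA, h⟩ := hc.2.1
  have := hA.to_subtype
  refine Finite.of_surjective (fun a : A => (quotientMap ρ hρ).onE a) fun x => ?_
  obtain ⟨x, rfl⟩ := quotientMap_onE_surjective hρ x
  obtain ⟨g, hg⟩ := h x
  exact ⟨⟨_, hg⟩, ((quotientMap_onE_eq hρ).2 ⟨g, rfl⟩).symm⟩

end Quotient

/-! ### Links after attaching an annulus -/

section Annulus

variable {Z : SquareComplex.{u}} {m : ℕ} {w : ZMod m → Z.E}
  {hw : ∀ i, Z.tgt (w i) = Z.src (w (i + 1))}

/-- The edges of `Z`, as edges of the complex with an annulus attached. -/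
def attachInl (e : Z.E) : (Z.attachAnnulus m w hw).E := Sum.inl e

/-- The edges that cross the annulus. -/
def attachInr (t : ZMod m × Bool) : (Z.attachAnnulus m w hw).E := Sum.inr t

theorem attachInl_inj {e f : Z.E} :
    (attachInl e : (Z.attachAnnulus m w hw).E) = attachInl f ↔ e = f :=
  Sum.inl_injective.eq_iff

theorem attachInr_inj {e f : ZMod m × Bool} :
    (attachInr e : (Z.attachAnnulus m w hw).E) = attachInr f ↔ e = f :=
  Sum.inr_injective.eq_iff

theorem attachInl_ne_attachInr {e : Z.E} {t : ZMod m × Bool} :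
    (attachInl e : (Z.attachAnnulus m w hw).E) = attachInr t ↔ False :=
  ⟨fun h => Sum.inl_ne_inr h, False.elim⟩

theorem attachInr_ne_attachInl {e : Z.E} {t : ZMod m × Bool} :
    (attachInr t : (Z.attachAnnulus m w hw).E) = attachInl e ↔ False :=
  ⟨fun h => Sum.inr_ne_inl h, False.elim⟩

theorem attachAnnulus_edge_cases (e : (Z.attachAnnulus m w hw).E) :
    (∃ f, e = attachInl f) ∨ ∃ i s, e = attachInr (i, s) := by
  rcases e with e | ⟨i, s⟩
  · exact .inl ⟨e, rfl⟩
  · exact .inr ⟨i, s, rfl⟩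

theorem inv_attachInl (e : Z.E) :
    (Z.attachAnnulus m w hw).inv (attachInl e) = attachInl (Z.inv e) := rfl

theorem inv_attachInr (i : ZMod m) (s : Bool) :
    (Z.attachAnnulus m w hw).inv (attachInr (i, s)) = attachInr (i, !s) := rfl

/-- The inclusion of `Z`. -/
def attachMap : Hom Z (Z.attachAnnulus m w hw) where
  onV x := x
  onE := attachInl
  src _ := rfl
  inv _ := rfl
  sq a b c d h := .inl ⟨a, b, c, d, h, rfl, rfl, rfl, rfl⟩

theorem attachAnnulus_sq_intro (i : ZMod m) : (Z.attachAnnulus m w hw).Sq (attachInl (w i))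
    (attachInr (i + 1, true)) (attachInl (Z.inv (w i))) (attachInr (i, false)) :=
  .inr ⟨i, .refl⟩

theorem attachAnnulus_sq {a b c d : (Z.attachAnnulus m w hw).E}
    (h : (Z.attachAnnulus m w hw).Sq a b c d) :
    (∃ a' b' c' d', Z.Sq a' b' c' d' ∧
      a = attachInl a' ∧ b = attachInl b' ∧ c = attachInl c' ∧ d = attachInl d') ∨
    ∃ (i : ZMod m) (s : Bool),
      (a = attachInl (w i) ∧ b = attachInr (i + 1, s) ∧ c = attachInl (Z.inv (w i)) ∧
        d = attachInr (i, !s)) ∨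
      (a = attachInl (Z.inv (w i)) ∧ b = attachInr (i, s) ∧ c = attachInl (w i) ∧
        d = attachInr (i + 1, !s)) ∨
      (a = attachInr (i, s) ∧ b = attachInl (w i) ∧ c = attachInr (i + 1, !s) ∧
        d = attachInl (Z.inv (w i))) ∨
      (a = attachInr (i + 1, s) ∧ b = attachInl (Z.inv (w i)) ∧ c = attachInr (i, !s) ∧
        d = attachInl (w i)) := by
  rcases h with h | ⟨i, h⟩
  · exact .inl h
  · refine .inr ⟨i, ?_⟩
    have h' := h.cases_eq (by rintro (e | t) <;> simp [Z.inv_inv])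
    simp only [Sum.map_inl, Sum.map_inr, Z.inv_inv, Bool.not_true, Bool.not_false] at h'
    rcases h' with h | h | h | h | h | h | h | h
    · exact ⟨true, .inl h⟩
    · exact ⟨true, .inr (.inr (.inr h))⟩
    · exact ⟨false, .inr (.inl h)⟩
    · exact ⟨false, .inr (.inr (.inl h))⟩
    · exact ⟨true, .inr (.inr (.inl h))⟩
    · exact ⟨false, .inl h⟩
    · exact ⟨false, .inr (.inr (.inr h))⟩
    · exact ⟨true, .inr (.inl h)⟩

theorem attachAnnulus_linkAdj {e f : (Z.attachAnnulus m w hw).E}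
    (h : (Z.attachAnnulus m w hw).LinkAdj e f) :
    (∃ e' f', e = attachInl e' ∧ f = attachInl f' ∧ Z.LinkAdj e' f') ∨
    (∃ e' i s, e = attachInl e' ∧ f = attachInr (i, s) ∧ (e' = w i ∨ ∃ j, i = j + 1 ∧
      e' = Z.inv (w j))) ∨
    (∃ e' i s, f = attachInl e' ∧ e = attachInr (i, s) ∧ (e' = w i ∨ ∃ j, i = j + 1 ∧
      e' = Z.inv (w j))) := by
  obtain ⟨c, d, h⟩ := h
  have he := (Z.attachAnnulus m w hw).inv_inv e
  rcases attachAnnulus_sq h with ⟨a', b', c', d', h, h1, h2, -, -⟩ |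
    ⟨i, s, ⟨h1, h2, -, -⟩ | ⟨h1, h2, -, -⟩ | ⟨h1, h2, -, -⟩ | ⟨h1, h2, -, -⟩⟩
  · rw [h1, inv_attachInl] at he
    exact .inl ⟨_, _, he.symm, h2, c', d', (Z.inv_inv a').symm ▸ h⟩
  · rw [h1, inv_attachInl] at he
    exact .inr (.inl ⟨_, _, _, he.symm, h2, .inr ⟨i, rfl, rfl⟩⟩)
  · rw [h1, inv_attachInl] at he
    exact .inr (.inl ⟨_, _, _, he.symm, h2, .inl (Z.inv_inv _)⟩)
  · rw [h1, inv_attachInr] at he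
    exact .inr (.inr ⟨_, _, _, h2, he.symm, .inl rfl⟩)
  · rw [h1, inv_attachInr] at he
    exact .inr (.inr ⟨_, _, _, h2, he.symm, .inr ⟨i, rfl, rfl⟩⟩)

/-- Each end of a crossing edge is a new vertex of a link, joined only to the two directions in
which the loop leaves that point. A double edge would need the two directions to coincide, which
`h₁` excludes; a triangle would need them to be adjacent, which `h₂` excludes. Together the two
conditions say that the loop is a local geodesic. -/
theorem attachAnnulus_isNonPositivelyCurved (hZ : Z.IsNonPositivelyCurved)
    (h₁ : ∀ i, Z.inv (w i) ≠ w (i + 1)) (h₂ : ∀ i, ¬ Z.LinkAdj (Z.inv (w i)) (w (i + 1))) :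
    (Z.attachAnnulus m w hw).IsNonPositivelyCurved := by
  have h₁' : ∀ i, w i ≠ Z.inv (w (i + 1)) := fun i h => h₁ i (by rw [h, Z.inv_inv])
  have hbad : ∀ e f i, Z.LinkAdj e f → (e = w i ∨ ∃ j, i = j + 1 ∧ e = Z.inv (w j)) →
      ¬ (f = w i ∨ ∃ j, i = j + 1 ∧ f = Z.inv (w j)) := by
    rintro e f i h (rfl | ⟨j, rfl, rfl⟩) (rfl | ⟨j', hj, rfl⟩)
    · exact hZ.no_loop _ h
    · subst hj; exact h₂ _ h.symm
    · exact h₂ _ h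
    · obtain rfl := add_right_cancel hj
      exact hZ.no_loop _ h
  refine ⟨fun e h => ?_, fun a b c d c' d' h h' => ?_, fun a b c d h hf => ?_, ?_⟩
  · rcases attachAnnulus_linkAdj h with ⟨e', f', h1, h2, h3⟩ | ⟨e', i, s, h1, h2, h3⟩ |
      ⟨e', i, s, h1, h2, h3⟩
    · obtain rfl := attachInl_inj.1 (h1.symm.trans h2)
      exact hZ.no_loop _ h3
    · exact attachInl_ne_attachInr.1 (h1.symm.trans h2)
    · exact attachInr_ne_attachInl.1 (h2.symm.trans h1)
  · rcases attachAnnulus_sq h with ⟨a', b', c₁, d₁, hz, rfl, rfl, rfl, rfl⟩ |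
      ⟨i, s, ⟨rfl, rfl, rfl, rfl⟩ | ⟨rfl, rfl, rfl, rfl⟩ | ⟨rfl, rfl, rfl, rfl⟩ |
        ⟨rfl, rfl, rfl, rfl⟩⟩ <;>
    rcases attachAnnulus_sq h' with ⟨a₂, b₂, c₂, d₂, hz', ha, hb, rfl, rfl⟩ |
      ⟨i', s', ⟨ha, hb, rfl, rfl⟩ | ⟨ha, hb, rfl, rfl⟩ | ⟨ha, hb, rfl, rfl⟩ |
        ⟨ha, hb, rfl, rfl⟩⟩ <;>
    simp only [attachInl_inj, attachInr_inj, attachInl_ne_attachInr, attachInr_ne_attachInl,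
      Prod.mk.injEq, add_left_inj] at ha hb
    · obtain ⟨rfl, rfl⟩ := hZ.no_double _ _ _ _ _ _ hz (ha ▸ hb ▸ hz')
      exact ⟨rfl, rfl⟩
    · obtain ⟨rfl, rfl⟩ := hb; exact ⟨rfl, rfl⟩
    · obtain ⟨rfl, rfl⟩ := hb; exact absurd ha (h₁' _)
    · obtain ⟨rfl, rfl⟩ := hb; exact absurd ha.symm (h₁' _)
    · obtain ⟨rfl, rfl⟩ := hb; exact ⟨rfl, rfl⟩
    · obtain ⟨rfl, rfl⟩ := ha; exact ⟨rfl, rfl⟩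
    · obtain ⟨rfl, rfl⟩ := ha; exact absurd hb.symm (h₁ _)
    · obtain ⟨rfl, rfl⟩ := ha; exact absurd hb (h₁ _)
    · obtain ⟨rfl, rfl⟩ := ha; exact ⟨rfl, rfl⟩
  · rcases attachAnnulus_sq h with ⟨a', b', c₁, d₁, hz, rfl, rfl, rfl, rfl⟩ |
      ⟨i, s, ⟨rfl, rfl, rfl, rfl⟩ | ⟨rfl, rfl, rfl, rfl⟩ | ⟨rfl, rfl, rfl, rfl⟩ |
        ⟨rfl, rfl, rfl, rfl⟩⟩ <;>
    simp only [attachInl_inj, attachInr_inj, Prod.mk.injEq] at hf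
    · exact hZ.no_fold _ _ _ _ hz hf
    · exact Z.inv_ne _ hf.1.symm
    · exact Z.inv_ne _ hf.1
    · exact Z.inv_ne _ hf.2.symm
    · exact Z.inv_ne _ hf.2
  · rintro e f k ⟨h1, h2, h3⟩
    rcases attachAnnulus_linkAdj h1 with ⟨e₁, f₁, rfl, rfl, k1⟩ | ⟨e₁, i₁, s₁, rfl, rfl, k1⟩ |
      ⟨e₁, i₁, s₁, rfl, rfl, k1⟩ <;>
    rcases attachAnnulus_linkAdj h2 with ⟨e₂, f₂, hf, rfl, k2⟩ | ⟨e₂, i₂, s₂, hf, rfl, k2⟩ |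
      ⟨e₂, i₂, s₂, rfl, hf, k2⟩ <;>
    rcases attachAnnulus_linkAdj h3 with ⟨e₃, f₃, hk, he, k3⟩ | ⟨e₃, i₃, s₃, hk, he, k3⟩ |
      ⟨e₃, i₃, s₃, he, hk, k3⟩ <;>
    simp only [attachInl_inj, attachInr_inj, attachInl_ne_attachInr, attachInr_ne_attachInl,
      Prod.mk.injEq] at hf hk he
    · subst hf hk he; exact hZ.no_triangle _ _ _ ⟨k1, k2, k3⟩
    · obtain ⟨rfl, rfl⟩ := hk; subst hf he; exact hbad _ _ _ k1 k3 k2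
    · obtain ⟨rfl, rfl⟩ := hf; subst hk he; exact hbad _ _ _ k3 k2 k1
    · obtain ⟨rfl, rfl⟩ := he; subst hf hk; exact hbad _ _ _ k2 k1 k3

end Annulus

end SquareComplex

namespace SquareComplex

/-! ### Group-valued edge labels and the functions they define on the universal cover -/

namespace Cover

variable {Z : SquareComplex.{u}} {z : Z.V} {G : Type*} [Group G] (f : Z.E → G)
  (hinv : ∀ e, f (Z.inv e) = (f e)⁻¹) (hsq : ∀ a b c d, Z.Sq a b c d → f a * f b * f c * f d = 1)

theorem vtx_congr {y y' : Z.V} {l l' : List Z.E} {h : Z.IsPath z l y} {h' : Z.IsPath z l' y'}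
    (hy : y = y') (hl : l = l') : vtx l h = vtx l' h' := by
  subst hy hl
  rfl

theorem sq_intro {a b c d : (Z.universalCover z).E}
    (h : Z.Sq (label a) (label b) (label c) (label d))
    (h1 : (Z.universalCover z).tgt a = (Z.universalCover z).src b)
    (h2 : (Z.universalCover z).tgt b = (Z.universalCover z).src c)
    (h3 : (Z.universalCover z).tgt c = (Z.universalCover z).src d)
    (h4 : (Z.universalCover z).tgt d = (Z.universalCover z).src a) :
    (Z.universalCover z).Sq a b c d := ⟨h, h1, h2, h3, h4⟩

/-- The product of edge labels along paths, as a function on the universal cover. -/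
def vol (x : (Z.universalCover z).V) : G :=
  Quot.lift (fun p : Z.Path z (endpt x) => (p.1.map f).prod)
    (fun p _ h => Htpy.prod_eq hinv hsq (Htpy.of_step h p.2)) x.2

theorem vol_vtx {y : Z.V} (l : List Z.E) (h : Z.IsPath z l y) :
    vol f hinv hsq (vtx l h) = (l.map f).prod := rfl

theorem vol_tgt (t : (Z.universalCover z).E) :
    vol f hinv hsq ((Z.universalCover z).tgt t) =
      vol f hinv hsq ((Z.universalCover z).src t) * f (label t) := by
  obtain ⟨l, hl, hx⟩ := exists_eq_vtx ((Z.universalCover z).src t)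
  obtain ⟨t', h1, h2, h3⟩ := exists_edge_vtx l hl (label t) (src_label t)
  obtain rfl := edge_ext (h1.trans hx.symm) h2
  have h4 : vol f hinv hsq ((Z.universalCover z).src t') = (l.map f).prod := by
    rw [h1]; exact vol_vtx f hinv hsq l hl
  rw [h4, h3, vol_vtx, List.map_append, List.prod_append, List.map_singleton,
    List.prod_singleton]

theorem vol_transl {m : List Z.E} (hm : Z.IsPath z m z) (x : (Z.universalCover z).V) :
    vol f hinv hsq ((transl m hm).1 • x) = (m.map f).prod * vol f hinv hsq x := by
  obtain ⟨l, hl, hx⟩ := exists_eq_vtx x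
  rw [hx]
  change vol f hinv hsq (vtx (m ++ l) (hm.append hl)) = _
  rw [vol_vtx, vol_vtx, List.map_append, List.prod_append]

end Cover

open Cover

theorem zpow_smul_of_shift {G α : Type*} [Group G] [MulAction G α] {f : G} {e : ℤ → α} {m : ℤ}
    (h : ∀ n, f • e n = e (n + m)) (j n : ℤ) : f ^ j • e n = e (n + j * m) := by
  induction j using Int.induction_on generalizing n with
  | zero => simp
  | succ j ih =>
    rw [zpow_add_one, mul_smul, h, ih]
    congr 1
    ring
  | pred j ih =>
    have h : f⁻¹ • e n = e (n - m) := by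
      rw [inv_smul_eq_iff, h]
      congr 1
      ring
    rw [zpow_sub_one, mul_smul, h, ih]
    congr 1
    ring

/-- A bi-infinite edge path in `X` that is translated by `g`, and its image in the quotient. -/
structure AxialLoop {Γ : Type v} [Group Γ] {X : SquareComplex.{u}} (ρ : Γ →* X.Aut)
    (hρ : IsFree ρ) where
  g : Γ
  m : ℕ
  pos : 0 < m
  e : ℤ → X.E
  path : ∀ n, X.tgt (e n) = X.src (e (n + 1))
  shift : ∀ n, ρ g • e n = e (n + m)
  w : ZMod m → (quotient ρ hρ).E
  w_cast : ∀ n : ℤ, w n = (quotientMap ρ hρ).onE (e n)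

/-! ### The annulus attached along an axis, and the HNN extension -/

namespace AxialLoop

variable {Γ : Type v} [Group Γ] {X : SquareComplex.{u}} {ρ : Γ →* X.Aut} {hρ : IsFree ρ}
  (D : AxialLoop ρ hρ)

theorem closed (i : ZMod D.m) :
    (quotient ρ hρ).tgt (D.w i) = (quotient ρ hρ).src (D.w (i + 1)) := by
  obtain ⟨n, rfl⟩ := ZMod.intCast_surjective i
  have : ((n : ZMod D.m) + 1) = ((n + 1 : ℤ) : ZMod D.m) := by push_cast; rfl
  rw [this, D.w_cast, D.w_cast, (quotientMap ρ hρ).src, (quotientMap ρ hρ).tgt, D.path]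

/-- The quotient with an annulus attached along the loop. -/
abbrev base : SquareComplex.{u} := (quotient ρ hρ).attachAnnulus D.m D.w D.closed

/-- The origin of the axis. -/
def origin : X.V := X.src (D.e 0)

/-- The map from `X` to the quotient with an annulus attached. -/
def incl : Hom X D.base := attachMap.comp (quotientMap ρ hρ)

/-- The base point. -/
abbrev basePoint : D.base.V := D.incl.onV D.origin

/-- The universal cover. -/
abbrev Y : SquareComplex.{u} := D.base.universalCover D.basePoint

/-- The group of deck transformations. -/
abbrev deck : Subgroup D.Y.Aut := D.base.deck D.basePoint

/-- The HNN extension of `Γ` by a stable letter that commutes with `g`. -/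
abbrev HNN : Type v :=
  HNNExtension Γ (Subgroup.zpowers D.g) (Subgroup.zpowers D.g) (MulEquiv.refl _)

theorem incl_onV_eq {x y : X.V} : D.incl.onV x = D.incl.onV y ↔ ∃ g, ρ g • x = y :=
  quotientMap_onV_eq hρ

theorem incl_onE_smul (g : Γ) (e : X.E) : D.incl.onE (ρ g • e) = D.incl.onE e :=
  congrArg attachInl ((quotientMap_onE_eq hρ).2 ⟨g, rfl⟩).symm

/-- The edge crossing the annulus at the `n`-th vertex of the loop. -/
def tE (n : ℤ) : D.base.E := attachInr ((n : ZMod D.m), true)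

theorem src_tE (n : ℤ) : D.base.src (D.tE n) = D.incl.onV (X.src (D.e n)) := by
  change (quotient ρ hρ).src (D.w n) = _
  rw [D.w_cast, (quotientMap ρ hρ).src]
  rfl

theorem tgt_tE (n : ℤ) : D.base.tgt (D.tE n) = D.incl.onV (X.src (D.e n)) := D.src_tE n

theorem tE_congr {n n' : ℤ} (h : (n : ZMod D.m) = n') : D.tE n = D.tE n' := by rw [tE, h]; rfl

theorem tE_add (n : ℤ) : D.tE (n + D.m) = D.tE n := D.tE_congr (by simp)

theorem tE_succ (n : ℤ) : D.tE (n + 1) = attachInr ((n : ZMod D.m) + 1, true) :=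
  congrArg (fun i => attachInr (i, true)) (by push_cast; rfl)

theorem base_edge_cases (e : D.base.E) :
    (∃ f, e = D.incl.onE f) ∨ ∃ n : ℕ, e = D.tE n ∨ e = D.base.inv (D.tE n) := by
  rcases attachAnnulus_edge_cases e with ⟨f, rfl⟩ | ⟨i, s, rfl⟩
  · obtain ⟨f, rfl⟩ := quotientMap_onE_surjective hρ f
    exact .inl ⟨f, rfl⟩
  · have : NeZero D.m := ⟨D.pos.ne'⟩
    obtain ⟨n, rfl⟩ : ∃ n : ℕ, i = ((n : ℤ) : ZMod D.m) := ⟨i.val, by simp⟩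
    cases s
    · exact .inr ⟨n, .inr rfl⟩
    · exact .inr ⟨n, .inl rfl⟩

theorem sq_tE (n : ℤ) : D.base.Sq (D.incl.onE (D.e n)) (D.tE (n + 1))
    (D.base.inv (D.incl.onE (D.e n))) (D.base.inv (D.tE n)) := by
  have h : D.base.Sq _ _ _ _ := attachAnnulus_sq_intro (hw := D.closed) (n : ZMod D.m)
  rw [D.w_cast] at h
  rw [D.tE_succ]
  exact h

theorem shift_zpow (j n : ℤ) : ρ (D.g ^ j) • D.e n = D.e (n + j * D.m) := by
  rw [map_zpow, zpow_smul_of_shift D.shift]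

/-! ### The labelling by elements of the HNN extension -/

/-- An equivariant map from the vertices of `X` to the group. -/
noncomputable def coord : X.V → Γ := (hρ.exists_equivariant D.origin).choose

theorem coord_origin : D.coord D.origin = 1 := (hρ.exists_equivariant D.origin).choose_spec.1

theorem coord_smul (g : Γ) (x : X.V) : D.coord (ρ g • x) = g * D.coord x :=
  (hρ.exists_equivariant D.origin).choose_spec.2 g x

/-- The label of the `n`-th edge across the annulus. -/
noncomputable def tLabel (n : ℤ) : D.HNN :=
  (HNNExtension.of (D.coord (X.src (D.e n))))⁻¹ * HNNExtension.t *
    HNNExtension.of (D.coord (X.src (D.e n)))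

theorem t_commute (j : ℤ) :
    Commute (HNNExtension.t : D.HNN) (HNNExtension.of (D.g ^ j)) :=
  HNNExtension.t_mul_of (⟨D.g ^ j, j, rfl⟩ : Subgroup.zpowers D.g)

/-- Vertices of the axis whose indices agree modulo `m` differ by a power of `g`. That power
commutes with the stable letter, so it cancels in the conjugate. -/
theorem tLabel_eq {n n' : ℤ} (h : (n : ZMod D.m) = n') : D.tLabel n = D.tLabel n' := by
  obtain ⟨j, hj⟩ := ((ZMod.intCast_eq_intCast_iff_dvd_sub _ _ _).1 h)
  obtain rfl : n' = n + j * D.m := by linarith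
  have h1 := (D.t_commute j).eq
  simp only [tLabel, ← D.shift_zpow, src_smul, coord_smul, map_mul, mul_inv_rev]
  have h2 : (HNNExtension.of (D.g ^ j) : D.HNN)⁻¹ * HNNExtension.t * HNNExtension.of (D.g ^ j) =
      HNNExtension.t := by
    rw [mul_assoc, h1, inv_mul_cancel_left]
  calc _ = (HNNExtension.of (D.coord (X.src (D.e n))))⁻¹ *
        ((HNNExtension.of (D.g ^ j) : D.HNN)⁻¹ * HNNExtension.t * HNNExtension.of (D.g ^ j)) *
        HNNExtension.of (D.coord (X.src (D.e n))) := by rw [h2]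
    _ = _ := by simp only [mul_assoc]

/-- The labels of the edges. -/
noncomputable def volt : D.base.E → D.HNN :=
  Sum.elim (Quotient.lift (fun e => HNNExtension.of ((D.coord (X.src e))⁻¹ * D.coord (X.tgt e)))
    (by
      rintro a _ ⟨g, rfl⟩
      rw [src_smul, tgt_smul, coord_smul, coord_smul]
      simp [mul_assoc]))
    (fun t => if t.2 then D.tLabel (ZMod.intCast_surjective t.1).choose else
      (D.tLabel (ZMod.intCast_surjective t.1).choose)⁻¹)

theorem volt_incl (e : X.E) :
    D.volt (D.incl.onE e) = HNNExtension.of ((D.coord (X.src e))⁻¹ * D.coord (X.tgt e)) := rfl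

theorem volt_attachInr_true (n : ℤ) :
    D.volt (attachInr ((n : ZMod D.m), true)) = D.tLabel n :=
  D.tLabel_eq (ZMod.intCast_surjective (n : ZMod D.m)).choose_spec

theorem volt_attachInr_false (n : ℤ) :
    D.volt (attachInr ((n : ZMod D.m), false)) = (D.tLabel n)⁻¹ :=
  congrArg (fun a => a⁻¹) (D.tLabel_eq (ZMod.intCast_surjective (n : ZMod D.m)).choose_spec)

theorem volt_tE (n : ℤ) : D.volt (D.tE n) = D.tLabel n := D.volt_attachInr_true n

theorem volt_inv (e : D.base.E) : D.volt (D.base.inv e) = (D.volt e)⁻¹ := by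
  rcases D.base_edge_cases e with ⟨f, rfl⟩ | ⟨n, rfl | rfl⟩
  · rw [← D.incl.inv, volt_incl, volt_incl, ← map_inv, tgt_inv, mul_inv_rev,
      _root_.inv_inv]
    rfl
  · rw [volt_tE]; exact D.volt_attachInr_false n
  · rw [D.base.inv_inv, volt_tE, eq_comm, inv_eq_iff_eq_inv]; exact D.volt_attachInr_false n

theorem volt_mul_tE (n : ℤ) : D.volt (D.incl.onE (D.e n)) * D.volt (D.tE (n + 1)) =
    D.volt (D.tE n) * D.volt (D.incl.onE (D.e n)) := by
  rw [volt_incl, volt_tE, volt_tE, tLabel, tLabel, D.path]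
  simp [mul_assoc]

theorem volt_sq (a b c d : D.base.E) (h : D.base.Sq a b c d) :
    D.volt a * D.volt b * D.volt c * D.volt d = 1 := by
  rcases h with ⟨a, b, c, d, ⟨a, b, c, d, h, rfl, rfl, rfl, rfl⟩, rfl, rfl, rfl, rfl⟩ | ⟨i, h⟩
  · change D.volt (D.incl.onE a) * D.volt (D.incl.onE b) * D.volt (D.incl.onE c) *
      D.volt (D.incl.onE d) = 1
    obtain ⟨h1, h2, h3, h4⟩ := Sq.tgt_eq h
    simp only [volt_incl, ← map_mul, h1, h2, h3, h4]
    simp [mul_assoc]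
  · have key : ∀ a b c d e f k l : D.base.E, SameSquare D.base.inv a b c d e f k l →
        D.volt a * D.volt b * D.volt c * D.volt d = 1 →
        D.volt e * D.volt f * D.volt k * D.volt l = 1 := by
      intro a b c d e f k l hs h1
      induction hs with
      | refl => exact h1
      | rot _ ih =>
        rw [mul_assoc, mul_assoc, mul_eq_one_iff_eq_inv] at ih
        rw [ih, mul_assoc (D.volt _), mul_inv_cancel]
      | rev _ ih =>
        simp only [volt_inv]
        rw [← inv_inj]
        simpa [mul_assoc] using ih
    refine key _ _ _ _ _ _ _ _ h ?_
    obtain ⟨n, rfl⟩ := ZMod.intCast_surjective i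
    change D.volt (attachInl (D.w n)) * D.volt (attachInr ((n : ZMod D.m) + 1, true)) *
      D.volt (D.base.inv (attachInl (D.w n))) * D.volt (D.base.inv (D.tE n)) = 1
    rw [volt_inv, volt_inv, ← D.tE_succ, D.w_cast]
    change D.volt (D.incl.onE (D.e n)) * D.volt (D.tE (n + 1)) *
      (D.volt (D.incl.onE (D.e n)))⁻¹ * (D.volt (D.tE n))⁻¹ = 1
    rw [volt_mul_tE]
    simp [mul_assoc]

theorem volt_prod_incl {l : List X.E} : ∀ {x y : X.V}, X.IsPath x l y →
    ((l.map D.incl.onE).map D.volt).prod = HNNExtension.of ((D.coord x)⁻¹ * D.coord y) := by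
  induction l with
  | nil => rintro x _ rfl; simp
  | cons e l ih =>
    rintro x y ⟨rfl, h⟩
    rw [List.map_cons, List.map_cons, List.prod_cons, ih h, volt_incl, ← map_mul]
    simp [mul_assoc]

/-- The labelling of the vertices of the universal cover. -/
noncomputable def lab : D.Y.V → D.HNN := vol D.volt D.volt_inv D.volt_sq

/-! ### The action of the HNN extension on the universal cover -/

theorem isPath_incl {γ : Γ} {l : List X.E} (h : X.IsPath D.origin l (ρ γ • D.origin)) :
    D.base.IsPath D.basePoint (l.map D.incl.onE) D.basePoint := by
  have h1 := D.incl.isPath h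
  rwa [← (D.incl_onV_eq).2 ⟨γ, rfl⟩] at h1

theorem map_incl_smul (γ : Γ) (l : List X.E) :
    (l.map (fun e => ρ γ • e)).map D.incl.onE = l.map D.incl.onE := by
  simp [incl_onE_smul]

theorem isPath_smul {x y : X.V} {l : List X.E} (γ : Γ) (h : X.IsPath x l y) :
    X.IsPath (ρ γ • x) (l.map (fun e => ρ γ • e)) (ρ γ • y) :=
  (Hom.ofAut (ρ γ)).isPath h

variable (hX : X.IsSimplyConnected)

/-- A path in `X` from the origin. -/
noncomputable def pathTo (x : X.V) : List X.E := (hX.2.1 D.origin x).choose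

theorem isPath_pathTo (x : X.V) : X.IsPath D.origin (D.pathTo hX x) x :=
  (hX.2.1 D.origin x).choose_spec

theorem htpy_incl (hX : X.IsSimplyConnected) {x : X.V} {l l' : List X.E} (h : X.IsPath D.origin l x)
    (h' : X.IsPath D.origin l' x) :
    D.base.Htpy D.basePoint (D.incl.onV x) (l.map D.incl.onE) (l'.map D.incl.onE) :=
  D.incl.htpy (hX.htpy h h')

theorem transl_incl_eq (hX : X.IsSimplyConnected) {γ : Γ} {l l' : List X.E}
    (h : X.IsPath D.origin l (ρ γ • D.origin))
    (h' : X.IsPath D.origin l' (ρ γ • D.origin)) :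
    (transl _ (D.isPath_incl h) : D.deck) = transl _ (D.isPath_incl h') := by
  have h1 := D.htpy_incl hX h h'
  rw [← (D.incl_onV_eq).2 ⟨γ, rfl⟩] at h1
  exact transl_eq h1

/-- The action of `Γ` on the universal cover. -/
noncomputable def ofHom : Γ →* D.deck :=
  MonoidHom.mk' (fun γ => transl _ (D.isPath_incl (D.isPath_pathTo hX (ρ γ • D.origin)))) (by
    intro a b
    -- A path for `a * b` is a path for `a` followed by the `a`-translate of a path for `b`, and the
    -- translation is not visible in the quotient.
    have h1 := (D.isPath_pathTo hX (ρ a • D.origin)).append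
      (isPath_smul a (D.isPath_pathTo hX (ρ b • D.origin)))
    rw [← mul_smul, ← map_mul] at h1
    rw [transl_mul, D.transl_incl_eq hX (D.isPath_pathTo hX _) h1]
    simp only [List.map_append, map_incl_smul])

theorem ofHom_eq {γ : Γ} {l : List X.E} (h : X.IsPath D.origin l (ρ γ • D.origin)) :
    D.ofHom hX γ = transl _ (D.isPath_incl h) :=
  D.transl_incl_eq hX (D.isPath_pathTo hX _) h

/-- The loop across the annulus, as a deck transformation. -/
def tDeck : D.deck := transl [D.tE 0] (isPath_singleton.2 ⟨D.src_tE 0, D.tgt_tE 0⟩)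

/-- The initial segment of the axis. -/
def seg (n : ℕ) : List X.E := (List.range n).map (fun i : ℕ => D.e i)

theorem isPath_seg (n : ℕ) : X.IsPath D.origin (D.seg n) (X.src (D.e n)) := by
  induction n with
  | zero => rfl
  | succ n ih =>
    rw [seg, List.range_succ, List.map_append]
    refine ih.append (isPath_singleton.2 ⟨rfl, ?_⟩)
    rw [D.path]; push_cast; rfl

/-- The crossing edge is pushed along the annulus one square at a time. For `n = m`, once around,
this becomes the relation between `t` and `g` in the HNN extension. -/
theorem htpy_seg (n : ℕ) : D.base.Htpy D.basePoint (D.incl.onV (X.src (D.e n)))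
    ((D.seg n).map D.incl.onE ++ [D.tE n]) (D.tE 0 :: (D.seg n).map D.incl.onE) := by
  induction n with
  | zero => exact .refl (isPath_singleton.2 ⟨D.src_tE 0, D.tgt_tE 0⟩)
  | succ n ih =>
    have hsucc : ((n + 1 : ℕ) : ℤ) = (n : ℤ) + 1 := by push_cast; rfl
    have h1 := Htpy.of_sq_half (D.sq_tE n)
    rw [tgt_tE, D.incl.src] at h1
    have h2 := h1.append_left (D.incl.isPath (D.isPath_seg n))
    have h3 := ih.append_right (m := [D.incl.onE (D.e n)])
      (z := D.incl.onV (X.src (D.e ((n : ℤ) + 1)))) (isPath_singleton.2 ⟨D.incl.src _, by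
        rw [D.incl.tgt, D.path]⟩)
    rw [List.append_assoc] at h3
    have h4 := h2.trans h3
    rw [seg, List.range_succ, List.map_append, List.map_append, hsucc]
    simpa [seg] using h4

theorem tDeck_mul_ofHom : D.tDeck * D.ofHom hX D.g = D.ofHom hX D.g * D.tDeck := by
  have h1 : X.src (D.e (D.m : ℕ)) = ρ D.g • D.origin := by
    rw [origin, ← src_smul, D.shift, zero_add]
  have h2 := D.isPath_seg D.m
  rw [h1] at h2
  rw [D.ofHom_eq hX h2, tDeck, transl_mul, transl_mul]
  have h3 := D.htpy_seg D.m
  have h4 : D.tE (D.m : ℕ) = D.tE 0 := by rw [← D.tE_add 0, zero_add]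
  rw [h1, h4, ← (D.incl_onV_eq).2 ⟨D.g, rfl⟩] at h3
  exact (transl_eq h3).symm

/-- The action of the HNN extension on the universal cover. -/
noncomputable def actHom : D.HNN →* D.deck :=
  HNNExtension.lift (D.ofHom hX) D.tDeck (by
    rintro ⟨_, j, rfl⟩
    have h : Commute D.tDeck (D.ofHom hX D.g) := D.tDeck_mul_ofHom hX
    have h1 := (h.zpow_right j).eq
    rw [← map_zpow] at h1
    exact h1)

theorem actHom_of (γ : Γ) : D.actHom hX (HNNExtension.of γ) = D.ofHom hX γ :=
  HNNExtension.lift_of _ _ _ _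

theorem actHom_t : D.actHom hX HNNExtension.t = D.tDeck := HNNExtension.lift_t _ _ _

/-- Left translation of the HNN extension on itself is free. Through this equivariant map the action
on `Y` is free on vertices too, and `actHom` is injective. -/
theorem lab_smul (a : D.HNN) (x : D.Y.V) : D.lab ((D.actHom hX a).1 • x) = a * D.lab x := by
  induction a using HNNExtension.induction_on generalizing x with
  | of γ =>
    rw [actHom_of]
    refine (vol_transl _ _ _ _ _).trans ?_
    rw [D.volt_prod_incl (D.isPath_pathTo hX _), coord_origin, coord_smul, coord_origin]
    simp [lab]
  | t =>
    rw [actHom_t]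
    refine (vol_transl _ _ _ _ _).trans ?_
    have : D.tLabel 0 = HNNExtension.t := by
      have h := D.coord_origin
      rw [origin] at h
      simp [tLabel, h]
    simp [volt_tE, lab, this]
  | mul a b ha hb =>
    rw [map_mul, mul_assoc, ← hb, ← ha, ← mul_smul]
    rfl
  | inv a ha =>
    rw [eq_inv_mul_iff_mul_eq, ← ha, ← mul_smul, map_inv]
    congr 1
    exact smul_inv_smul (D.actHom hX a).1 x

/-- The lift to the universal cover of the map from `X`, on vertices. -/
noncomputable def liftV (x : X.V) : D.Y.V :=
  vtx ((D.pathTo hX x).map D.incl.onE) (D.incl.isPath (D.isPath_pathTo hX x))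

theorem liftV_eq {x : X.V} {l : List X.E} (h : X.IsPath D.origin l x) :
    D.liftV hX x = vtx (l.map D.incl.onE) (D.incl.isPath h) :=
  (vtx_eq_iff _ _).2 (D.htpy_incl hX (D.isPath_pathTo hX x) h)

theorem exists_liftE (e : X.E) : ∃ t : D.Y.E, D.Y.src t = D.liftV hX (X.src e) ∧
    label t = D.incl.onE e ∧ D.Y.tgt t = D.liftV hX (X.tgt e) := by
  obtain ⟨t, h1, h2, h3⟩ := exists_edge_vtx _
    (D.incl.isPath (D.isPath_pathTo hX (X.src e))) (D.incl.onE e) (D.incl.src e)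
  refine ⟨t, h1, h2, ?_⟩
  rw [h3, D.liftV_eq hX ((D.isPath_pathTo hX (X.src e)).append (isPath_singleton.2 ⟨rfl, rfl⟩))]
  exact vtx_congr (D.incl.tgt e) (by rw [List.map_append]; rfl)

/-- The lift to the universal cover of the map from `X`, on edges. -/
noncomputable def liftE (e : X.E) : D.Y.E := (D.exists_liftE hX e).choose

theorem src_liftE (e : X.E) : D.Y.src (D.liftE hX e) = D.liftV hX (X.src e) :=
  (D.exists_liftE hX e).choose_spec.1

theorem label_liftE (e : X.E) : label (D.liftE hX e) = D.incl.onE e :=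
  (D.exists_liftE hX e).choose_spec.2.1

theorem tgt_liftE (e : X.E) : D.Y.tgt (D.liftE hX e) = D.liftV hX (X.tgt e) :=
  (D.exists_liftE hX e).choose_spec.2.2

/-- The lift to the universal cover of the map from `X`. -/
noncomputable def lift : Hom X D.Y where
  onV := D.liftV hX
  onE := D.liftE hX
  src := D.src_liftE hX
  inv e := by
    refine edge_ext ?_ ?_
    · rw [src_liftE]
      exact (D.tgt_liftE hX e).symm
    · rw [label_liftE, D.incl.inv, ← label_liftE D hX]
      rfl
  sq a b c d h := by
    obtain ⟨h1, h2, h3, h4⟩ := Sq.tgt_eq h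
    refine sq_intro ?_ ?_ ?_ ?_ ?_
    · simp only [label_liftE]
      exact D.incl.sq _ _ _ _ h
    all_goals rw [tgt_liftE, src_liftE]
    · rw [h1]
    · rw [h2]
    · rw [h3]
    · rw [h4]

theorem of_smul_liftV (γ : Γ) (x : X.V) :
    (D.actHom hX (HNNExtension.of γ)).1 • D.liftV hX x = D.liftV hX (ρ γ • x) := by
  have h1 := (D.isPath_pathTo hX (ρ γ • D.origin)).append (isPath_smul γ (D.isPath_pathTo hX x))
  rw [actHom_of, D.liftV_eq hX h1]
  refine (transl_smul _ _ (D.incl.isPath (D.isPath_pathTo hX x))).trans ?_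
  exact vtx_congr ((D.incl_onV_eq).2 ⟨γ, rfl⟩) (by rw [List.map_append, map_incl_smul])

theorem of_smul_liftE (γ : Γ) (e : X.E) :
    (D.actHom hX (HNNExtension.of γ)).1 • D.liftE hX e = D.liftE hX (ρ γ • e) := by
  refine edge_ext ?_ ?_
  · rw [src_smul, src_liftE, src_liftE, of_smul_liftV, src_smul]
  · rw [label_smul (D.actHom hX _).2, label_liftE, label_liftE, incl_onE_smul]

theorem exists_tEdge (n : ℕ) : ∃ t : D.Y.E, D.Y.src t = D.liftV hX (X.src (D.e n)) ∧
    label t = D.tE n ∧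
    D.Y.tgt t = (D.actHom hX HNNExtension.t).1 • D.liftV hX (X.src (D.e n)) := by
  obtain ⟨t, h1, h2, h3⟩ := exists_edge_vtx _
    (D.incl.isPath (D.isPath_seg n)) (D.tE n) (D.src_tE n)
  rw [D.liftV_eq hX (D.isPath_seg n)]
  refine ⟨t, h1, h2, ?_⟩
  rw [h3, actHom_t]
  refine Eq.trans ?_ (transl_smul _ _ (D.incl.isPath (D.isPath_seg n))).symm
  have h4 := D.htpy_seg n
  exact (vtx_congr (D.tgt_tE n) rfl).trans ((vtx_eq_iff h4.left h4.right).2 h4)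

/-- The lift, at a vertex of the axis, of an edge across the annulus. -/
noncomputable def tEdge (n : ℕ) : D.Y.E := (D.exists_tEdge hX n).choose

theorem src_tEdge (n : ℕ) : D.Y.src (D.tEdge hX n) = D.liftV hX (X.src (D.e n)) :=
  (D.exists_tEdge hX n).choose_spec.1

theorem label_tEdge (n : ℕ) : label (D.tEdge hX n) = D.tE n :=
  (D.exists_tEdge hX n).choose_spec.2.1

theorem tgt_tEdge (n : ℕ) : D.Y.tgt (D.tEdge hX n) =
    (D.actHom hX HNNExtension.t).1 • D.liftV hX (X.src (D.e n)) :=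
  (D.exists_tEdge hX n).choose_spec.2.2

theorem label_actHom_smul (a : D.HNN) (t : D.Y.E) :
    label ((D.actHom hX a).1 • t) = label t := label_smul (D.actHom hX a).2 t

theorem actHom_mul_smul (a b : D.HNN) (x : D.Y.V) :
    (D.actHom hX (a * b)).1 • x = (D.actHom hX a).1 • (D.actHom hX b).1 • x := by
  rw [map_mul, ← mul_smul]
  rfl

/-- Every vertex of the universal cover is a translate of a vertex of the lift of `X`. -/
theorem exists_smul_liftV (v : D.Y.V) (x : X.V) (h : endpt v = D.incl.onV x) :
    ∃ a : D.HNN, v = (D.actHom hX a).1 • D.liftV hX x := by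
  -- Induction along a path in `Y`. The claim is carried for all `x` over the current vertex at
  -- once: two such `x` differ by an element of `Γ`, which the translating element absorbs (`hrep`).
  have key : ∀ (L : List D.Y.E) (u v : D.Y.V), D.Y.IsPath u L v →
      (∀ x, endpt u = D.incl.onV x → ∃ a : D.HNN, u = (D.actHom hX a).1 • D.liftV hX x) →
      (∀ x, endpt v = D.incl.onV x → ∃ a : D.HNN, v = (D.actHom hX a).1 • D.liftV hX x) := by
    have hrep : ∀ (a : D.HNN) (x y : X.V), D.incl.onV x = D.incl.onV y →
        ∃ b : D.HNN, (D.actHom hX a).1 • D.liftV hX x = (D.actHom hX b).1 • D.liftV hX y := by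
      intro a x y h
      obtain ⟨γ, rfl⟩ := (D.incl_onV_eq).1 h.symm
      exact ⟨a * HNNExtension.of γ, by rw [actHom_mul_smul, of_smul_liftV]⟩
    intro L
    induction L with
    | nil => rintro u _ rfl h; exact h
    | cons t L ih =>
      rintro u v ⟨rfl, hL⟩ hu
      refine ih _ _ hL ?_
      rcases D.base_edge_cases (label t) with ⟨f, hf⟩ | ⟨n, hn | hn⟩
      · obtain ⟨a, ha⟩ := hu (X.src f) (by rw [← src_label, hf, D.incl.src])
        have ht : t = (D.actHom hX a).1 • D.liftE hX f := edge_ext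
          (by rw [ha, src_smul, src_liftE]) (by rw [label_actHom_smul, label_liftE, hf])
        have h1 : D.Y.tgt t = (D.actHom hX a).1 • D.liftV hX (X.tgt f) := by
          rw [ht, tgt_smul, tgt_liftE]
        intro x hx
        rw [h1] at hx ⊢
        exact hrep a _ _ (((D.actHom hX a).2.1 _).symm.trans hx)
      · obtain ⟨a, ha⟩ := hu (X.src (D.e n)) (by rw [← src_label, hn, src_tE])
        have ht : t = (D.actHom hX a).1 • D.tEdge hX n := edge_ext
          (by rw [ha, src_smul, src_tEdge]) (by rw [label_actHom_smul, label_tEdge, hn])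
        have h1 : D.Y.tgt t =
            (D.actHom hX (a * HNNExtension.t)).1 • D.liftV hX (X.src (D.e n)) := by
          rw [ht, tgt_smul, tgt_tEdge, actHom_mul_smul]
        intro x hx
        rw [h1] at hx ⊢
        exact hrep _ _ _ (((D.actHom hX _).2.1 _).symm.trans hx)
      · obtain ⟨a, ha⟩ := hu (X.src (D.e n)) (by
          rw [← src_label, hn]; exact D.tgt_tE n)
        have ht : t = D.Y.inv ((D.actHom hX (a * HNNExtension.t⁻¹)).1 • D.tEdge hX n) := edge_ext
          (by
            change _ = D.Y.tgt _
            rw [ha, tgt_smul, tgt_tEdge, ← actHom_mul_smul, inv_mul_cancel_right])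
          (by
            rw [hn]
            change _ = D.base.inv (label _)
            rw [label_actHom_smul, label_tEdge])
        have h1 : D.Y.tgt t =
            (D.actHom hX (a * HNNExtension.t⁻¹)).1 • D.liftV hX (X.src (D.e n)) := by
          rw [ht, tgt_inv, src_smul, src_tEdge]
        intro x hx
        rw [h1] at hx ⊢
        exact hrep _ _ _ (((D.actHom hX _).2.1 _).symm.trans hx)
  have hbase : baseVertex D.base D.basePoint = D.liftV hX D.origin :=
    (D.liftV_eq hX (isPath_nil D.origin)).symm
  obtain ⟨L, hL⟩ := exists_isPath (baseVertex D.base D.basePoint) v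
  refine key L _ v hL (fun x hx => ?_) x h
  obtain ⟨γ, rfl⟩ := (D.incl_onV_eq).1 hx
  refine ⟨HNNExtension.of γ⁻¹, ?_⟩
  rw [of_smul_liftV, ← mul_smul, ← map_mul, inv_mul_cancel, map_one, one_smul, hbase]

theorem actHom_injective : Function.Injective (D.actHom hX) := by
  rw [injective_iff_map_eq_one]
  intro a ha
  have h1 := D.lab_smul hX a (D.liftV hX D.origin)
  rw [ha] at h1
  have h2 : (1 : D.deck).1 • D.liftV hX D.origin = D.liftV hX D.origin :=
    one_smul D.Y.Aut _
  rw [h2] at h1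
  exact (mul_eq_right.1 h1.symm)

/-- The HNN extension is transitive on the fibre of the base vertex, and a deck transformation is
determined by the image of that vertex. -/
theorem actHom_surjective : Function.Surjective (D.actHom hX) := by
  intro f
  obtain ⟨a, ha⟩ := D.exists_smul_liftV hX (f.1 • D.liftV hX D.origin) D.origin (f.2.1 _)
  exact ⟨a, (deck_ext _ ha).symm⟩

/-- The deck group is the HNN extension. -/
noncomputable def deckEquiv : D.HNN ≃* D.deck :=
  MulEquiv.ofBijective (D.actHom hX) ⟨D.actHom_injective hX, D.actHom_surjective hX⟩

/-- The action of the HNN extension on the universal cover. -/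
noncomputable def act : D.HNN →* D.Y.Aut := D.deck.subtype.comp (D.actHom hX)

theorem act_isFree (hb : D.base.IsNonPositivelyCurved) : IsFree (D.act hX) := by
  refine isFree_of_deck hb (fun a => (D.actHom hX a).2) fun a ha x hx => ha ?_
  have h1 := D.lab_smul hX a x
  change (D.actHom hX a).1 • x = x at hx
  rw [hx] at h1
  exact mul_eq_right.1 h1.symm

theorem act_isCocompact (hc : IsCocompact ρ) : IsCocompact (D.act hX) := by
  have : Finite D.base.V := quotient_finite_V hρ hc
  have : NeZero D.m := ⟨D.pos.ne'⟩
  have h := quotient_finite_E hρ hc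
  have : Finite D.base.E := inferInstanceAs (Finite ((quotient ρ hρ).E ⊕ (ZMod D.m × Bool)))
  refine isCocompact_of_deck (fun a => (D.actHom hX a).2) fun x y hxy => ?_
  obtain ⟨z, hz⟩ : ∃ z, D.incl.onV z = endpt x := quotientMap_onV_surjective hρ _
  obtain ⟨a, ha⟩ := D.exists_smul_liftV hX x z hz.symm
  obtain ⟨b, hb⟩ := D.exists_smul_liftV hX y z (hxy.symm.trans hz.symm)
  refine ⟨b * a⁻¹, ?_⟩
  change (D.actHom hX (b * a⁻¹)).1 • x = y
  rw [ha, ← actHom_mul_smul, inv_mul_cancel_right, hb]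

end AxialLoop

end SquareComplex

namespace SquareComplex

/-! ### Products of graphs -/

section Prod

variable {V₁ V₂ : Type u} {T₁ : SimpleGraph V₁} {T₂ : SimpleGraph V₂}

/-- A horizontal edge of a product. -/
def hE (e : T₁.Dart) (y : V₂) : (prod T₁ T₂).E := Sum.inl (e, y)

/-- A vertical edge of a product. -/
def vE (x : V₁) (f : T₂.Dart) : (prod T₁ T₂).E := Sum.inr (x, f)

theorem hE_inj {e e' : T₁.Dart} {y y' : V₂} :
    (hE e y : (prod T₁ T₂).E) = hE e' y' ↔ e = e' ∧ y = y' :=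
  Sum.inl_injective.eq_iff.trans Prod.mk_inj

theorem vE_inj {x x' : V₁} {f f' : T₂.Dart} :
    (vE x f : (prod T₁ T₂).E) = vE x' f' ↔ x = x' ∧ f = f' :=
  Sum.inr_injective.eq_iff.trans Prod.mk_inj

theorem hE_ne_vE {e : T₁.Dart} {y : V₂} {x : V₁} {f : T₂.Dart} :
    (hE e y : (prod T₁ T₂).E) = vE x f ↔ False := ⟨fun h => Sum.inl_ne_inr h, False.elim⟩

theorem vE_ne_hE {e : T₁.Dart} {y : V₂} {x : V₁} {f : T₂.Dart} :
    (vE x f : (prod T₁ T₂).E) = hE e y ↔ False := ⟨fun h => Sum.inr_ne_inl h, False.elim⟩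

theorem prod_edge_cases (a : (prod T₁ T₂).E) : (∃ e y, a = hE e y) ∨ ∃ x f, a = vE x f := by
  rcases a with ⟨e, y⟩ | ⟨x, f⟩
  · exact .inl ⟨e, y, rfl⟩
  · exact .inr ⟨x, f, rfl⟩

theorem inv_hE (e : T₁.Dart) (y : V₂) : (prod T₁ T₂).inv (hE e y) = hE e.symm y := rfl

theorem inv_vE (x : V₁) (f : T₂.Dart) : (prod T₁ T₂).inv (vE x f) = vE x f.symm := rfl

theorem src_hE (e : T₁.Dart) (y : V₂) :
    (prod T₁ T₂).src (hE e y) = prodVertex T₁ T₂ e.fst y := rfl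

theorem src_vE (x : V₁) (f : T₂.Dart) :
    (prod T₁ T₂).src (vE x f) = prodVertex T₁ T₂ x f.fst := rfl

theorem tgt_hE (e : T₁.Dart) (y : V₂) :
    (prod T₁ T₂).tgt (hE e y) = prodVertex T₁ T₂ e.snd y := rfl

theorem tgt_vE (x : V₁) (f : T₂.Dart) :
    (prod T₁ T₂).tgt (vE x f) = prodVertex T₁ T₂ x f.snd := rfl

theorem prodVertex_inj {x x' : V₁} {y y' : V₂} :
    prodVertex T₁ T₂ x y = prodVertex T₁ T₂ x' y' ↔ x = x' ∧ y = y' := Prod.mk_inj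

theorem exists_prodVertex (v : (prod T₁ T₂).V) : ∃ x y, v = prodVertex T₁ T₂ x y :=
  ⟨v.1, v.2, rfl⟩

theorem prod_edge_ext {a b : (prod T₁ T₂).E} (h : (prod T₁ T₂).src a = (prod T₁ T₂).src b)
    (h' : (prod T₁ T₂).tgt a = (prod T₁ T₂).tgt b) : a = b := by
  rcases prod_edge_cases a with ⟨e, y, rfl⟩ | ⟨x, f, rfl⟩ <;>
  rcases prod_edge_cases b with ⟨e', y', rfl⟩ | ⟨x', f', rfl⟩ <;>
  simp only [src_hE, src_vE, tgt_hE, tgt_vE, prodVertex_inj] at h h'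
  · exact hE_inj.2 ⟨SimpleGraph.Dart.ext _ _ (Prod.ext h.1 h'.1), h.2⟩
  · exact absurd (h.1.trans h'.1.symm) e.fst_ne_snd
  · exact absurd (h.2.trans h'.2.symm) f.fst_ne_snd
  · exact vE_inj.2 ⟨h.1, SimpleGraph.Dart.ext _ _ (Prod.ext h.2 h'.2)⟩

theorem prod_sq_h (e : T₁.Dart) (f : T₂.Dart) : (prod T₁ T₂).Sq (hE e f.fst) (vE e.snd f)
    (hE e.symm f.snd) (vE e.fst f.symm) := ⟨e, f, .refl⟩

theorem prod_sq_v (e : T₁.Dart) (f : T₂.Dart) : (prod T₁ T₂).Sq (vE e.fst f) (hE e f.snd)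
    (vE e.snd f.symm) (hE e.symm f.fst) :=
  (prod T₁ T₂).sq_rot _ _ _ _ (prod_sq_h e.symm f)

theorem prod_sq_cases {a b c d : (prod T₁ T₂).E} (h : (prod T₁ T₂).Sq a b c d) :
    ∃ (e : T₁.Dart) (f : T₂.Dart),
      (a = hE e f.fst ∧ b = vE e.snd f ∧ c = hE e.symm f.snd ∧ d = vE e.fst f.symm) ∨
      (a = vE e.fst f ∧ b = hE e f.snd ∧ c = vE e.snd f.symm ∧ d = hE e.symm f.fst) := by
  obtain ⟨e, f, h⟩ := h
  have h' := h.cases_eq (by rintro (e | f) <;> simp)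
  simp only [Sum.map_inl, Sum.map_inr, SimpleGraph.Dart.symm_symm] at h'
  rcases h' with h | h | h | h | h | h | h | h
  · exact ⟨e, f, .inl h⟩
  · exact ⟨e.symm, f, .inr h⟩
  · exact ⟨e.symm, f.symm, .inl h⟩
  · exact ⟨e, f.symm, .inr h⟩
  · exact ⟨e, f, .inr h⟩
  · exact ⟨e, f.symm, .inl h⟩
  · exact ⟨e.symm, f.symm, .inr h⟩
  · exact ⟨e.symm, f, .inl h⟩

theorem prod_linkAdj {a b : (prod T₁ T₂).E} (h : (prod T₁ T₂).LinkAdj a b) :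
    (∃ e y x f, a = hE e y ∧ b = vE x f) ∨ (∃ e y x f, a = vE x f ∧ b = hE e y) := by
  obtain ⟨c, d, h⟩ := h
  have ha := (prod T₁ T₂).inv_inv a
  obtain ⟨e, f, ⟨h1, h2, -⟩ | ⟨h1, h2, -⟩⟩ := prod_sq_cases h
  · exact .inl ⟨_, _, _, _, by rw [← ha, h1, inv_hE], h2⟩
  · exact .inr ⟨_, _, _, _, by rw [← ha, h1, inv_vE], h2⟩

/-- Corners join horizontal to vertical directions, so links are bipartite and have no loops or
triangles. A square is determined by its two sides at a corner. -/
theorem prod_isNonPositivelyCurved : (prod T₁ T₂).IsNonPositivelyCurved := by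
  refine ⟨fun a h => ?_, fun a b c d c' d' h h' => ?_, fun a b c d h hf => ?_, ?_⟩
  · rcases prod_linkAdj h with ⟨e, y, x, f, h1, h2⟩ | ⟨e, y, x, f, h1, h2⟩
    · exact hE_ne_vE.1 (h1.symm.trans h2)
    · exact vE_ne_hE.1 (h1.symm.trans h2)
  · obtain ⟨e, f, ⟨rfl, rfl, rfl, rfl⟩ | ⟨rfl, rfl, rfl, rfl⟩⟩ := prod_sq_cases h <;>
    obtain ⟨e', f', ⟨h1, h2, rfl, rfl⟩ | ⟨h1, h2, rfl, rfl⟩⟩ := prod_sq_cases h' <;>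
    simp only [hE_inj, vE_inj, hE_ne_vE, vE_ne_hE] at h1 h2
    · obtain rfl := h1.1
      obtain rfl := h2.2
      exact ⟨rfl, rfl⟩
    · obtain rfl := h1.2
      obtain rfl := h2.1
      exact ⟨rfl, rfl⟩
  · obtain ⟨e, f, ⟨rfl, rfl, rfl, rfl⟩ | ⟨rfl, rfl, rfl, rfl⟩⟩ := prod_sq_cases h
    · exact e.symm_ne (hE_inj.1 hf.1).1.symm
    · exact e.symm_ne (hE_inj.1 hf.2).1.symm
  · rintro a b c ⟨h1, h2, h3⟩
    rcases prod_linkAdj h1 with ⟨_, _, _, _, h4, h5⟩ | ⟨_, _, _, _, h4, h5⟩ <;>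
    rcases prod_linkAdj h2 with ⟨_, _, _, _, h6, h7⟩ | ⟨_, _, _, _, h6, h7⟩ <;>
    rcases prod_linkAdj h3 with ⟨_, _, _, _, h8, h9⟩ | ⟨_, _, _, _, h8, h9⟩ <;>
    simp [h4, h5, h7, hE_ne_vE, vE_ne_hE] at h6 h8 h9

/-- Walks in a graph that is mapped to a square complex give edge paths. -/
theorem isPath_of_walk {V : Type*} {T : SimpleGraph V} {X : SquareComplex.{u}} {p : V → X.V}
    {m : T.Dart → X.E} (hsrc : ∀ d, X.src (m d) = p d.fst)
    (hinv : ∀ d, X.inv (m d) = m d.symm) {a b : V} (w : T.Walk a b) :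
    X.IsPath (p a) (w.darts.map m) (p b) := by
  induction w with
  | nil => rfl
  | cons h w ih =>
    refine ⟨hsrc _, ?_⟩
    rw [tgt, hinv, hsrc]
    exact ih

/-- In a tree, extending a geodesic by an edge gives a geodesic up to homotopy. -/
theorem htpy_of_isAcyclic {V : Type*} {T : SimpleGraph V} (hT : T.IsAcyclic)
    {X : SquareComplex.{u}} {p : V → X.V}
    {m : T.Dart → X.E} (hsrc : ∀ d, X.src (m d) = p d.fst)
    (hinv : ∀ d, X.inv (m d) = m d.symm) {a : V} (d : T.Dart) {w : T.Walk a d.fst}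
    {w' : T.Walk a d.snd} (hw : w.IsPath) (hw' : w'.IsPath) :
    X.Htpy (p a) (p d.snd) (w.darts.map m ++ [m d]) (w'.darts.map m) := by
  have htgt : ∀ d, X.tgt (m d) = p d.snd := fun d => by rw [tgt, hinv, hsrc]; rfl
  by_cases h : d.fst ∈ w'.support
  · have h1 := hT.path_concat hw hw' d.adj h
    subst h1
    rw [SimpleGraph.Walk.darts_concat, List.concat_eq_append, List.map_append]
    exact .refl ((isPath_of_walk hsrc hinv w).append
      (isPath_singleton.2 ⟨hsrc d, htgt d⟩))
  · have h2 : d.snd ∈ w.support :=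
      hT.mem_support_of_ne_mem_support_of_adj_of_isPath hw hw' d.adj h
    have h1 := hT.path_concat hw' hw d.adj.symm h2
    subst h1
    rw [SimpleGraph.Walk.darts_concat, List.concat_eq_append, List.map_append, List.append_assoc]
    have h3 := (Htpy.backtrack' (htgt d)).append_left (isPath_of_walk hsrc hinv w')
    rw [hinv, List.append_nil] at h3
    exact h3

theorem htpy_slide (e : T₁.Dart) {y y' : V₂} (w : T₂.Walk y y') :
    (prod T₁ T₂).Htpy (prodVertex T₁ T₂ e.fst y) (prodVertex T₁ T₂ e.snd y')
      (w.darts.map (vE e.fst) ++ [hE e y']) (hE e y :: w.darts.map (vE e.snd)) := by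
  induction w with
  | nil => exact .refl ⟨rfl, rfl⟩
  | @cons a b c h w ih =>
    have hd := isPath_of_walk (p := prodVertex T₁ T₂ e.snd) (m := vE e.snd) (src_vE _) (inv_vE _) w
    have h1 := ih.append_left (m := [vE e.fst ⟨(a, b), h⟩]) (isPath_singleton.2 ⟨rfl, rfl⟩)
    have h0 : (prod T₁ T₂).Htpy (prodVertex T₁ T₂ e.fst a) (prodVertex T₁ T₂ e.snd b)
        [vE e.fst ⟨(a, b), h⟩, hE e b] [hE e a, vE e.snd ⟨(a, b), h⟩] :=
      Htpy.of_sq_half (prod_sq_v e ⟨(a, b), h⟩)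
    have h2 := h0.append_right hd
    exact h1.trans h2

/-- The standard path to `(x, y)` runs horizontally at height `y₀` and then vertically. A vertical
edge at its end is absorbed within the second tree; a horizontal one is first slid down to height
`y₀` through a column of squares (`htpy_slide`) and then absorbed in the first tree. -/
theorem prod_isSimplyConnected (h₁ : T₁.IsTree) (h₂ : T₂.IsTree) :
    (prod T₁ T₂).IsSimplyConnected := by
  obtain ⟨x₀⟩ := h₁.1.nonempty
  obtain ⟨y₀⟩ := h₂.1.nonempty
  choose p hp using fun x => (h₁.existsUnique_path x₀ x).exists
  choose q hq using fun y => (h₂.existsUnique_path y₀ y).exists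
  let P : V₁ → V₂ → List (prod T₁ T₂).E := fun x y =>
    (p x).darts.map (fun e => hE e y₀) ++ (q y).darts.map (vE x)
  have hh : ∀ {a b : V₁} (w : T₁.Walk a b), (prod T₁ T₂).IsPath (prodVertex T₁ T₂ a y₀)
      (w.darts.map (fun e => hE e y₀)) (prodVertex T₁ T₂ b y₀) :=
    isPath_of_walk (p := fun x => prodVertex T₁ T₂ x y₀) (fun _ => rfl) (fun _ => rfl)
  have hv : ∀ (x : V₁) {a b : V₂} (w : T₂.Walk a b), (prod T₁ T₂).IsPath (prodVertex T₁ T₂ x a)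
      (w.darts.map (vE x)) (prodVertex T₁ T₂ x b) := fun x {a b} =>
    isPath_of_walk (p := fun y => prodVertex T₁ T₂ x y) (src_vE _) (inv_vE _)
  refine isSimplyConnected_of_paths (prodVertex T₁ T₂ x₀ y₀) (fun v => P v.1 v.2)
    (fun v => (hh _).append (hv _ _)) fun a => ?_
  rcases prod_edge_cases a with ⟨e, y, rfl⟩ | ⟨x, f, rfl⟩
  · change (prod T₁ T₂).Htpy _ (prodVertex T₁ T₂ e.snd y) (P e.fst y ++ [hE e y]) (P e.snd y)
    have h1 := (htpy_slide e (q y)).append_left (hh (p e.fst))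
    have h2 := (htpy_of_isAcyclic h₁.2 (p := fun x => prodVertex T₁ T₂ x y₀)
      (m := fun e => hE e y₀) (fun _ => rfl) (fun _ => rfl) e (hp _) (hp _)).append_right
      (hv e.snd (q y))
    simp only [P, List.append_assoc] at h1 h2 ⊢
    exact h1.trans h2
  · change (prod T₁ T₂).Htpy _ (prodVertex T₁ T₂ x f.snd) (P x f.fst ++ [vE x f]) (P x f.snd)
    have h2 := (htpy_of_isAcyclic h₂.2 (p := fun y => prodVertex T₁ T₂ x y)
      (m := vE x) (src_vE x) (inv_vE x) f (hq _) (hq _)).append_left (hh (p x))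
    simpa only [P, List.append_assoc] using h2

/-! ### Automorphisms of products -/

/-- The automorphism `f` of a product is the product of `f₁` and `f₂`. -/
structure Splits (f : (prod T₁ T₂).Aut) (f₁ : V₁ → V₁) (f₂ : V₂ → V₂) : Prop where
  vertex : ∀ x y, f • prodVertex T₁ T₂ x y = prodVertex T₁ T₂ (f₁ x) (f₂ y)
  adj₁ : ∀ x x', T₁.Adj x x' → T₁.Adj (f₁ x) (f₁ x')
  adj₂ : ∀ y y', T₂.Adj y y' → T₂.Adj (f₂ y) (f₂ y')
  inj₁ : Function.Injective f₁
  inj₂ : Function.Injective f₂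

theorem Splits.mul {f g : (prod T₁ T₂).Aut} {f₁ g₁ : V₁ → V₁} {f₂ g₂ : V₂ → V₂}
    (hf : Splits f f₁ f₂) (hg : Splits g g₁ g₂) : Splits (f * g) (f₁ ∘ g₁) (f₂ ∘ g₂) :=
  ⟨fun x y => by rw [mul_smul, hg.vertex, hf.vertex]; rfl,
    fun _ _ h => hf.adj₁ _ _ (hg.adj₁ _ _ h), fun _ _ h => hf.adj₂ _ _ (hg.adj₂ _ _ h),
    hf.inj₁.comp hg.inj₁, hf.inj₂.comp hg.inj₂⟩

theorem Splits.pow {f : (prod T₁ T₂).Aut} {f₁ : V₁ → V₁} {f₂ : V₂ → V₂}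
    (hf : Splits f f₁ f₂) (n : ℕ) : Splits (f ^ n) (f₁^[n]) (f₂^[n]) := by
  induction n with
  | zero =>
    exact ⟨fun x y => by rw [pow_zero, one_smul]; rfl, fun _ _ h => h, fun _ _ h => h,
      Function.injective_id, Function.injective_id⟩
  | succ n ih =>
    rw [pow_succ', Function.iterate_succ', Function.iterate_succ']
    exact hf.mul ih

theorem Splits.smul_hE {f : (prod T₁ T₂).Aut} {f₁ : V₁ → V₁} {f₂ : V₂ → V₂}
    (hf : Splits f f₁ f₂) (e : T₁.Dart) (y : V₂) :
    f • (hE e y : (prod T₁ T₂).E) = hE ⟨(f₁ e.fst, f₁ e.snd), hf.adj₁ _ _ e.adj⟩ (f₂ y) := by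
  apply prod_edge_ext
  · rw [src_smul, src_hE, hf.vertex, src_hE]
  · rw [tgt_smul, tgt_hE, hf.vertex, tgt_hE]

/-- The projection to `T₁` of the hyperplane dual to an edge of the product. -/
def hType (a : (prod T₁ T₂).E) : Option (Sym2 V₁) :=
  Sum.elim (fun e => some s(e.1.fst, e.1.snd)) (fun _ => none) a

theorem hType_hE (e : T₁.Dart) (y : V₂) :
    hType (hE e y : (prod T₁ T₂).E) = some s(e.fst, e.snd) := rfl

theorem hType_vE (x : V₁) (f : T₂.Dart) : hType (vE x f : (prod T₁ T₂).E) = none := rfl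

theorem hType_inv (a : (prod T₁ T₂).E) : hType ((prod T₁ T₂).inv a) = hType a := by
  rcases prod_edge_cases a with ⟨e, y, rfl⟩ | ⟨x, f, rfl⟩
  · rw [inv_hE, hType_hE, hType_hE]; exact congrArg some Sym2.eq_swap
  · rfl

theorem hType_sq {a b c d : (prod T₁ T₂).E} (h : (prod T₁ T₂).Sq a b c d) :
    hType c = hType a ∧ ((hType a).isSome ↔ ¬ (hType b).isSome) := by
  obtain ⟨e, f, ⟨rfl, rfl, rfl, rfl⟩ | ⟨rfl, rfl, rfl, rfl⟩⟩ := prod_sq_cases h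
  · simp only [hType_hE, hType_vE]
    exact ⟨congrArg some Sym2.eq_swap, by simp⟩
  · simp only [hType_hE, hType_vE]
    simp

theorem hType_eq_of_dual_eq {a b : (prod T₁ T₂).E} (h : (prod T₁ T₂).dual a = (prod T₁ T₂).dual b) :
    hType a = hType b :=
  eq_of_dual_eq hType hType_inv (fun _ _ _ _ h => (hType_sq h).1) h

theorem dual_hE (hT : T₂.Preconnected) (e : T₁.Dart) (y y' : V₂) :
    (prod T₁ T₂).dual (hE e y) = (prod T₁ T₂).dual (hE e y') := by
  obtain ⟨w⟩ := hT y y'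
  induction w with
  | nil => rfl
  | @cons a b c h w ih =>
    rw [← ih, (Sq.dual_eq (prod_sq_h e ⟨(a, b), h⟩)).1, ← inv_hE, dual_inv]

theorem dual_vE (hT : T₁.Preconnected) (f : T₂.Dart) (x x' : V₁) :
    (prod T₁ T₂).dual (vE x f) = (prod T₁ T₂).dual (vE x' f) := by
  obtain ⟨w⟩ := hT x x'
  induction w with
  | nil => rfl
  | @cons a b c h w ih =>
    rw [← ih, (Sq.dual_eq (prod_sq_v ⟨(a, b), h⟩ f)).1, ← inv_vE, dual_inv]

theorem isSome_hType_smul {f : (prod T₁ T₂).Aut} {e : T₁.Dart} {k : T₂.Dart}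
    (h : ¬ (hType (f • (vE e.snd k : (prod T₁ T₂).E))).isSome) :
    (hType (f • (hE e k.fst : (prod T₁ T₂).E))).isSome :=
  (hType_sq ((sq_smul f _ _ _ _).2 (prod_sq_h e k))).2.2 h

/-- An automorphism maps opposite sides of a square to opposite sides and adjacent sides to adjacent
ones. By connectedness, the type of the image of one horizontal edge decides the types of all
images, so `h` excludes an exchange of the two factors. Then vertical moves do not affect the first
coordinate of the image, nor horizontal moves the second. -/
theorem exists_splits (hT₁ : T₁.Preconnected) (hT₂ : T₂.Preconnected) (f : (prod T₁ T₂).Aut)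
    (e₀ : T₁.Dart) (f₀ : T₂.Dart) {y₀ : V₂}
    (h : (hType (f • (hE e₀ y₀ : (prod T₁ T₂).E))).isSome) : ∃ f₁ f₂, Splits f f₁ f₂ := by
  have hh : ∀ e y y', hType (f • (hE e y : (prod T₁ T₂).E)) =
      hType (f • (hE e y' : (prod T₁ T₂).E)) := by
    intro e y y'
    apply hType_eq_of_dual_eq
    rw [← smul_dual, ← smul_dual, dual_hE hT₂ e y y']
  have hv : ∀ x x' k, hType (f • (vE x k : (prod T₁ T₂).E)) =
      hType (f • (vE x' k : (prod T₁ T₂).E)) := by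
    intro x x' k
    apply hType_eq_of_dual_eq
    rw [← smul_dual, ← smul_dual, dual_vE hT₁ k x x']
  have hs : ∀ e k y x, (hType (f • (hE e y : (prod T₁ T₂).E))).isSome ↔
      ¬ (hType (f • (vE x k : (prod T₁ T₂).E))).isSome := by
    intro e k y x
    rw [hh e y k.fst, hv x e.snd k]
    exact (hType_sq ((sq_smul f _ _ _ _).2 (prod_sq_h e k))).2
  have hV : ∀ x k, ¬ (hType (f • (vE x k : (prod T₁ T₂).E))).isSome := fun x k =>
    (hs e₀ k y₀ x).1 h
  have hH : ∀ e y, (hType (f • (hE e y : (prod T₁ T₂).E))).isSome := fun e y =>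
    (hs e f₀ y e.fst).2 (hV _ _)
  have h1 : ∀ x y y', (f • prodVertex T₁ T₂ x y).1 = (f • prodVertex T₁ T₂ x y').1 := by
    intro x y y'
    obtain ⟨w⟩ := hT₂ y y'
    induction w with
    | nil => rfl
    | @cons a b c hab w ih =>
      rw [← ih, ← src_vE x ⟨(a, b), hab⟩, ← tgt_vE x ⟨(a, b), hab⟩, ← src_smul, ← tgt_smul]
      have h2 := hV x ⟨(a, b), hab⟩
      rcases prod_edge_cases (f • (vE x ⟨(a, b), hab⟩ : (prod T₁ T₂).E)) with
        ⟨e, y, he⟩ | ⟨z, k, hk⟩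
      · rw [he] at h2; exact absurd rfl h2
      · rw [hk]; rfl
  have h2 : ∀ x x' y, (f • prodVertex T₁ T₂ x y).2 = (f • prodVertex T₁ T₂ x' y).2 := by
    intro x x' y
    obtain ⟨w⟩ := hT₁ x x'
    induction w with
    | nil => rfl
    | @cons a b c hab w ih =>
      rw [← ih, ← src_hE ⟨(a, b), hab⟩, ← tgt_hE ⟨(a, b), hab⟩, ← src_smul, ← tgt_smul]
      have h2 := hH ⟨(a, b), hab⟩ y
      rcases prod_edge_cases (f • (hE ⟨(a, b), hab⟩ y : (prod T₁ T₂).E)) with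
        ⟨e, y, he⟩ | ⟨z, k, hk⟩
      · rw [he]; rfl
      · rw [hk] at h2; cases h2
  have hvert : ∀ x y, f • prodVertex T₁ T₂ x y = prodVertex T₁ T₂
      (f • prodVertex T₁ T₂ x y₀).1 (f • prodVertex T₁ T₂ e₀.fst y).2 := fun x y =>
    Prod.ext (h1 x y y₀) (h2 x e₀.fst y)
  have hinj : Function.Injective (fun v : (prod T₁ T₂).V => f • v) := MulAction.injective f
  refine ⟨fun x => (f • prodVertex T₁ T₂ x y₀).1, fun y => (f • prodVertex T₁ T₂ e₀.fst y).2,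
    hvert, fun x x' hx => ?_, fun y y' hy => ?_, fun x x' hx => ?_, fun y y' hy => ?_⟩
  · have h3 := hH ⟨(x, x'), hx⟩ y₀
    have h4 := src_smul f (hE ⟨(x, x'), hx⟩ y₀)
    have h5 := tgt_smul f (hE ⟨(x, x'), hx⟩ y₀)
    rcases prod_edge_cases (f • (hE ⟨(x, x'), hx⟩ y₀ : (prod T₁ T₂).E)) with ⟨e, y, he⟩ | ⟨z, k, hk⟩
    · rw [he] at h4 h5
      have h6 := e.adj
      have h7 : e.fst = (f • prodVertex T₁ T₂ x y₀).1 := congrArg Prod.fst h4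
      have h8 : e.snd = (f • prodVertex T₁ T₂ x' y₀).1 := congrArg Prod.fst h5
      rwa [h7, h8] at h6
    · rw [hk] at h3; cases h3
  · have h3 := hV e₀.fst ⟨(y, y'), hy⟩
    have h4 := src_smul f (vE e₀.fst ⟨(y, y'), hy⟩)
    have h5 := tgt_smul f (vE e₀.fst ⟨(y, y'), hy⟩)
    rcases prod_edge_cases (f • (vE e₀.fst ⟨(y, y'), hy⟩ : (prod T₁ T₂).E)) with
      ⟨e, y, he⟩ | ⟨z, k, hk⟩
    · rw [he] at h3; exact absurd rfl h3
    · rw [hk] at h4 h5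
      have h6 := k.adj
      have h7 : k.fst = (f • prodVertex T₁ T₂ e₀.fst y).2 := congrArg Prod.snd h4
      have h8 : k.snd = (f • prodVertex T₁ T₂ e₀.fst y').2 := congrArg Prod.snd h5
      rwa [h7, h8] at h6
  · have h3 : f • prodVertex T₁ T₂ x y₀ = f • prodVertex T₁ T₂ x' y₀ := by
      rw [hvert x, hvert x']; exact congrArg (fun z => prodVertex T₁ T₂ z _) hx
    exact (prodVertex_inj.1 (hinj h3)).1
  · have h3 : f • prodVertex T₁ T₂ e₀.fst y = f • prodVertex T₁ T₂ e₀.fst y' := by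
      rw [hvert _ y, hvert _ y']; exact congrArg (fun z => prodVertex T₁ T₂ _ z) hy
    exact (prodVertex_inj.1 (hinj h3)).2

end Prod

end SquareComplex

namespace SquareComplex

open Cover

namespace AxialLoop

variable {Γ : Type v} [Group Γ] {X : SquareComplex.{u}} {ρ : Γ →* X.Aut} {hρ : IsFree ρ}
  (D : AxialLoop ρ hρ)

/-! ### Invariants of hyperplanes -/

/-- The retraction of the HNN extension that kills the stable letter. -/
def ret : D.HNN →* Γ := HNNExtension.lift (MonoidHom.id Γ) 1 (by simp)

/-- The exponent sum of the stable letter. -/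
def height : D.HNN →* Multiplicative ℤ := HNNExtension.lift 1 (.ofAdd 1) (by simp)

theorem ret_of (γ : Γ) : D.ret (HNNExtension.of γ) = γ := HNNExtension.lift_of _ _ _ _

theorem ret_t : D.ret HNNExtension.t = 1 := HNNExtension.lift_t _ _ _

theorem height_of (γ : Γ) : D.height (HNNExtension.of γ) = 1 := HNNExtension.lift_of _ _ _ _

theorem height_t : D.height HNNExtension.t = .ofAdd 1 := HNNExtension.lift_t _ _ _

theorem lab_tgt (t : D.Y.E) : D.lab (D.Y.tgt t) = D.lab (D.Y.src t) * D.volt (label t) :=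
  vol_tgt _ _ _ t

theorem ret_volt (i : ZMod D.m) (s : Bool) : D.ret (D.volt (attachInr (i, s))) = 1 := by
  obtain ⟨n, rfl⟩ := ZMod.intCast_surjective i
  have h : D.ret (D.tLabel n) = 1 := by simp [tLabel, ret_of, ret_t]
  cases s
  · rw [volt_attachInr_false, map_inv, h, inv_one]
  · rw [volt_attachInr_true, h]

theorem ret_lab_tgt {t : D.Y.E} {i : ZMod D.m} {s : Bool} (h : label t = attachInr (i, s)) :
    D.ret (D.lab (D.Y.tgt t)) = D.ret (D.lab (D.Y.src t)) := by
  rw [lab_tgt, map_mul, h, ret_volt, mul_one]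

theorem ret_lab_tgt_incl {t : D.Y.E} {f : X.E} (h : label t = D.incl.onE f) :
    D.ret (D.lab (D.Y.tgt t)) =
      D.ret (D.lab (D.Y.src t)) * ((D.coord (X.src f))⁻¹ * D.coord (X.tgt f)) := by
  rw [lab_tgt, map_mul, h, volt_incl, ret_of]

theorem height_lab_tgt {t : D.Y.E} {f : X.E} (h : label t = D.incl.onE f) :
    D.height (D.lab (D.Y.tgt t)) = D.height (D.lab (D.Y.src t)) := by
  rw [lab_tgt, map_mul, h, volt_incl, height_of, mul_one]

/-- The values of `invariant` on edges with a given label. -/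
noncomputable def labelInvariant (k k' : Multiplicative ℤ) (γ : Γ) :
    D.base.E → X.Hyperplane ⊕ (Multiplicative ℤ × Γ ⧸ Subgroup.zpowers D.g) :=
  Sum.elim (Quotient.lift (fun e => .inl (ρ (γ * (D.coord (X.src e))⁻¹) • X.dual e)) (by
      rintro a _ ⟨g, rfl⟩
      simp only [src_smul, coord_smul, ← smul_dual, smul_smul, ← map_mul]
      simp [mul_assoc]))
    (fun t => .inr (if t.2 then k else k', QuotientGroup.mk
      (γ * (D.coord (X.src (D.e (ZMod.intCast_surjective t.1).choose)))⁻¹)))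

/-- An invariant of hyperplanes of the universal cover. -/
noncomputable def invariant (t : D.Y.E) :
    X.Hyperplane ⊕ (Multiplicative ℤ × Γ ⧸ Subgroup.zpowers D.g) :=
  D.labelInvariant (D.height (D.lab (D.Y.src t))) (D.height (D.lab (D.Y.tgt t)))
    (D.ret (D.lab (D.Y.src t))) (label t)

theorem invariant_incl {t : D.Y.E} {f : X.E} (h : label t = D.incl.onE f) :
    D.invariant t = .inl (ρ (D.ret (D.lab (D.Y.src t)) * (D.coord (X.src f))⁻¹) • X.dual f) := by
  rw [invariant, h]
  rfl

theorem invariant_attachInr {t : D.Y.E} {n : ℤ} {s : Bool}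
    (h : label t = attachInr ((n : ZMod D.m), s)) :
    D.invariant t = .inr (if s then D.height (D.lab (D.Y.src t)) else
      D.height (D.lab (D.Y.tgt t)),
      QuotientGroup.mk (D.ret (D.lab (D.Y.src t)) * (D.coord (X.src (D.e n)))⁻¹)) := by
  rw [invariant, h]
  refine congrArg Sum.inr (Prod.ext rfl ?_)
  -- Two integers that represent the same crossing edge differ by a multiple of `m`, which changes
  -- the representative by a power of `g` and leaves the coset alone.
  have h1 := (ZMod.intCast_surjective (n : ZMod D.m)).choose_spec
  generalize (ZMod.intCast_surjective (n : ZMod D.m)).choose = n' at h1 ⊢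
  obtain ⟨j, hj⟩ := (ZMod.intCast_eq_intCast_iff_dvd_sub _ _ _).1 h1
  obtain rfl : n = n' + j * D.m := by linarith
  refine QuotientGroup.eq.2 ⟨-j, ?_⟩
  rw [← D.shift_zpow, src_smul, coord_smul]
  simp

theorem invariant_inv (t : D.Y.E) : D.invariant (D.Y.inv t) = D.invariant t := by
  have hs : D.Y.src (D.Y.inv t) = D.Y.tgt t := rfl
  have hl : label (D.Y.inv t) = D.base.inv (label t) := rfl
  rcases attachAnnulus_edge_cases (label t) with ⟨f, hf⟩ | ⟨i, s, hi⟩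
  · obtain ⟨f, rfl⟩ := quotientMap_onE_surjective hρ f
    change label t = D.incl.onE f at hf
    have h1 : label (D.Y.inv t) = D.incl.onE (X.inv f) := by rw [hl, hf, D.incl.inv]
    rw [D.invariant_incl hf, D.invariant_incl h1, hs, D.ret_lab_tgt_incl hf, dual_inv]
    simp [tgt, mul_assoc]
  · obtain ⟨n, rfl⟩ := ZMod.intCast_surjective i
    have h1 : label (D.Y.inv t) = attachInr ((n : ZMod D.m), !s) := by rw [hl, hi]; rfl
    rw [D.invariant_attachInr hi, D.invariant_attachInr h1, hs, D.ret_lab_tgt hi, tgt_inv]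
    cases s <;> rfl

theorem invariant_sq_incl {a b c d : D.Y.E} (h : D.Y.Sq a b c d) {f : X.E} {i : ZMod D.m}
    {s : Bool} (ha : label a = D.incl.onE f) (hc : label c = D.incl.onE (X.inv f))
    (hd : label d = attachInr (i, s)) : D.invariant c = D.invariant a := by
  obtain ⟨-, -, h3, h4⟩ := Sq.tgt_eq h
  have hl : label (D.Y.inv c) = D.base.inv (label c) := rfl
  have hc' : label (D.Y.inv c) = D.incl.onE f := by rw [hl, hc, ← D.incl.inv, X.inv_inv]
  have hs : D.Y.src (D.Y.inv c) = D.Y.tgt c := rfl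
  rw [← invariant_inv, D.invariant_incl hc', D.invariant_incl ha, hs, h3, ← D.ret_lab_tgt hd, h4]

theorem invariant_sq_attachInr {a b c d : D.Y.E} (h : D.Y.Sq a b c d) {n : ℤ}
    {s : Bool} (ha : label a = attachInr ((n : ZMod D.m), s)) (hb : label b = D.incl.onE (D.e n))
    (hc : label c = attachInr (((n + 1 : ℤ) : ZMod D.m), !s))
    (hd : label d = D.incl.onE (X.inv (D.e n))) : D.invariant c = D.invariant a := by
  obtain ⟨h1, h2, h3, h4⟩ := Sq.tgt_eq h
  rw [D.invariant_attachInr ha, D.invariant_attachInr hc, ← h2, D.ret_lab_tgt_incl hb,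
    ← h1, D.ret_lab_tgt ha, h3, D.path, ← D.height_lab_tgt hd, D.height_lab_tgt hb, h4, ← h1]
  have : D.ret (D.lab (D.Y.src a)) *
      ((D.coord (X.src (D.e n)))⁻¹ * D.coord (X.src (D.e (n + 1)))) *
      (D.coord (X.src (D.e (n + 1))))⁻¹ = D.ret (D.lab (D.Y.src a)) *
      (D.coord (X.src (D.e n)))⁻¹ := by simp [mul_assoc]
  rw [this]
  cases s <;> rfl

theorem attachInl_w (n : ℤ) :
    (attachInl (D.w n) : D.base.E) = D.incl.onE (D.e n) := by
  rw [D.w_cast]; rfl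

theorem attachInl_inv_w (n : ℤ) :
    (attachInl ((quotient ρ hρ).inv (D.w n)) : D.base.E) = D.incl.onE (X.inv (D.e n)) := by
  rw [D.w_cast, ← (quotientMap ρ hρ).inv]; rfl

/-- Killing the stable letter amounts to an equivariant folding of `Y` onto `X` that collapses the
strips. An edge from `X` is sent to the hyperplane of its image, a crossing edge to its height and
to the coset of the axis that its strip is collapsed to. A square of `X` preserves the first kind of
value by parallelism in `X`; a square of a strip preserves both kinds, because crossing edges have
trivial image under `ret` and edges from `X` do not change the height. -/
theorem invariant_sq {a b c d : D.Y.E} (h : D.Y.Sq a b c d) : D.invariant c = D.invariant a := by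
  have hb : D.base.Sq (label a) (label b) (label c) (label d) := h.1
  have hcast : ∀ n : ℤ, ((n : ZMod D.m) + 1) = ((n + 1 : ℤ) : ZMod D.m) :=
    fun n => by push_cast; rfl
  rcases attachAnnulus_sq hb with ⟨a', b', c', d', hs, h1, h2, h3, -⟩ | ⟨i, s, h'⟩
  · obtain ⟨a', b', c', d', hs, rfl, rfl, rfl, rfl⟩ := hs
    change label a = D.incl.onE a' at h1
    change label b = D.incl.onE b' at h2
    change label c = D.incl.onE c' at h3
    obtain ⟨h4, h5, -, -⟩ := Sq.tgt_eq h
    obtain ⟨h6, h7, -, -⟩ := Sq.tgt_eq hs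
    rw [D.invariant_incl h1, D.invariant_incl h3, ← h5, D.ret_lab_tgt_incl h2, ← h4,
      D.ret_lab_tgt_incl h1, (Sq.dual_eq hs).1, h6, h7]
    simp [mul_assoc]
  · obtain ⟨n, rfl⟩ := ZMod.intCast_surjective i
    simp only [hcast, attachInl_w, attachInl_inv_w] at h'
    rcases h' with ⟨h1, h2, h3, h4⟩ | ⟨h1, h2, h3, h4⟩ | ⟨h1, h2, h3, h4⟩ | ⟨h1, h2, h3, h4⟩
    · exact D.invariant_sq_incl h h1 h3 h4
    · exact D.invariant_sq_incl h h1 (by rw [h3, X.inv_inv]) h4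
    · exact D.invariant_sq_attachInr h h1 h2 h3 h4
    · exact (D.invariant_sq_attachInr (D.Y.sq_rot _ _ _ _ (D.Y.sq_rot _ _ _ _ h)) h3 h4
        (by rw [h1, Bool.not_not]) h2).symm

theorem invariant_eq {t t' : D.Y.E} (h : D.Y.dual t = D.Y.dual t') :
    D.invariant t = D.invariant t' :=
  eq_of_dual_eq D.invariant D.invariant_inv (fun _ _ _ _ h => D.invariant_sq h) h

/-- A hyperplane that crosses the hyperplane of an annulus is dual to a translate of an edge of the
axis. -/
theorem exists_invariant_eq_of_sq {a b c d : D.Y.E} (h : D.Y.Sq a b c d) {k : Multiplicative ℤ}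
    {γ : Γ} (hb : D.invariant b = .inr (k, QuotientGroup.mk γ)) :
    ∃ n, D.invariant a = .inl (ρ γ • X.dual (D.e n)) := by
  have hbase : D.base.Sq (label a) (label b) (label c) (label d) := h.1
  have hcast : ∀ n : ℤ, ((n : ZMod D.m) + 1) = ((n + 1 : ℤ) : ZMod D.m) :=
    fun n => by push_cast; rfl
  have hX : ∀ f, label b ≠ D.incl.onE f := fun f hf => by
    rw [D.invariant_incl hf] at hb
    exact Sum.inl_ne_inr hb
  -- Replacing the representative of a coset by another one shifts the axis along itself.
  have key : ∀ (δ : Γ) (n : ℤ), (QuotientGroup.mk δ : Γ ⧸ Subgroup.zpowers D.g) =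
      QuotientGroup.mk γ → ∃ n', ρ δ • X.dual (D.e n) = ρ γ • X.dual (D.e n') := by
    intro δ n hδ
    obtain ⟨j, hj⟩ := QuotientGroup.eq.1 hδ.symm
    refine ⟨n + j * D.m, ?_⟩
    have hj' : δ = γ * D.g ^ j := by rw [show D.g ^ j = γ⁻¹ * δ from hj, mul_inv_cancel_left]
    rw [hj', map_mul, mul_smul, ← D.shift_zpow]
    rfl
  obtain ⟨h1, -, -, -⟩ := Sq.tgt_eq h
  rcases attachAnnulus_sq hbase with ⟨a', b', c', d', hs, -, h2, -⟩ | ⟨i, s, h'⟩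
  · obtain ⟨f, rfl⟩ := quotientMap_onE_surjective hρ b'
    exact absurd h2 (hX f)
  · obtain ⟨n, rfl⟩ := ZMod.intCast_surjective i
    simp only [hcast, attachInl_w, attachInl_inv_w] at h'
    rcases h' with ⟨h2, h3, -⟩ | ⟨h2, h3, -⟩ | ⟨-, h3, -⟩ | ⟨-, h3, -⟩
    · rw [D.invariant_attachInr h3, ← h1, D.ret_lab_tgt_incl h2, D.path] at hb
      have h5 := (Prod.ext_iff.1 (Sum.inr_injective hb)).2
      obtain ⟨n', hn'⟩ := key _ n (by simpa [mul_assoc] using h5)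
      exact ⟨n', by rw [D.invariant_incl h2, hn']⟩
    · have hl : label (D.Y.inv a) = D.base.inv (label a) := rfl
      have h2' : label (D.Y.inv a) = D.incl.onE (D.e n) := by
        rw [hl, h2, ← D.incl.inv, X.inv_inv]
      rw [D.invariant_attachInr h3] at hb
      obtain ⟨n', hn'⟩ := key _ n (Prod.ext_iff.1 (Sum.inr_injective hb)).2
      have hs : D.Y.src (D.Y.inv a) = D.Y.src b := h1
      exact ⟨n', by rw [← D.invariant_inv, D.invariant_incl h2', hs, hn']⟩
    · exact absurd h3 (hX _)
    · exact absurd h3 (hX _)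

end AxialLoop

end SquareComplex

namespace SquareComplex

open Cover

namespace AxialLoop

variable {Γ : Type v} [Group Γ] {X : SquareComplex.{u}} {ρ : Γ →* X.Aut} {hρ : IsFree ρ}
  (D : AxialLoop ρ hρ) (hX : X.IsSimplyConnected)

/-! ### The strip over the axis -/

theorem sq_strip (n : ℕ) : D.Y.Sq (D.liftE hX (D.e n)) (D.tEdge hX (n + 1))
    (D.Y.inv (D.act hX HNNExtension.t • D.liftE hX (D.e n))) (D.Y.inv (D.tEdge hX n)) := by
  have hn : ((n + 1 : ℕ) : ℤ) = (n : ℤ) + 1 := by push_cast; rfl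
  have hact : D.act hX HNNExtension.t = (D.actHom hX HNNExtension.t).1 := rfl
  have hlab : label (D.act hX HNNExtension.t • D.liftE hX (D.e n)) = D.incl.onE (D.e n) := by
    rw [hact, label_actHom_smul, label_liftE]
  have hinv : ∀ t : D.Y.E, label (D.Y.inv t) = D.base.inv (label t) := fun _ => rfl
  refine sq_intro ?_ ?_ ?_ ?_ ?_
  · rw [hinv, hinv, hlab, label_liftE, label_tEdge, label_tEdge, hn]
    exact D.sq_tE n
  · rw [tgt_liftE, src_tEdge, D.path, hn]
  · change _ = D.Y.tgt _
    rw [tgt_tEdge, tgt_smul, tgt_liftE, D.path, hn, hact]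
  · change _ = D.Y.tgt _
    rw [tgt_inv, src_smul, src_liftE, tgt_tEdge, hact]
  · rw [tgt_inv, src_tEdge, src_liftE]

theorem dual_tEdge (n : ℕ) : D.Y.dual (D.tEdge hX n) = D.Y.dual (D.tEdge hX 0) := by
  induction n with
  | zero => rfl
  | succ n ih => rw [(Sq.dual_eq (D.sq_strip hX n)).2, dual_inv, ih]

/-- The edge and its translate by the stable letter are opposite sides of a square of the strip. -/
theorem t_smul_dual_liftE (n : ℕ) : D.act hX HNNExtension.t • D.Y.dual (D.liftE hX (D.e n)) =
    D.Y.dual (D.liftE hX (D.e n)) := by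
  exact ((Sq.dual_eq (D.sq_strip hX n)).1.trans (dual_inv _)).symm

theorem of_smul_dual_liftE (γ : Γ) (f : X.E) :
    D.act hX (HNNExtension.of γ) • D.Y.dual (D.liftE hX f) = D.Y.dual (D.liftE hX (ρ γ • f)) :=
  congrArg D.Y.dual (D.of_smul_liftE hX γ f)

theorem of_g_smul_tEdge (n : ℕ) :
    D.act hX (HNNExtension.of D.g) • D.tEdge hX n = D.tEdge hX (n + D.m) := by
  have hact : D.act hX (HNNExtension.of D.g) = (D.actHom hX (HNNExtension.of D.g)).1 := rfl
  have hn : ((n + D.m : ℕ) : ℤ) = (n : ℤ) + D.m := by push_cast; rfl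
  refine edge_ext ?_ ?_
  · rw [src_smul, src_tEdge, src_tEdge, hact, of_smul_liftV, ← src_smul, D.shift, hn]
  · rw [hact, label_actHom_smul, label_tEdge, label_tEdge, hn, tE_add]

theorem lab_liftV (x : X.V) : D.lab (D.liftV hX x) = HNNExtension.of (D.coord x) := by
  have h := D.volt_prod_incl (D.isPath_pathTo hX x)
  rw [coord_origin, inv_one, one_mul] at h
  exact h

theorem invariant_smul_tEdge (a : D.HNN) : D.invariant (D.act hX a • D.tEdge hX 0) =
    .inr (D.height a, QuotientGroup.mk (D.ret a)) := by
  have hact : D.act hX a = (D.actHom hX a).1 := rfl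
  have h : label (D.act hX a • D.tEdge hX 0) = attachInr (((0 : ℤ) : ZMod D.m), true) := by
    rw [hact, label_actHom_smul, label_tEdge]; rfl
  have h0 : X.src (D.e ((0 : ℕ) : ℤ)) = D.origin := rfl
  have h0' : X.src (D.e (0 : ℤ)) = D.origin := rfl
  rw [D.invariant_attachInr h, src_smul, src_tEdge, hact, lab_smul, lab_liftV, h0, h0',
    coord_origin]
  simp

/-! ### A sequence of hyperplanes that escapes to infinity -/

/-- The product of `g`, the stable letter, and `c`. -/
def elt (c : Γ) : D.HNN := HNNExtension.of D.g * HNNExtension.t * HNNExtension.of c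

theorem ret_elt (c : Γ) : D.ret (D.elt c) = D.g * c := by
  simp [elt, ret_of, ret_t]

theorem height_elt_pow (c : Γ) (n : ℕ) : D.height (D.elt c ^ n) = .ofAdd (n : ℤ) := by
  rw [map_pow, show D.height (D.elt c) = .ofAdd 1 by simp [elt, height_of, height_t], ← ofAdd_nsmul]
  simp

/-- The translates of the hyperplane of the annulus. -/
noncomputable def wall (c : Γ) (n : ℕ) : D.Y.Hyperplane :=
  D.act hX (D.elt c ^ n) • D.Y.dual (D.tEdge hX 0)

theorem dual_smul_tEdge (c : Γ) (n : ℕ) :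
    D.Y.dual (D.act hX (D.elt c ^ n) • D.tEdge hX 0) = D.wall hX c n := rfl

theorem invariant_of_dual_eq_wall {c : Γ} {n : ℕ} {t : D.Y.E} (h : D.Y.dual t = D.wall hX c n) :
    D.invariant t = .inr (.ofAdd (n : ℤ), QuotientGroup.mk ((D.g * c) ^ n)) := by
  rw [D.invariant_eq (h.trans (D.dual_smul_tEdge hX c n).symm), invariant_smul_tEdge,
    height_elt_pow, map_pow, ret_elt]

theorem wall_injective (c : Γ) : Function.Injective (D.wall hX c) := by
  intro a b h
  have h1 := (D.invariant_of_dual_eq_wall hX (D.dual_smul_tEdge hX c a)).symm.trans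
    (D.invariant_of_dual_eq_wall hX ((D.dual_smul_tEdge hX c a).trans h))
  have h2 := (Prod.ext_iff.1 (Sum.inr_injective h1)).1
  exact_mod_cast Multiplicative.ofAdd.injective h2

theorem not_crosses_wall_wall (c : Γ) (a b : ℕ) :
    ¬ D.Y.Crosses (D.wall hX c a) (D.wall hX c b) := by
  rintro ⟨t, t', _, _, h, h1, h2⟩
  obtain ⟨n, hn⟩ := D.exists_invariant_eq_of_sq h (D.invariant_of_dual_eq_wall hX h2)
  rw [D.invariant_of_dual_eq_wall hX h1] at hn
  exact Sum.inr_ne_inl hn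

variable {hX} in
open Classical in
-- A translated copy of `X` is connected, and its edges have invariants of the first kind while
-- walls have invariants of the second. So a copy lies entirely on one side of each wall.
theorem side_smul_liftV {c : Γ} {n : ℕ} {σ : D.Y.V → ZMod 2}
    (hσ : ∀ e, σ (D.Y.tgt e) = σ (D.Y.src e) + if D.Y.dual e = D.wall hX c n then 1 else 0)
    (a : D.HNN) (x y : X.V) :
    σ (D.act hX a • D.liftV hX x) = σ (D.act hX a • D.liftV hX y) := by
  obtain ⟨l, hl⟩ := hX.2.1 x y
  induction l generalizing x with
  | nil => rw [hl]
  | cons f l ih =>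
    obtain ⟨rfl, hl⟩ := hl
    have hact : D.act hX a = (D.actHom hX a).1 := rfl
    have hne : D.Y.dual (D.act hX a • D.liftE hX f) ≠ D.wall hX c n := fun h => by
      have h1 := D.invariant_of_dual_eq_wall hX h
      rw [D.invariant_incl (f := f) (by rw [hact, label_actHom_smul, label_liftE])] at h1
      exact Sum.inl_ne_inr h1
    have h1 := hσ (D.act hX a • D.liftE hX f)
    rw [if_neg hne, add_zero, tgt_smul, src_smul, tgt_liftE, src_liftE] at h1
    rw [← h1]
    exact ih _ hl

variable {hX} in
open Classical in
-- From the `i`-th translate of the origin to the next, move inside a copy of `X`, cross one strip,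
-- and move inside another copy. Only the crossing edge can change the side; since `g` preserves the
-- hyperplane of the strip, that edge is dual to the `i`-th wall. Thus wall `n` lies between the
-- translates `n` and `n + 1`.
theorem side_elt_pow {c : Γ} {n : ℕ} {σ : D.Y.V → ZMod 2}
    (hσ : ∀ e, σ (D.Y.tgt e) = σ (D.Y.src e) + if D.Y.dual e = D.wall hX c n then 1 else 0)
    (i : ℕ) : σ (D.act hX (D.elt c ^ i) • D.liftV hX D.origin) =
      σ (D.liftV hX D.origin) + if n < i then 1 else 0 := by
  induction i with
  | zero => simp
  | succ i ih =>
    have h0 : X.src (D.e ((0 : ℕ) : ℤ)) = D.origin := rfl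
    have hg : D.act hX (HNNExtension.of D.g) • D.Y.dual (D.tEdge hX 0) =
        D.Y.dual (D.tEdge hX 0) := by
      rw [smul_dual, of_g_smul_tEdge, dual_tEdge]
    have h1 := hσ (D.act hX (D.elt c ^ i * HNNExtension.of D.g) • D.tEdge hX 0)
    have h2 : D.Y.dual (D.act hX (D.elt c ^ i * HNNExtension.of D.g) • D.tEdge hX 0) =
        D.wall hX c i := by
      rw [map_mul, mul_smul, ← smul_dual, ← smul_dual, hg]; rfl
    have h3 : D.act hX (D.elt c ^ i * HNNExtension.of D.g) • D.liftV hX D.origin =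
        D.act hX (D.elt c ^ i) • D.liftV hX (ρ D.g • D.origin) := by
      rw [map_mul, mul_smul]
      exact congrArg _ (D.of_smul_liftV hX _ _)
    have h4 : D.act hX (D.elt c ^ (i + 1)) • D.liftV hX D.origin =
        D.act hX (D.elt c ^ i * HNNExtension.of D.g * HNNExtension.t) •
          D.liftV hX (ρ c • D.origin) := by
      rw [pow_succ, elt, ← mul_assoc, ← mul_assoc, map_mul _ _ (HNNExtension.of c), mul_smul]
      exact congrArg _ (D.of_smul_liftV hX _ _)
    have h5 : D.Y.tgt (D.tEdge hX 0) = D.act hX HNNExtension.t • D.liftV hX D.origin :=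
      D.tgt_tEdge hX 0
    rw [tgt_smul, h5, ← mul_smul, ← map_mul, src_smul, src_tEdge, h0, h2, h3] at h1
    rw [h4, D.side_smul_liftV hσ _ _ D.origin, h1, D.side_smul_liftV hσ _ _ D.origin, ih, add_assoc]
    congr 1
    have h6 : D.wall hX c i = D.wall hX c n ↔ i = n := (D.wall_injective hX c).eq_iff
    simp only [h6]
    rcases lt_trichotomy n i with h | rfl | h
    · rw [if_pos h, if_neg h.ne', if_pos (by omega), add_zero]
    · simp
    · rw [if_neg (by omega), if_neg h.ne, if_neg (by omega), add_zero]

/-- The walls do not cross each other, so the carriers of the walls `a` and `b` lie on different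
sides of the wall `n` between them. A hyperplane whose carrier meets both of these carriers cannot
stay on one side of it. -/
theorem crosses_wall_of_crosses {c : Γ} {a n b : ℕ} (han : a ≤ n) (hnb : n ≤ b)
    {H : D.Y.Hyperplane} (ha : D.Y.Crosses H (D.wall hX c a))
    (hb : D.Y.Crosses H (D.wall hX c b)) : D.Y.Crosses H (D.wall hX c n) := by
  rcases han.eq_or_lt with rfl | han
  · exact ha
  rcases hnb.eq_or_lt with rfl | hnb
  · exact hb
  by_contra hn
  obtain ⟨σ, hσ⟩ := (isSimplyConnected D.base D.basePoint).exists_side (D.wall hX c n)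
  -- The square where `H` crosses wall `k` has an edge dual to `H` with an end point in the carrier
  -- of wall `k`, and that carrier lies on the side of the `k`-th translate of the origin.
  have key : ∀ k, k ≠ n → D.Y.Crosses H (D.wall hX c k) → ∃ t, D.Y.dual t = H ∧
      σ (D.Y.src t) = σ (D.act hX (D.elt c ^ k) • D.liftV hX D.origin) := by
    rintro k hk ⟨t, t', _, _, h, h1, h2⟩
    have h3 := side_eq_of_not_crosses hσ (fun h => hk (D.wall_injective hX c h))
      (D.not_crosses_wall_wall hX c k n) h2 (D.dual_smul_tEdge hX c k)
    rw [src_smul, src_tEdge] at h3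
    exact ⟨D.Y.inv t, by rw [dual_inv, h1], (congrArg σ (Sq.tgt_eq h).1).trans h3⟩
  have hne : H ≠ D.wall hX c n := by
    rintro rfl
    exact D.not_crosses_wall_wall hX _ _ _ ha
  obtain ⟨t, h1, h2⟩ := key a han.ne ha
  obtain ⟨t', h1', h2'⟩ := key b hnb.ne' hb
  have h3 := side_eq_of_not_crosses hσ hne hn h1 h1'
  rw [h2, h2', D.side_elt_pow hσ, D.side_elt_pow hσ, if_neg (by omega), if_pos hnb] at h3
  simp at h3

/-- The invariant of `H` is a single hyperplane of `X`. Crossing wall `n` forces it to be dual to an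
edge of the translate of the axis by `(g * c) ^ n`; comparing two consecutive values of `n` and
cancelling the common power gives the relation. -/
theorem exists_shift_of_crosses {c : Γ} {a M : ℕ} {H : D.Y.Hyperplane}
    (h : ∀ n, a ≤ n → n ≤ a + M → D.Y.Crosses H (D.wall hX c n)) :
    ∃ x : ℕ → ℤ, ∀ q < M, ρ (D.g * c) • X.dual (D.e (x (q + 1))) = X.dual (D.e (x q)) := by
  obtain ⟨t₀, ht₀⟩ : ∃ t, D.Y.dual t = H := by
    obtain ⟨t, -, -, -, -, h1, -⟩ := h a le_rfl (by omega)
    exact ⟨t, h1⟩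
  have key : ∀ q, ∃ x, q ≤ M →
      D.invariant t₀ = .inl (ρ ((D.g * c) ^ (a + q)) • X.dual (D.e x)) := by
    intro q
    by_cases hq : q ≤ M
    · obtain ⟨t, t', _, _, hs, h1, h2⟩ := h (a + q) (by omega) (by omega)
      obtain ⟨n, hn⟩ := D.exists_invariant_eq_of_sq hs (D.invariant_of_dual_eq_wall hX h2)
      exact ⟨n, fun _ => by rw [D.invariant_eq (ht₀.trans h1.symm), hn]⟩
    · exact ⟨0, fun h => absurd h hq⟩
  choose x hx using key
  refine ⟨x, fun q hq => ?_⟩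
  have h1 := Sum.inl_injective ((hx q hq.le).symm.trans (hx (q + 1) hq))
  rw [← add_assoc, pow_succ, map_mul _ _ (D.g * c), mul_smul] at h1
  exact (MulAction.injective _ h1).symm

/-- The `J` walls with indices `M`, `2 M`, …, `J M` all separate the two end walls, so a shortest
walk meets each of their stars. By `hM` these meetings take place at distinct vertices of the walk.
The summand 1 accounts for a walk having one more vertex than edges. -/
theorem le_dist_wall {c : Γ} {M : ℕ} (hM : ¬ ∃ x : ℕ → ℤ, ∀ q < M,
    ρ (D.g * c) • X.dual (D.e (x (q + 1))) = X.dual (D.e (x q))) (J : ℕ) :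
    J ≤ D.Y.contactGraph.dist (D.wall hX c 0) (D.wall hX c ((J + 1) * M)) + 1 := by
  classical
  have hY := isSimplyConnected D.base D.basePoint
  have hM0 : 0 < M := by
    rcases Nat.eq_zero_or_pos M with rfl | h
    · exact absurd ⟨fun _ => 0, fun q hq => absurd hq (Nat.not_lt_zero q)⟩ hM
    · exact h
  obtain ⟨w, hw⟩ : ∃ w : D.Y.contactGraph.Walk (D.wall hX c 0) (D.wall hX c ((J + 1) * M)),
      w.length = D.Y.contactGraph.dist _ _ :=
    (contactGraph_reachable hY (D.act hX (D.elt c ^ 0) • D.tEdge hX 0)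
    (D.act hX (D.elt c ^ ((J + 1) * M)) • D.tEdge hX 0)).exists_walk_length_eq_dist
  have key : ∀ q : ℕ, ∃ L, q < J → L ∈ w.support ∧
      (L = D.wall hX c ((q + 1) * M) ∨ D.Y.Crosses L (D.wall hX c ((q + 1) * M))) := by
    intro q
    by_cases hq : q < J
    · obtain ⟨σ, hσ⟩ := hY.exists_side (D.wall hX c ((q + 1) * M))
      obtain ⟨L, h1, h2⟩ := exists_mem_support_crosses hσ w rfl rfl (by
        rw [src_smul, src_smul, src_tEdge]
        intro h
        have h0 : X.src (D.e ((0 : ℕ) : ℤ)) = D.origin := rfl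
        rw [h0, D.side_elt_pow hσ, D.side_elt_pow hσ, if_neg (by omega),
          if_pos (Nat.mul_lt_mul_of_pos_right (by omega) hM0)] at h
        simp at h)
      exact ⟨L, fun _ => ⟨h1, h2⟩⟩
    · exact ⟨D.wall hX c 0, fun h => absurd h hq⟩
  choose L hL using key
  -- A common vertex would be a wall that equals or crosses another wall, or else a hyperplane that
  -- crosses all walls from index `(a + 1) * M` to `(b + 1) * M`, at least `M + 1` in succession.
  have hne : ∀ a b, a < b → b < J → L a ≠ L b := by
    intro a b hab hb h
    have hlt : (a + 1) * M < (b + 1) * M := Nat.mul_lt_mul_of_pos_right (by omega) hM0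
    have h1 := (hL a (hab.trans hb)).2
    have h2 := (hL b hb).2
    rw [← h] at h2
    rcases h1 with h1 | h1 <;> rcases h2 with h2 | h2
    · exact hlt.ne (D.wall_injective hX c (h1.symm.trans h2))
    · rw [h1] at h2; exact D.not_crosses_wall_wall hX _ _ _ h2
    · rw [h2] at h1; exact D.not_crosses_wall_wall hX _ _ _ h1
    · refine hM (D.exists_shift_of_crosses hX (a := (a + 1) * M) fun n hn hn' =>
        D.crosses_wall_of_crosses hX hn (hn'.trans ?_) h1 h2)
      nlinarith
  have hcard : (Finset.range J).card ≤ w.support.toFinset.card := by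
    refine Finset.card_le_card_of_injOn L (fun q hq => ?_) ?_
    · exact List.mem_toFinset.2 (hL q (Finset.mem_range.1 hq)).1
    · intro a ha b hb h
      rcases lt_trichotomy a b with h1 | h1 | h1
      · exact absurd h (hne a b h1 (Finset.mem_range.1 hb))
      · exact h1
      · exact absurd h.symm (hne b a h1 (Finset.mem_range.1 ha))
  have h2 := hcard.trans (List.toFinset_card_le w.support)
  rw [Finset.card_range, SimpleGraph.Walk.length_support, hw] at h2
  exact h2

/-- The three factors act in turn on the hyperplane of an edge of the axis: `c` fixes it within the
range `r`, the stable letter fixes it because it runs across the strip, and `g` shifts the edge by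
`m`. -/
theorem elt_pow_smul_dual_liftE {c : Γ} {r : ℕ}
    (hc : ∀ n : ℕ, n ≤ r → ρ c • X.dual (D.e n) = X.dual (D.e n))
    (i : ℕ) (hi : i * D.m ≤ r) : D.act hX (D.elt c ^ i) • D.Y.dual (D.liftE hX (D.e 0)) =
      D.Y.dual (D.liftE hX (D.e (i * D.m : ℕ))) := by
  induction i with
  | zero => simp
  | succ i ih =>
    have hle : i * D.m ≤ r := le_trans (Nat.mul_le_mul_right _ (by omega)) hi
    have hc' : D.Y.dual (D.liftE hX (ρ c • D.e (i * D.m : ℕ))) =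
        D.Y.dual (D.liftE hX (D.e (i * D.m : ℕ))) := (D.lift hX).dual_eq (hc _ hle)
    rw [pow_succ', map_mul, mul_smul, ih hle, elt, map_mul, map_mul, mul_smul, mul_smul,
      of_smul_dual_liftE, hc', t_smul_dual_liftE, of_smul_dual_liftE, D.shift]
    congr 3
    push_cast
    ring

/-- Both walls are in contact with one common hyperplane. The first is seen at the edge with index
`i * m` of the axis and the second at the edge with index 0 of a further translate, and these two
edges are dual to the same hyperplane. -/
theorem dist_wall_le {c : Γ} {r : ℕ} (hc : ∀ n : ℕ, n ≤ r → ρ c • X.dual (D.e n) = X.dual (D.e n))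
    (j i : ℕ) (hi : i * D.m ≤ r) :
    D.Y.contactGraph.dist (D.wall hX c j) (D.act hX (D.elt c ^ i) • D.wall hX c j) ≤ 2 := by
  have h1 : D.act hX (D.elt c ^ i) • D.wall hX c j =
      D.Y.dual (D.act hX (D.elt c ^ j) • D.act hX (D.elt c ^ i) • D.tEdge hX 0) := by
    rw [wall, smul_smul, ← map_mul, ← pow_add, add_comm, pow_add, map_mul, mul_smul]
    rfl
  have h2 : D.wall hX c j = D.Y.dual (D.act hX (D.elt c ^ j) • D.tEdge hX (i * D.m)) := by
    rw [← smul_dual, dual_tEdge]; rfl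
  rw [h1, h2]
  refine contactGraph_dist_le_two (f := D.act hX (D.elt c ^ j) • D.liftE hX (D.e (i * D.m : ℕ)))
    (f' := D.act hX (D.elt c ^ j) • D.act hX (D.elt c ^ i) • D.liftE hX (D.e 0)) ?_ ?_ ?_
  · rw [src_smul, src_smul, src_tEdge, src_liftE]
  · rw [← smul_dual, ← smul_dual, ← smul_dual, D.elt_pow_smul_dual_liftE hX hc i hi]
  · rw [src_smul, src_smul, src_smul, src_smul, src_tEdge, src_liftE]
    rfl

theorem not_isAcylindricalOnContactGraph (h : ∀ r : ℕ, ∃ (c : Γ) (M : ℕ),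
    (∀ n : ℕ, n ≤ r → ρ c • X.dual (D.e n) = X.dual (D.e n)) ∧ ¬ ∃ x : ℕ → ℤ, ∀ q < M,
      ρ (D.g * c) • X.dual (D.e (x (q + 1))) = X.dual (D.e (x q))) :
    ¬ IsAcylindricalOnContactGraph (D.act hX) := by
  intro hac
  -- The value 3 admits displacements up to 2. With the range `N * m`, all powers of `elt` with
  -- exponents 0, …, `N` displace the walls by at most 2, which is one element too many; they are
  -- distinct by height.
  obtain ⟨R, -, N, -, hN⟩ := hac 3 (by norm_num)
  obtain ⟨c, M, hc, hM⟩ := h (N * D.m)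
  have h1 := D.le_dist_wall hX hM (⌈R⌉₊ + 1)
  have h2 := hN (D.wall hX c 0) (D.wall hX c ((⌈R⌉₊ + 1 + 1) * M)) (by
    exact (Nat.le_ceil R).trans (Nat.cast_le.2 (Nat.le_of_succ_le_succ h1)))
  have hinj : Function.Injective (fun i : ℕ => D.elt c ^ i) := by
    intro a b hab
    have h3 := congrArg D.height hab
    simp only [height_elt_pow] at h3
    exact_mod_cast Multiplicative.ofAdd.injective h3
  have h3 : (((Finset.range (N + 1)).map ⟨_, hinj⟩ : Finset D.HNN) : Set D.HNN).encard ≤ N := by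
    refine le_trans (Set.encard_le_encard ?_) h2
    intro a ha
    simp only [Finset.coe_map, Function.Embedding.coeFn_mk, Set.mem_image, Finset.coe_range,
      Set.mem_Iio] at ha
    obtain ⟨i, hi, rfl⟩ := ha
    have hle : i * D.m ≤ N * D.m := Nat.mul_le_mul_right _ (by omega)
    have h4 : ∀ j, ((D.Y.contactGraph.dist (D.wall hX c j)
        (D.act hX (D.elt c ^ i) • D.wall hX c j) : ℕ) : ℝ) < 3 := fun j => by
      have := D.dist_wall_le hX hc j i hle
      exact_mod_cast Nat.lt_succ_of_le this
    exact ⟨h4 _, h4 _⟩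
  rw [Set.encard_coe_eq_coe_finsetCard, Finset.card_map, Finset.card_range] at h3
  have h5 : N + 1 ≤ N := by exact_mod_cast h3
  omega

end AxialLoop

end SquareComplex

/-! ### Lines in trees -/

namespace SimpleGraph

variable {V : Type*} {T : SimpleGraph V}

/-- The walk along a ray. -/
def rayWalk {a : ℕ → V} (h : ∀ n, T.Adj (a n) (a (n + 1))) : ∀ n, T.Walk (a 0) (a n)
  | 0 => .nil
  | n + 1 => (rayWalk h n).concat (h n)

theorem support_rayWalk {a : ℕ → V} (h : ∀ n, T.Adj (a n) (a (n + 1))) (n : ℕ) :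
    (rayWalk h n).support = (List.range (n + 1)).map a := by
  induction n with
  | zero => rfl
  | succ n ih =>
    rw [rayWalk, Walk.support_concat, ih, List.range_succ (n := n + 1), List.map_append]
    rfl

theorem isPath_rayWalk {a : ℕ → V} (h : ∀ n, T.Adj (a n) (a (n + 1)))
    (ha : Function.Injective a) (n : ℕ) : (rayWalk h n).IsPath := by
  rw [Walk.isPath_def, support_rayWalk]
  exact List.nodup_range.map ha

/-- The initial segments of the rays are two paths in a forest with the same ends, so they have the
same sequence of vertices. -/
theorem IsAcyclic.eq_of_rays (hT : T.IsAcyclic) {a b : ℕ → V} (ha : Function.Injective a)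
    (hb : Function.Injective b) (ha' : ∀ n, T.Adj (a n) (a (n + 1)))
    (hb' : ∀ n, T.Adj (b n) (b (n + 1))) (h0 : a 0 = b 0) {p q : ℕ} (h : a p = b q) :
    p = q ∧ ∀ j ≤ p, a j = b j := by
  have := hT.subsingleton_path (a 0) (a p)
  have h1 := congrArg (fun w => Walk.support w.1) (Subsingleton.elim (α := T.Path (a 0) (a p))
    ⟨_, isPath_rayWalk ha' ha p⟩
    ⟨(rayWalk hb' q).copy h0.symm h.symm, (by simpa using isPath_rayWalk hb' hb q)⟩)
  simp only [Walk.support_copy, support_rayWalk] at h1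
  have h2 : p = q := by simpa using congrArg List.length h1
  subst h2
  exact ⟨rfl, fun j hj => List.map_inj_left.1 h1 j (List.mem_range.2 (by omega))⟩

/-- Two lines in a tree that agree near `0` and meet again agree up to that point. -/
theorem IsAcyclic.eq_of_lines (hT : T.IsAcyclic) {a b : ℤ → V} (ha : Function.Injective a)
    (hb : Function.Injective b) (ha' : ∀ n, T.Adj (a n) (a (n + 1)))
    (hb' : ∀ n, T.Adj (b n) (b (n + 1))) (h0 : a 0 = b 0) (h1 : a 1 = b 1)
    (h2 : a (-1) = b (-1)) {i j : ℤ} (h : a i = b j) :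
    i = j ∧ ∀ k, (0 ≤ k ∧ k ≤ j) ∨ (j ≤ k ∧ k ≤ 0) → a k = b k := by
  have hpos : ∀ {c : ℤ → V}, Function.Injective c → Function.Injective (fun n : ℕ => c n) :=
    fun hc _ _ h => by exact_mod_cast hc h
  have hneg : ∀ {c : ℤ → V}, Function.Injective c → Function.Injective (fun n : ℕ => c (-n)) :=
    fun hc _ _ h => by exact_mod_cast neg_injective (hc h)
  have hpos' : ∀ {c : ℤ → V}, (∀ n, T.Adj (c n) (c (n + 1))) →
      ∀ n : ℕ, T.Adj (c n) (c (n + 1 : ℕ)) := fun hc n => by exact_mod_cast hc n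
  have hneg' : ∀ {c : ℤ → V}, (∀ n, T.Adj (c n) (c (n + 1))) →
      ∀ n : ℕ, T.Adj (c (-n)) (c (-(n + 1 : ℕ))) := fun hc n => by
    have := (hc (-(n + 1 : ℕ))).symm
    rwa [show -((n + 1 : ℕ) : ℤ) + 1 = -(n : ℤ) by push_cast; ring] at this
  rcases le_total 0 i with hi | hi <;> rcases le_total 0 j with hj | hj
  · lift i to ℕ using hi
    lift j to ℕ using hj
    obtain ⟨h3, h4⟩ := hT.eq_of_rays (hpos ha) (hpos hb) (hpos' ha') (hpos' hb') h0 h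
    refine ⟨by rw [h3], fun k hk => ?_⟩
    obtain ⟨k, rfl⟩ := Int.eq_ofNat_of_zero_le (show 0 ≤ k by omega)
    exact h4 k (by omega)
  · lift i to ℕ using hi
    obtain ⟨j, rfl⟩ := Int.exists_eq_neg_ofNat hj
    obtain ⟨h3, h4⟩ := hT.eq_of_rays (hpos ha) (hneg hb) (hpos' ha') (hneg' hb')
      (by simpa using h0) h
    subst h3
    rcases Nat.eq_zero_or_pos i with rfl | hi
    · exact ⟨by simp, fun k hk => by obtain rfl : k = 0 := by (simp at hk; omega)
                                     exact h0⟩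
    -- Meeting in opposite directions would identify the first step of one line forwards with the
    -- first step of the other backwards, hence `a 1` with `a (-1)`.
    · have h5 := h4 1 hi
      simp only [Nat.cast_one, ← h2] at h5
      exact absurd (ha h5) (by norm_num)
  · lift j to ℕ using hj
    obtain ⟨i, rfl⟩ := Int.exists_eq_neg_ofNat hi
    obtain ⟨h3, h4⟩ := hT.eq_of_rays (hneg ha) (hpos hb) (hneg' ha') (hpos' hb')
      (by simpa using h0) h
    subst h3
    rcases Nat.eq_zero_or_pos i with rfl | hi
    · exact ⟨by simp, fun k hk => by obtain rfl : k = 0 := by (simp at hk; omega)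
                                     exact h0⟩
    · have h5 := h4 1 hi
      simp only [Nat.cast_one, ← h1] at h5
      exact absurd (ha h5) (by norm_num)
  · obtain ⟨i, rfl⟩ := Int.exists_eq_neg_ofNat hi
    obtain ⟨j, rfl⟩ := Int.exists_eq_neg_ofNat hj
    obtain ⟨h3, h4⟩ := hT.eq_of_rays (hneg ha) (hneg hb) (hneg' ha') (hneg' hb')
      (by simpa using h0) h
    refine ⟨by rw [h3], fun k hk => ?_⟩
    obtain ⟨k, rfl⟩ := Int.exists_eq_neg_ofNat (show k ≤ 0 by omega)
    exact h4 k (by omega)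

/-- An injective endomorphism of a locally finite connected graph that fixes a vertex has finite
orbits. -/
theorem Preconnected.exists_iterate_eq (hT : T.Preconnected) (hfin : ∀ x, (T.neighborSet x).Finite)
    {f : V → V} (hf : Function.Injective f) (hadj : ∀ x y, T.Adj x y → T.Adj (f x) (f y)) {p : V}
    (hp : f p = p) (v : V) : ∃ s > 0, f^[s] v = v := by
  obtain ⟨w⟩ := hT p v
  have hiter : ∀ s x y, T.Adj x y → T.Adj (f^[s] x) (f^[s] y) := by
    intro s
    induction s with
    | zero => exact fun _ _ h => h
    | succ s ih =>
      intro x y h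
      rw [Function.iterate_succ_apply', Function.iterate_succ_apply']
      exact hadj _ _ (ih _ _ h)
  have key : ∀ {x y : V}, T.Walk x y → (∃ s > 0, f^[s] x = x) → ∃ s > 0, f^[s] y = y := by
    intro x y w
    induction w with
    | nil => exact id
    | @cons x y z h w ih =>
      rintro ⟨s, hs, hx⟩
      refine ih ?_
      -- Once an iterate fixes `x`, it maps the finite set of neighbours of `x` injectively to
      -- itself, so the next vertex of the walk is periodic for it.
      have hmaps : Set.MapsTo f^[s] (T.neighborSet x) (T.neighborSet x) := fun a ha => by
        have := hiter s _ _ ha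
        rwa [hx] at this
      have := (hfin x).to_subtype
      obtain ⟨k, hk, hk'⟩ := Function.Injective.mem_periodicPts
        (f := hmaps.restrict) ((hmaps.restrict_inj).2 (hf.iterate s).injOn)
        ⟨y, h⟩
      refine ⟨s * k, Nat.mul_pos hs hk, ?_⟩
      have h1 := congrArg Subtype.val hk'
      rw [Set.MapsTo.iterate_restrict] at h1
      rw [Function.iterate_mul]
      exact h1
  exact key w ⟨1, one_pos, hp⟩

/-- The product of the periods of the points is a common period of a finite set. -/
theorem Preconnected.exists_iterate_eq_on (hT : T.Preconnected)
    (hfin : ∀ x, (T.neighborSet x).Finite)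
    {f : V → V} (hf : Function.Injective f) (hadj : ∀ x y, T.Adj x y → T.Adj (f x) (f y)) {p : V}
    (hp : f p = p) {S : Set V} (hS : S.Finite) : ∃ s > 0, ∀ v ∈ S, f^[s] v = v := by
  induction S, hS using Set.Finite.induction_on with
  | empty => exact ⟨1, one_pos, fun _ h => absurd h (Set.notMem_empty _)⟩
  | @insert a S _ _ ih =>
    obtain ⟨s, hs, h⟩ := ih
    obtain ⟨k, hk, h'⟩ := hT.exists_iterate_eq hfin hf hadj hp a
    refine ⟨s * k, Nat.mul_pos hs hk, ?_⟩
    rintro v (rfl | hv)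
    · exact Function.IsPeriodicPt.const_mul h' s
    · exact Function.IsPeriodicPt.mul_const (h v hv) k

end SimpleGraph

namespace SquareComplex

/-! ### Non-positive curvature from a geodesic axis -/

namespace AxialLoop

variable {Γ : Type v} [Group Γ] {X : SquareComplex.{u}} {ρ : Γ →* X.Aut} {hρ : IsFree ρ}
  (D : AxialLoop ρ hρ)

/-- The quotient map is injective on stars and link adjacency lifts, so the loop is a local geodesic
as soon as the axis is. -/
theorem base_isNonPositivelyCurved (hX : X.IsNonPositivelyCurved)
    (h₁ : ∀ n, X.inv (D.e n) ≠ D.e (n + 1)) (h₂ : ∀ n, ¬ X.LinkAdj (X.inv (D.e n)) (D.e (n + 1))) :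
    D.base.IsNonPositivelyCurved := by
  have hcast : ∀ n : ℤ, ((n : ZMod D.m) + 1) = ((n + 1 : ℤ) : ZMod D.m) :=
    fun n => by push_cast; rfl
  refine attachAnnulus_isNonPositivelyCurved (quotient_isNonPositivelyCurved hρ hX)
    (fun i h => ?_) (fun i h => ?_)
  · obtain ⟨n, rfl⟩ := ZMod.intCast_surjective i
    rw [hcast, D.w_cast, D.w_cast, ← (quotientMap ρ hρ).inv] at h
    exact h₁ n (quotientMap_onE_inj hρ h (D.path n))
  · obtain ⟨n, rfl⟩ := ZMod.intCast_surjective i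
    rw [hcast, D.w_cast, D.w_cast, ← (quotientMap ρ hρ).inv] at h
    obtain ⟨f, h3, h4, h5⟩ := quotient_linkAdj_lift hρ h
    rw [← quotientMap_onE_inj hρ h5 ((D.path n).symm.trans h3.symm)] at h4
    exact h₂ n h4

end AxialLoop

end SquareComplex

/-! ### Anti-tori -/

namespace IsAntiTorus

open SquareComplex

variable {Γ : Type v} [Group Γ] {V₁ V₂ : Type u} {T₁ : SimpleGraph V₁} {T₂ : SimpleGraph V₂}
  {ρ : Γ →* (SquareComplex.prod T₁ T₂).Aut} {g₁ g₂ : Γ} {ℓ₁ : ℤ → V₁} {ℓ₂ : ℤ → V₂} {m₁ m₂ : ℕ}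

/-- The edges of the horizontal axis. -/
def axisEdge (h : IsAntiTorus ρ g₁ g₂ ℓ₁ ℓ₂ m₁ m₂)
    (n : ℤ) : (SquareComplex.prod T₁ T₂).E := hE ⟨(ℓ₁ n, ℓ₁ (n + 1)), h.adj₁ n⟩ (ℓ₂ 0)

theorem smul_axisEdge (h : IsAntiTorus ρ g₁ g₂ ℓ₁ ℓ₂ m₁ m₂)
    (n : ℤ) : ρ g₁ • h.axisEdge n = h.axisEdge (n + m₁) := by
  apply prod_edge_ext
  · rw [src_smul]
    exact h.translate₁ n
  · rw [tgt_smul]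
    refine (h.translate₁ (n + 1)).trans ?_
    rw [add_right_comm]
    rfl

/-- The horizontal axis of an anti-torus, and its image in the quotient. -/
def axial (h : IsAntiTorus ρ g₁ g₂ ℓ₁ ℓ₂ m₁ m₂)
    (hρ : IsFree ρ) : AxialLoop ρ hρ where
  g := g₁
  m := m₁
  pos := h.pos₁
  e := h.axisEdge
  path _ := rfl
  shift := h.smul_axisEdge
  w := h.loop hρ
  w_cast n := by
    refine (quotientMap_onE_eq hρ).2 ⟨g₁ ^ (n / m₁), ?_⟩
    have h1 := zpow_smul_of_shift h.smul_axisEdge (n / m₁) (n % m₁)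
    rw [Int.emod_add_ediv_mul] at h1
    have : NeZero m₁ := ⟨h.pos₁.ne'⟩
    rw [← ZMod.val_intCast] at h1
    rw [map_zpow]
    exact h1

theorem base_isNonPositivelyCurved (h : IsAntiTorus ρ g₁ g₂ ℓ₁ ℓ₂ m₁ m₂)
    (hρ : IsFree ρ) :
    (h.axial hρ).base.IsNonPositivelyCurved := by
  refine (h.axial hρ).base_isNonPositivelyCurved prod_isNonPositivelyCurved (fun n hn => ?_)
    fun n hn => ?_
  · have h1 : ℓ₁ n = ℓ₁ (n + 1 + 1) := congrArg (fun d => d.snd) (hE_inj.1 hn).1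
    have := h.inj₁ h1
    omega
  · rcases prod_linkAdj hn with ⟨_, _, _, _, -, h1⟩ | ⟨_, _, _, _, h1, -⟩
    · exact hE_ne_vE.1 h1
    · exact hE_ne_vE.1 h1

theorem zpow_translate₁ (h : IsAntiTorus ρ g₁ g₂ ℓ₁ ℓ₂ m₁ m₂)
    (k n : ℤ) : ρ (g₁ ^ k) • prodVertex T₁ T₂ (ℓ₁ n) (ℓ₂ 0) =
    prodVertex T₁ T₂ (ℓ₁ (n + k * m₁)) (ℓ₂ 0) := by
  rw [map_zpow]
  exact zpow_smul_of_shift (e := fun n => prodVertex T₁ T₂ (ℓ₁ n) (ℓ₂ 0)) h.translate₁ k n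

theorem zpow_translate₂ (h : IsAntiTorus ρ g₁ g₂ ℓ₁ ℓ₂ m₁ m₂)
    (k n : ℤ) : ρ (g₂ ^ k) • prodVertex T₁ T₂ (ℓ₁ 0) (ℓ₂ n) =
    prodVertex T₁ T₂ (ℓ₁ 0) (ℓ₂ (n + k * m₂)) := by
  rw [map_zpow]
  exact zpow_smul_of_shift (e := fun n => prodVertex T₁ T₂ (ℓ₁ 0) (ℓ₂ n)) h.translate₂ k n

theorem exists_splits₁ (h : IsAntiTorus ρ g₁ g₂ ℓ₁ ℓ₂ m₁ m₂)
    (h₁ : T₁.Preconnected) (h₂ : T₂.Preconnected) :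
    ∃ f₁ f₂, Splits (ρ g₁) f₁ f₂ := by
  refine exists_splits h₁ h₂ (ρ g₁) ⟨(ℓ₁ 0, ℓ₁ (0 + 1)), h.adj₁ 0⟩
    ⟨(ℓ₂ 0, ℓ₂ (0 + 1)), h.adj₂ 0⟩ (y₀ := ℓ₂ 0) ?_
  have h3 := h.smul_axisEdge 0
  rw [axisEdge, axisEdge] at h3
  rw [h3, hType_hE]
  rfl

theorem exists_splits₂ (h : IsAntiTorus ρ g₁ g₂ ℓ₁ ℓ₂ m₁ m₂)
    (h₁ : T₁.Preconnected) (h₂ : T₂.Preconnected) :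
    ∃ f₁ f₂, Splits (ρ g₂) f₁ f₂ := by
  -- The edge is directed towards `ℓ₁ 0` so that the vertical side at its terminal vertex, which
  -- decides the type in `isSome_hType_smul`, lies on the axis of `g₂`.
  let e : T₁.Dart := ⟨(ℓ₁ (0 + 1), ℓ₁ 0), (h.adj₁ 0).symm⟩
  let k : T₂.Dart := ⟨(ℓ₂ 0, ℓ₂ (0 + 1)), h.adj₂ 0⟩
  refine exists_splits h₁ h₂ (ρ g₂) e k (y₀ := ℓ₂ 0) (isSome_hType_smul (k := k) ?_)
  have h3 : ρ g₂ • (vE (ℓ₁ 0) k : (SquareComplex.prod T₁ T₂).E) =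
      vE (ℓ₁ 0) ⟨(ℓ₂ (0 + m₂), ℓ₂ (0 + 1 + m₂)), by
        rw [add_right_comm]; exact h.adj₂ _⟩ := by
    apply prod_edge_ext
    · rw [src_smul]; exact h.translate₂ 0
    · rw [tgt_smul]; exact h.translate₂ (0 + 1)
  have h4 : (vE e.snd k : (SquareComplex.prod T₁ T₂).E) = vE (ℓ₁ 0) k := rfl
  rw [h4, h3, hType_vE]
  simp

/-- A power `g₂ ^ n` does not fix the vertex `g₁ ^ k p₁` of the first tree when `g₁ ^ k` fixes the
vertex `g₂ ^ (-n) p₂` of the second one, since otherwise the two powers commute. -/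
theorem apply_ne_of_zpow_smul_eq (h : IsAntiTorus ρ g₁ g₂ ℓ₁ ℓ₂ m₁ m₂)
    (hρ : IsFree ρ) {γ₁ : V₁ → V₁} {γ₂ : V₂ → V₂} {n : ℕ} (hn : 0 < n)
    (hc : Splits (ρ (g₂ ^ n)) γ₁ γ₂) {k : ℤ} (hk : k ≠ 0)
    (hy : ρ (g₁ ^ k) • prodVertex T₁ T₂ (ℓ₁ 0) (ℓ₂ (-(n * m₂))) =
      prodVertex T₁ T₂ (ℓ₁ (k * m₁)) (ℓ₂ (-(n * m₂)))) : γ₁ (ℓ₁ (k * m₁)) ≠ ℓ₁ (k * m₁) := by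
  intro hfix
  refine h.not_commute k n hk (by exact_mod_cast hn.ne') ?_
  have h1 : ρ (g₂ ^ n) • prodVertex T₁ T₂ (ℓ₁ 0) (ℓ₂ (-(n * m₂))) =
      prodVertex T₁ T₂ (ℓ₁ 0) (ℓ₂ 0) := by
    have := h.zpow_translate₂ n (-(n * m₂))
    rwa [zpow_natCast, neg_add_cancel] at this
  have h2 : γ₂ (ℓ₂ (-(n * m₂))) = ℓ₂ 0 := (prodVertex_inj.1 ((hc.vertex _ _).symm.trans h1)).2
  rw [zpow_natCast]
  -- Both products send `(p₁, g₂⁻ⁿ p₂)` to `(ℓ₁ (k m₁), p₂)`: through `(p₁, p₂)` in one order,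
  -- through `(ℓ₁ (k m₁), g₂⁻ⁿ p₂)` in the other. Freeness turns this into equality of the group
  -- elements.
  refine hρ.eq_of_smul_eq (x := prodVertex T₁ T₂ (ℓ₁ 0) (ℓ₂ (-(n * m₂)))) ?_
  rw [map_mul, map_mul, mul_smul, mul_smul, h1, hy, h.zpow_translate₁, hc.vertex, hfix, h2,
    zero_add]

theorem not_isAcylindricalOnContactGraph (h : IsAntiTorus ρ g₁ g₂ ℓ₁ ℓ₂ m₁ m₂)
    (hT₁ : T₁.IsTree) (hT₂ : T₂.IsTree)
    (hfin₁ : ∀ x, (T₁.neighborSet x).Finite) (hfin₂ : ∀ x, (T₂.neighborSet x).Finite)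
    (hρ : IsFree ρ) (hX : (SquareComplex.prod T₁ T₂).IsSimplyConnected) :
    ¬ IsAcylindricalOnContactGraph ((h.axial hρ).act hX) := by
  have hc₁ := hT₁.1.preconnected
  have hc₂ := hT₂.1.preconnected
  obtain ⟨α, β, hαβ⟩ := h.exists_splits₁ hc₁ hc₂
  obtain ⟨γ₁, γ₂, hγ⟩ := h.exists_splits₂ hc₁ hc₂
  have hα : ∀ n, α (ℓ₁ n) = ℓ₁ (n + m₁) := fun n =>
    (prodVertex_inj.1 ((hαβ.vertex _ _).symm.trans (h.translate₁ n))).1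
  have hβ : β (ℓ₂ 0) = ℓ₂ 0 :=
    (prodVertex_inj.1 ((hαβ.vertex _ _).symm.trans (h.translate₁ 0))).2
  have hγ0 : γ₁ (ℓ₁ 0) = ℓ₁ 0 :=
    (prodVertex_inj.1 ((hγ.vertex _ _).symm.trans (h.translate₂ 0))).1
  refine (h.axial hρ).not_isAcylindricalOnContactGraph hX fun r => ?_
  -- The segment reaches `r + 1`, where the edge with index `r` ends. It starts at `-1` because the
  -- comparison of a line with its image needs agreement on both sides of 0.
  obtain ⟨n, hn, hfix⟩ := hc₁.exists_iterate_eq_on hfin₁ hγ.inj₁ hγ.adj₁ hγ0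
    ((Set.finite_Icc (-1 : ℤ) (r + 1)).image ℓ₁)
  -- Since `g₁` fixes `p₂` and `T₂` is locally finite, some power of it also fixes the vertex `g₂⁻ⁿ
  -- p₂`.
  obtain ⟨s, hs, hy⟩ := hc₂.exists_iterate_eq hfin₂ hαβ.inj₂ hαβ.adj₂ hβ (ℓ₂ (-(n * m₂)))
  have hc := hγ.pow n
  rw [← map_pow] at hc
  have hfix' : ∀ j : ℤ, -1 ≤ j → j ≤ r + 1 → γ₁^[n] (ℓ₁ j) = ℓ₁ j := fun j h1 h2 =>
    hfix _ ⟨j, ⟨h1, h2⟩, rfl⟩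
  refine ⟨g₂ ^ n, 2 * s + 1, fun j hj => ?_, ?_⟩
  · change ρ (g₂ ^ n) • (SquareComplex.prod T₁ T₂).dual (hE _ _) =
      (SquareComplex.prod T₁ T₂).dual (hE _ _)
    rw [smul_dual, hc.smul_hE, dual_hE hc₂ _ _ (ℓ₂ 0)]
    congr 2
    exact SimpleGraph.Dart.ext _ _ (Prod.ext (hfix' _ (by omega) (by omega))
      (hfix' _ (by omega) (by omega)))
  rintro ⟨x, hx⟩
  -- Undoing the shift by `g₁`, the power of `g₂` maps an edge of `ℓ₁` to an edge of `ℓ₁`. It fixes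
  -- `ℓ₁` near 0, so `ℓ₁` and its image are lines that agree near 0 and meet again; they agree, with
  -- the same parameter, all the way to that edge.
  have hstep : ∀ q < 2 * s + 1, x (q + 1) = x q - m₁ ∧
      ∀ k, (0 ≤ k ∧ k ≤ x (q + 1)) ∨ (x (q + 1) ≤ k ∧ k ≤ 0) → γ₁^[n] (ℓ₁ k) = ℓ₁ k := by
    intro q hq
    have h1 := hx q hq
    change ρ (g₁ * g₂ ^ n) • (SquareComplex.prod T₁ T₂).dual (hE _ _) =
      (SquareComplex.prod T₁ T₂).dual (hE _ _) at h1
    have h2 := hαβ.mul hc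
    rw [← map_mul] at h2
    rw [smul_dual, h2.smul_hE] at h1
    have h3 := hType_eq_of_dual_eq h1
    rw [hType_hE, hType_hE, Option.some_inj] at h3
    have h4 : ∀ j, ℓ₁ j = α (ℓ₁ (j - m₁)) := fun j => by rw [hα, sub_add_cancel]
    have hl : ∀ {i j : ℤ}, ℓ₁ i = γ₁^[n] (ℓ₁ j) →
        i = j ∧ ∀ k, (0 ≤ k ∧ k ≤ j) ∨ (j ≤ k ∧ k ≤ 0) → ℓ₁ k = γ₁^[n] (ℓ₁ k) :=
      fun {i j} hij => hT₁.2.eq_of_lines h.inj₁ (hc.inj₁.comp h.inj₁) h.adj₁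
        (fun k => hc.adj₁ _ _ (h.adj₁ k)) (hfix' 0 (by omega) (by omega)).symm
        (hfix' 1 (by omega) (by omega)).symm (hfix' (-1) (by omega) (by omega)).symm hij
    rcases Sym2.eq_iff.1 h3 with ⟨h5, -⟩ | ⟨h5, h6⟩
    · obtain ⟨h7, h8⟩ := hl (hαβ.inj₁ (h5.trans (h4 _))).symm
      exact ⟨h7.symm, fun k hk => (h8 k hk).symm⟩
    -- The edge would be reversed: the two end points then require indices that contradict each
    -- other.
    · have h7 := (hl (hαβ.inj₁ (h5.trans (h4 _))).symm).1
      have h8 := (hl (hαβ.inj₁ (h6.trans (h4 _))).symm).1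
      omega
  have hx' : ∀ q ≤ 2 * s + 1, x q = x 0 - q * m₁ := by
    intro q
    induction q with
    | zero => simp
    | succ q ih =>
      intro hq
      rw [(hstep q hq).1, ih (by omega)]
      push_cast
      ring
  -- The indices `x 1, …, x (2 s + 1)` descend by `2 s m₁` in total, so either the first is at least
  -- `s m₁` or the last is below `-s m₁`. In each case the fixed part of `ℓ₁` contains the
  -- corresponding vertex; this is the reason for taking `M = 2 s + 1`.
  have hfixs : γ₁^[n] (ℓ₁ ((s : ℤ) * m₁)) = ℓ₁ ((s : ℤ) * m₁) ∨
      γ₁^[n] (ℓ₁ (-(s : ℤ) * m₁)) = ℓ₁ (-(s : ℤ) * m₁) := by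
    have h1 := hx' 1 (by omega)
    have h2 := hx' (2 * s + 1) le_rfl
    have h3 : 0 ≤ (s : ℤ) * m₁ := by positivity
    push_cast at h1 h2
    have h4 : (2 * (s : ℤ) + 1) * m₁ = 2 * ((s : ℤ) * m₁) + 1 * m₁ := by ring
    rcases le_or_gt ((s : ℤ) * m₁) (x 1) with h5 | h5
    · exact .inl ((hstep 0 (by omega)).2 _ (.inl ⟨h3, h5⟩))
    · refine .inr ((hstep (2 * s) (by omega)).2 _ (.inr ⟨?_, ?_⟩))
      · rw [h2, neg_mul]; linarith
      · rw [neg_mul]; linarith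
  have hs' : ρ (g₁ ^ s) • prodVertex T₁ T₂ (ℓ₁ (-(s : ℤ) * m₁)) (ℓ₂ (-(n * m₂))) =
      prodVertex T₁ T₂ (ℓ₁ 0) (ℓ₂ (-(n * m₂))) ∧
      ρ (g₁ ^ s) • prodVertex T₁ T₂ (ℓ₁ 0) (ℓ₂ (-(n * m₂))) =
      prodVertex T₁ T₂ (ℓ₁ (s * m₁)) (ℓ₂ (-(n * m₂))) := by
    have h1 := hαβ.pow s
    rw [← map_pow] at h1
    have h2 : ∀ j, α^[s] (ℓ₁ j) = ℓ₁ (j + s * m₁) := fun j => by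
      have h3 := h.zpow_translate₁ s j
      rw [zpow_natCast, h1.vertex] at h3
      exact (prodVertex_inj.1 h3).1
    rw [h1.vertex, h1.vertex, hy, h2, h2, neg_mul, neg_add_cancel, zero_add]
    exact ⟨rfl, rfl⟩
  rcases hfixs with h1 | h1
  · refine h.apply_ne_of_zpow_smul_eq hρ hn hc (k := s) (by omega) ?_ h1
    rw [zpow_natCast]
    exact hs'.2
  · refine h.apply_ne_of_zpow_smul_eq hρ hn hc (k := -s) (by omega) ?_ h1
    rw [zpow_neg, map_inv, inv_smul_eq_iff, zpow_natCast]
    exact hs'.1.symm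

theorem isCAT0_and_exists_mulEquiv_deck (h : IsAntiTorus ρ g₁ g₂ ℓ₁ ℓ₂ m₁ m₂)
    (hT₁ : T₁.IsTree) (hT₂ : T₂.IsTree)
    (hfin₁ : ∀ x, (T₁.neighborSet x).Finite) (hfin₂ : ∀ x, (T₂.neighborSet x).Finite)
    (hρ : IsFree ρ) (hcoc : IsCocompact ρ) :
    (h.Y hρ).IsCAT0 ∧
      ∃ φ : HNNExtension Γ (Subgroup.zpowers g₁) (Subgroup.zpowers g₁) (MulEquiv.refl _) ≃*
          h.deck hρ,
        IsFree ((h.deck hρ).subtype.comp φ.toMonoidHom) ∧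
        IsCocompact ((h.deck hρ).subtype.comp φ.toMonoidHom) ∧
        ¬ IsAcylindricalOnContactGraph ((h.deck hρ).subtype.comp φ.toMonoidHom) := by
  have hX := prod_isSimplyConnected hT₁ hT₂
  have hb := h.base_isNonPositivelyCurved hρ
  -- The complex and deck group of the anti-torus unfold to those of `h.axial hρ`, so the results
  -- for axial loops apply as they stand.
  exact ⟨⟨Cover.isSimplyConnected _ _, Cover.isNonPositivelyCurved hb⟩,
    (h.axial hρ).deckEquiv hX, (h.axial hρ).act_isFree hX hb, (h.axial hρ).act_isCocompact hX hcoc,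
    h.not_isAcylindricalOnContactGraph hT₁ hT₂ hfin₁ hfin₂ hρ hX⟩

end IsAntiTorus

/-! ### Groups that act simply transitively on the vertices of a product of trees -/

/-- A family of elements of a group that is closed under inversion. -/
structure Alphabet (Γ : Type*) [Group Γ] (I : Type*) where
  val : I → Γ
  bar : I → I
  val_bar : ∀ i, val (bar i) = (val i)⁻¹
  val_ne : ∀ i, val i ≠ (val i)⁻¹

namespace Alphabet

variable {Γ I J : Type*} [Group Γ] (A : Alphabet Γ I) (B : Alphabet Γ J)

/-- The element of the group represented by a word. -/
def word (w : List I) : Γ := (w.map A.val).prod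

theorem word_nil : A.word [] = 1 := rfl

theorem word_cons (i : I) (w : List I) : A.word (i :: w) = A.val i * A.word w := List.prod_cons

theorem word_append (w w' : List I) : A.word (w ++ w') = A.word w * A.word w' := by
  rw [word, List.map_append, List.prod_append]; rfl

/-- The subgroup generated by the letters. -/
def subgroup : Subgroup Γ where
  carrier := Set.range A.word
  one_mem' := ⟨[], rfl⟩
  mul_mem' := by
    rintro _ _ ⟨w, rfl⟩ ⟨w', rfl⟩
    exact ⟨w ++ w', A.word_append w w'⟩
  inv_mem' := by
    rintro _ ⟨w, rfl⟩
    induction w with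
    | nil => exact ⟨[], by simp [word_nil]⟩
    | cons i w ih =>
      obtain ⟨w', h⟩ := ih
      exact ⟨w' ++ [A.bar i], by simp [word_append, h, word_cons, word_nil, val_bar]⟩

theorem word_mem (w : List I) : A.word w ∈ A.subgroup := ⟨w, rfl⟩

theorem val_mem (i : I) : A.val i ∈ A.subgroup := ⟨[i], by simp [word]⟩

/-- Words without cancellation. -/
def Reduced (w : List I) : Prop := w.IsChain (fun i j => A.val j ≠ (A.val i)⁻¹)

theorem exists_reduced (w : List I) : ∃ w', A.Reduced w' ∧ A.word w' = A.word w := by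
  induction w with
  | nil => exact ⟨[], List.isChain_nil, rfl⟩
  | cons i w ih =>
    obtain ⟨w', h, h'⟩ := ih
    rcases w' with _ | ⟨j, w'⟩
    · exact ⟨[i], List.isChain_singleton i, by rw [word_cons, h', word_cons]⟩
    · by_cases hj : A.val j = (A.val i)⁻¹
      · refine ⟨w', List.IsChain.tail h, ?_⟩
        rw [word_cons, ← h', word_cons, hj, mul_inv_cancel_left]
      · exact ⟨i :: j :: w', List.isChain_cons_cons.2 ⟨hj, h⟩, by rw [word_cons, h', word_cons]⟩

/-- The graph of cosets of `K` in which `g K` and `g a K` are adjacent for each letter `a`. -/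
def cosetGraph (K : Subgroup Γ) : SimpleGraph (Γ ⧸ K) where
  Adj x y := x ≠ y ∧ ∃ g i, x = QuotientGroup.mk g ∧ y = QuotientGroup.mk (g * A.val i)
  symm := ⟨by
    rintro _ _ ⟨hne, g, i, rfl, rfl⟩
    exact ⟨hne.symm, g * A.val i, A.bar i, rfl, by rw [val_bar, mul_inv_cancel_right]⟩⟩
  loopless := ⟨fun _ h => h.1 rfl⟩

/-- The conditions under which the coset graph is a tree with a letter for each edge at a vertex. -/
structure Splits (K : Subgroup Γ) : Prop where
  push : ∀ k ∈ K, ∀ i, ∃ j, ∃ k' ∈ K, k * A.val i = A.val j * k'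
  not_mem : ∀ w ≠ [], A.Reduced w → A.word w ∉ K
  gen : ∀ g, ∃ w, ∃ k ∈ K, g = A.word w * k

namespace Splits

variable {A} {K : Subgroup Γ}

theorem val_not_mem (h : A.Splits K) (i : I) : A.val i ∉ K := by
  have := h.not_mem [i] (List.cons_ne_nil _ _) (List.isChain_singleton i)
  rwa [word_cons, word_nil, mul_one] at this

/-- The definition of adjacency allows any representative of the first coset. Changing it by an
element of `K` only changes the letter, by `push`. -/
theorem adj_mk (h : A.Splits K) {g : Γ} {y : Γ ⧸ K} :
    (A.cosetGraph K).Adj (QuotientGroup.mk g) y ↔ ∃ i, y = QuotientGroup.mk (g * A.val i) := by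
  constructor
  · rintro ⟨-, g', i, hg, rfl⟩
    obtain ⟨j, k, hk, hj⟩ := h.push _ (QuotientGroup.eq.1 hg) i
    refine ⟨j, (QuotientGroup.eq.2 ?_).symm⟩
    rw [show g' * A.val i = g * A.val j * k by rw [mul_assoc g, ← hj]; group]
    rwa [inv_mul_cancel_left]
  · rintro ⟨i, rfl⟩
    refine ⟨fun hi => h.val_not_mem i ?_, g, i, rfl, rfl⟩
    have := QuotientGroup.eq.1 hi
    rwa [inv_mul_cancel_left] at this

theorem reachable (h : A.Splits K) (g : Γ) (w : List I) :
    (A.cosetGraph K).Reachable (QuotientGroup.mk g) (QuotientGroup.mk (g * A.word w)) := by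
  induction w generalizing g with
  | nil => rw [word_nil, mul_one]
  | cons i w ih =>
    rw [word_cons, ← mul_assoc]
    exact (h.adj_mk.2 ⟨i, rfl⟩).reachable.trans (ih _)

/-- The word is read off the walk; two consecutive letters that cancel would traverse an edge back
at once. The last clause exposes the first edge of the walk, so that the induction can see this. -/
theorem exists_word (h : A.Splits K) {x y : Γ ⧸ K} (p : (A.cosetGraph K).Walk x y)
    (hp : p.IsTrail) : ∀ g, x = QuotientGroup.mk g → ∃ w, A.Reduced w ∧ w.length = p.length ∧
      y = QuotientGroup.mk (g * A.word w) ∧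
      ∀ i w', w = i :: w' → s(x, QuotientGroup.mk (g * A.val i)) ∈ p.edges := by
  induction p with
  | nil =>
    rintro g rfl
    exact ⟨[], List.isChain_nil, rfl, by rw [word_nil, mul_one], fun _ _ h => by cases h⟩
  | @cons x z y hadj p ih =>
    rintro g rfl
    obtain ⟨i, rfl⟩ := h.adj_mk.1 hadj
    rw [SimpleGraph.Walk.isTrail_cons] at hp
    obtain ⟨w, h1, h2, h3, h4⟩ := ih hp.1 _ rfl
    refine ⟨i :: w, ?_, by simp [h2], by rw [h3, word_cons, mul_assoc], ?_⟩
    · rcases w with _ | ⟨j, w⟩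
      · exact List.isChain_singleton i
      · refine List.isChain_cons_cons.2 ⟨fun hj => hp.2 ?_, h1⟩
        have h5 := h4 j w rfl
        rwa [hj, mul_inv_cancel_right, Sym2.eq_swap] at h5
    · rintro j w' hj
      obtain ⟨rfl, -⟩ := List.cons_eq_cons.1 hj
      simp

/-- Connectedness is generation by words modulo `K`. A cycle would spell a non-empty reduced word
that lies in `K`. -/
theorem isTree (h : A.Splits K) : (A.cosetGraph K).IsTree := by
  refine ⟨(SimpleGraph.connected_iff_exists_forall_reachable _).2 ⟨QuotientGroup.mk 1, fun x => ?_⟩,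
    fun v c hc => ?_⟩
  · obtain ⟨g, rfl⟩ := QuotientGroup.mk_surjective x
    obtain ⟨w, k, hk, rfl⟩ := h.gen g
    have h1 := h.reachable 1 w
    rw [one_mul] at h1
    rwa [show (QuotientGroup.mk (A.word w * k) : Γ ⧸ K) = QuotientGroup.mk (A.word w) from
      (QuotientGroup.eq.2 (by rwa [inv_mul_cancel_left])).symm]
  · obtain ⟨g, rfl⟩ := QuotientGroup.mk_surjective v
    obtain ⟨w, h1, h2, h3, -⟩ := h.exists_word c hc.isTrail g rfl
    refine h.not_mem w (fun hw => ?_) h1 ?_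
    · have := hc.three_le_length
      rw [← h2, hw, List.length_nil] at this
      omega
    · have := QuotientGroup.eq.1 h3
      rwa [inv_mul_cancel_left] at this

theorem finite_neighborSet [Finite I] (h : A.Splits K) (x : Γ ⧸ K) :
    ((A.cosetGraph K).neighborSet x).Finite := by
  obtain ⟨g, rfl⟩ := QuotientGroup.mk_surjective x
  refine (Set.finite_range fun i => (QuotientGroup.mk (g * A.val i) : Γ ⧸ K)).subset ?_
  intro y hy
  obtain ⟨i, rfl⟩ := h.adj_mk.1 hy
  exact ⟨i, rfl⟩

/-- A letter differs from its inverse, so its repetitions form reduced words. -/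
theorem eq_zero_of_zpow_mem (h : A.Splits K) {i : I} {n : ℤ} (hn : A.val i ^ n ∈ K) : n = 0 := by
  by_contra h0
  refine h.not_mem (List.replicate n.natAbs i) (by simpa using h0) ?_ ?_
  · exact List.isChain_replicate_of_rel _ (A.val_ne i)
  · rw [word, List.map_replicate, List.prod_replicate]
    rcases Int.natAbs_eq n with h1 | h1
    · rw [h1, zpow_natCast] at hn
      exact hn
    · rw [h1, zpow_neg, inv_mem_iff, zpow_natCast] at hn
      exact hn

end Splits

theorem smul_cosetGraph (K : Subgroup Γ) (g : Γ) (x y : Γ ⧸ K) (h : (A.cosetGraph K).Adj x y) :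
    (A.cosetGraph K).Adj (g • x) (g • y) := by
  obtain ⟨hne, g', i, rfl, rfl⟩ := h
  refine ⟨fun h => hne (MulAction.injective g h), g * g', i, rfl, ?_⟩
  rw [mul_assoc]
  rfl

/-- The group is generated by two alphabets whose letters can be interchanged. -/
structure Interchange : Prop where
  swap : ∀ i k, ∃ l j, A.val i * B.val k = B.val l * A.val j
  not_mem_left : ∀ w ≠ [], A.Reduced w → A.word w ∉ B.subgroup
  not_mem_right : ∀ w ≠ [], B.Reduced w → B.word w ∉ A.subgroup
  gen : Subgroup.closure (Set.range A.val ∪ Set.range B.val) = ⊤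
  sq_ne : ∀ i k, A.val i * B.val k * (A.val i * B.val k) ≠ 1

namespace Interchange

variable {A B}

theorem symm (F : A.Interchange B) : B.Interchange A where
  swap k i := by
    obtain ⟨l, j, h⟩ := F.swap (A.bar i) (B.bar k)
    refine ⟨A.bar j, B.bar l, ?_⟩
    rw [A.val_bar, B.val_bar, ← mul_inv_rev] at h
    rw [A.val_bar, B.val_bar, ← mul_inv_rev, ← h, inv_inv]
  not_mem_left := F.not_mem_right
  not_mem_right := F.not_mem_left
  gen := by rw [Set.union_comm, F.gen]
  sq_ne k i h := F.sq_ne i k (by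
    have h1 : A.val i * B.val k * (A.val i * B.val k) =
        A.val i * (B.val k * A.val i * (B.val k * A.val i)) * (A.val i)⁻¹ := by group
    rw [h1, h, mul_one, mul_inv_cancel])

theorem push (F : A.Interchange B) {k : Γ} (hk : k ∈ B.subgroup) (i : I) :
    ∃ j, ∃ k' ∈ B.subgroup, k * A.val i = A.val j * k' := by
  obtain ⟨w, rfl⟩ := hk
  induction w with
  | nil => exact ⟨i, 1, one_mem _, by rw [word_nil, one_mul, mul_one]⟩
  | cons b w ih =>
    obtain ⟨j, k', hk', h⟩ := ih
    obtain ⟨l, m, h'⟩ := F.symm.swap b j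
    exact ⟨l, B.val m * k', mul_mem (B.val_mem m) hk', by
      rw [word_cons, mul_assoc, h, ← mul_assoc, h', mul_assoc]⟩

theorem push_word (F : A.Interchange B) (w : List I) : ∀ k ∈ B.subgroup,
    ∃ w', ∃ k' ∈ B.subgroup, k * A.word w = A.word w' * k' := by
  induction w with
  | nil => exact fun k hk => ⟨[], k, hk, by rw [word_nil, one_mul, mul_one]⟩
  | cons i w ih =>
    intro k hk
    obtain ⟨j, k', hk', h⟩ := F.push hk i
    obtain ⟨w', k'', hk'', h'⟩ := ih k' hk'
    exact ⟨j :: w', k'', hk'', by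
      rw [word_cons, ← mul_assoc, h, mul_assoc, h', word_cons, mul_assoc]⟩

theorem splits (F : A.Interchange B) : A.Splits B.subgroup where
  push _ hk := F.push hk
  not_mem := F.not_mem_left
  gen g := by
    have hg : g ∈ Subgroup.closure (Set.range A.val ∪ Set.range B.val) := by
      rw [F.gen]; trivial
    have key : ∀ k ∈ B.subgroup, ∀ w, ∀ k' ∈ B.subgroup,
        ∃ w', ∃ k'' ∈ B.subgroup, k * (A.word w * k') = A.word w' * k'' := by
      intro k hk w k' hk'
      obtain ⟨w', k'', hk'', h⟩ := F.push_word w k hk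
      exact ⟨w', k'' * k', mul_mem hk'' hk', by rw [← mul_assoc, h, mul_assoc]⟩
    induction hg using Subgroup.closure_induction_left with
    | one => exact ⟨[], 1, one_mem _, by rw [word_nil, one_mul]⟩
    | mul_left x hx y _ ih =>
      obtain ⟨w, k, hk, rfl⟩ := ih
      rcases hx with ⟨i, rfl⟩ | ⟨l, rfl⟩
      · exact ⟨i :: w, k, hk, by rw [word_cons, mul_assoc]⟩
      · exact key _ (B.val_mem l) w k hk
    | inv_mul_cancel x hx y _ ih =>
      obtain ⟨w, k, hk, rfl⟩ := ih
      rcases hx with ⟨i, rfl⟩ | ⟨l, rfl⟩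
      · exact ⟨A.bar i :: w, k, hk, by rw [word_cons, mul_assoc, A.val_bar]⟩
      · exact key _ (inv_mem (B.val_mem l)) w k hk

theorem eq_one (F : A.Interchange B) {g : Γ} (hA : g ∈ A.subgroup) (hB : g ∈ B.subgroup) :
    g = 1 := by
  obtain ⟨w, rfl⟩ := hA
  obtain ⟨w', h, h'⟩ := A.exists_reduced w
  rcases eq_or_ne w' [] with rfl | hne
  · rw [← h', word_nil]
  · exact absurd (h' ▸ hB) (F.not_mem_left w' hne h)

end Interchange

end Alphabet

/-! ### Diagonal actions on products and a criterion for cocompactness -/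

namespace SquareComplex

/-- An action by automorphisms, from actions on vertices and on edges. -/
def autHom {G : Type v} [Group G] {X : SquareComplex.{u}} (fV : G → X.V → X.V) (fE : G → X.E → X.E)
    (oneV : ∀ x, fV 1 x = x) (mulV : ∀ g h x, fV (g * h) x = fV g (fV h x))
    (oneE : ∀ e, fE 1 e = e) (mulE : ∀ g h e, fE (g * h) e = fE g (fE h e))
    (src : ∀ g e, X.src (fE g e) = fV g (X.src e)) (inv : ∀ g e, fE g (X.inv e) = X.inv (fE g e))
    (sq : ∀ g a b c d, X.Sq a b c d → X.Sq (fE g a) (fE g b) (fE g c) (fE g d)) : G →* X.Aut where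
  toFun g := ⟨(⟨fV g, fV g⁻¹, fun x => by rw [← mulV, inv_mul_cancel, oneV],
      fun x => by rw [← mulV, mul_inv_cancel, oneV]⟩,
    ⟨fE g, fE g⁻¹, fun x => by rw [← mulE, inv_mul_cancel, oneE],
      fun x => by rw [← mulE, mul_inv_cancel, oneE]⟩),
    src g, inv g, fun a b c d => ⟨fun h => by
      have h1 := sq g⁻¹ _ _ _ _ h
      simp only [Equiv.coe_fn_mk, ← mulE, inv_mul_cancel, oneE] at h1
      exact h1, sq g a b c d⟩⟩
  map_one' := Subtype.ext (Prod.ext (Equiv.ext oneV) (Equiv.ext oneE))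
  map_mul' g h := Subtype.ext (Prod.ext (Equiv.ext (mulV g h)) (Equiv.ext (mulE g h)))

section ProdAction

variable {G : Type v} [Group G] {V₁ V₂ : Type u} {T₁ : SimpleGraph V₁} {T₂ : SimpleGraph V₂}
  [MulAction G V₁] [MulAction G V₂] (h₁ : ∀ (g : G) x y, T₁.Adj x y → T₁.Adj (g • x) (g • y))
  (h₂ : ∀ (g : G) x y, T₂.Adj x y → T₂.Adj (g • x) (g • y))

/-- The diagonal action on a product of graphs. -/
def prodAction : G →* (prod T₁ T₂).Aut :=
  autHom (X := prod T₁ T₂) (fun g v => (g • v.1, g • v.2))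
    (fun g => Sum.map (fun e => (⟨(g • e.1.fst, g • e.1.snd), h₁ g _ _ e.1.adj⟩, g • e.2))
      (fun f => (g • f.1, ⟨(g • f.2.fst, g • f.2.snd), h₂ g _ _ f.2.adj⟩)))
    (fun v => Prod.ext (one_smul G _) (one_smul G _))
    (fun g h v => Prod.ext (mul_smul g h _) (mul_smul g h _))
    (by
      rintro (e | f)
      · exact prod_edge_ext (Prod.ext (one_smul G _) (one_smul G _))
          (Prod.ext (one_smul G _) (one_smul G _))
      · exact prod_edge_ext (Prod.ext (one_smul G _) (one_smul G _))
          (Prod.ext (one_smul G _) (one_smul G _)))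
    (by
      rintro g h (e | f)
      · exact prod_edge_ext (Prod.ext (mul_smul g h _) (mul_smul g h _))
          (Prod.ext (mul_smul g h _) (mul_smul g h _))
      · exact prod_edge_ext (Prod.ext (mul_smul g h _) (mul_smul g h _))
          (Prod.ext (mul_smul g h _) (mul_smul g h _)))
    (by rintro g (e | f) <;> rfl) (by rintro g (e | f) <;> rfl)
    (by
      intro g a b c d h
      obtain ⟨e, f, ⟨rfl, rfl, rfl, rfl⟩ | ⟨rfl, rfl, rfl, rfl⟩⟩ := prod_sq_cases h
      · exact prod_sq_h ⟨(g • e.fst, g • e.snd), h₁ g _ _ e.adj⟩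
          ⟨(g • f.fst, g • f.snd), h₂ g _ _ f.adj⟩
      · exact prod_sq_v ⟨(g • e.fst, g • e.snd), h₁ g _ _ e.adj⟩
          ⟨(g • f.fst, g • f.snd), h₂ g _ _ f.adj⟩)

end ProdAction

theorem prod_finite_star {V₁ V₂ : Type u} {T₁ : SimpleGraph V₁} {T₂ : SimpleGraph V₂}
    (h₁ : ∀ x, (T₁.neighborSet x).Finite) (h₂ : ∀ x, (T₂.neighborSet x).Finite)
    (v : (prod T₁ T₂).V) : {e | (prod T₁ T₂).src e = v}.Finite := by
  obtain ⟨x, y, rfl⟩ := exists_prodVertex v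
  refine Set.Finite.of_finite_image (f := (prod T₁ T₂).tgt) ?_
    (fun a ha b hb h => prod_edge_ext (ha.trans hb.symm) h)
  refine ((((h₁ x).image fun x' => prodVertex T₁ T₂ x' y)).union
    ((h₂ y).image fun y' => prodVertex T₁ T₂ x y')).subset ?_
  rintro _ ⟨a, ha, rfl⟩
  rcases prod_edge_cases a with ⟨e, y', rfl⟩ | ⟨x', f, rfl⟩
  · obtain ⟨rfl, rfl⟩ := prodVertex_inj.1 ha
    exact .inl ⟨e.snd, e.adj, rfl⟩
  · obtain ⟨rfl, rfl⟩ := prodVertex_inj.1 ha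
    exact .inr ⟨f.snd, f.adj, rfl⟩

theorem isCocompact_of_transitive {G : Type v} [Group G] {X : SquareComplex.{u}} {ρ : G →* X.Aut}
    (hfin : ∀ v, {e | X.src e = v}.Finite) (v : X.V) (ht : ∀ x, ∃ g, ρ g • x = v) :
    IsCocompact ρ := by
  refine ⟨⟨{v}, Set.finite_singleton v, ht⟩, ⟨_, hfin v, fun e => ?_⟩,
    ⟨⋃ a ∈ {e | X.src e = v}, ⋃ b ∈ {e | X.src e = X.tgt a}, ⋃ c ∈ {e | X.src e = X.tgt b},
      (fun d => (a, b, c, d)) '' {e | X.src e = X.tgt c}, ?_, fun a b c d h => ?_⟩⟩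
  · obtain ⟨g, hg⟩ := ht (X.src e)
    exact ⟨g, (src_smul _ _).trans hg⟩
  · exact (hfin v).biUnion fun a _ => (hfin _).biUnion fun b _ => (hfin _).biUnion fun c _ =>
      (hfin _).image _
  · obtain ⟨g, hg⟩ := ht (X.src a)
    obtain ⟨h1, h2, h3, -⟩ := Sq.tgt_eq ((sq_smul (ρ g) a b c d).2 h)
    refine ⟨g, ?_⟩
    simp only [Set.mem_iUnion]
    exact ⟨_, (src_smul _ _).trans hg, _, h1.symm, _, h2.symm, _, h3.symm, rfl⟩

end SquareComplex

namespace Alphabet.Interchange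

open SquareComplex

variable {Γ : Type u} {I J : Type*} [Group Γ] {A : Alphabet Γ I} {B : Alphabet Γ J}

/-- The action on the product of the coset trees. -/
def action (A : Alphabet Γ I) (B : Alphabet Γ J) :
    Γ →* (prod (A.cosetGraph B.subgroup) (B.cosetGraph A.subgroup)).Aut :=
  prodAction (A.smul_cosetGraph B.subgroup) (B.smul_cosetGraph A.subgroup)

/-- The vertex of the product given by a group element. -/
def vertex (A : Alphabet Γ I) (B : Alphabet Γ J) (g : Γ) :
    (prod (A.cosetGraph B.subgroup) (B.cosetGraph A.subgroup)).V :=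
  prodVertex _ _ (QuotientGroup.mk g) (QuotientGroup.mk g)

theorem action_smul_vertex (g h : Γ) : action A B g • vertex A B h = vertex A B (g * h) := rfl

theorem vertex_injective (F : A.Interchange B) : Function.Injective (vertex A B) := by
  intro g h hgh
  obtain ⟨h1, h2⟩ := prodVertex_inj.1 hgh
  exact inv_mul_eq_one.1 (F.eq_one (QuotientGroup.eq.1 h2) (QuotientGroup.eq.1 h1))

/-- Every element is a word in the second alphabet times an element of the subgroup of the first, so
any two cosets, one of each subgroup, have a common representative. Together with `vertex_injective`
this makes the action simply transitive on vertices. -/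
theorem exists_vertex (F : A.Interchange B) (x : Γ ⧸ B.subgroup) (y : Γ ⧸ A.subgroup) :
    ∃ g, x = QuotientGroup.mk g ∧ y = QuotientGroup.mk g := by
  obtain ⟨g, rfl⟩ := QuotientGroup.mk_surjective x
  obtain ⟨h, rfl⟩ := QuotientGroup.mk_surjective y
  obtain ⟨w, k, hk, hw⟩ := F.symm.splits.gen (g⁻¹ * h)
  refine ⟨g * B.word w, QuotientGroup.eq.2 ?_, QuotientGroup.eq.2 ?_⟩
  · rw [inv_mul_cancel_left]; exact B.word_mem w
  · rw [show h = g * (B.word w * k) by rw [← hw, mul_inv_cancel_left]]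
    rw [show (g * (B.word w * k))⁻¹ * (g * B.word w) = k⁻¹ by group]
    exact inv_mem hk

theorem exists_hE (F : A.Interchange B) (e : (A.cosetGraph B.subgroup).Dart) (y : Γ ⧸ A.subgroup) :
    ∃ g i, prodVertex _ _ e.fst y = vertex A B g ∧
      prodVertex _ _ e.snd y = vertex A B (g * A.val i) := by
  obtain ⟨g, h1, rfl⟩ := F.exists_vertex e.fst y
  have h2 := e.adj
  rw [h1] at h2
  obtain ⟨i, h3⟩ := F.splits.adj_mk.1 h2
  refine ⟨g, i, prodVertex_inj.2 ⟨h1, rfl⟩, prodVertex_inj.2 ⟨h3, QuotientGroup.eq.2 ?_⟩⟩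
  rw [inv_mul_cancel_left]
  exact A.val_mem i

theorem exists_vE (F : A.Interchange B) (x : Γ ⧸ B.subgroup) (f : (B.cosetGraph A.subgroup).Dart) :
    ∃ g k, prodVertex _ _ x f.fst = vertex A B g ∧
      prodVertex _ _ x f.snd = vertex A B (g * B.val k) := by
  obtain ⟨g, rfl, h1⟩ := F.exists_vertex x f.fst
  have h2 := f.adj
  rw [h1] at h2
  obtain ⟨k, h3⟩ := F.symm.splits.adj_mk.1 h2
  refine ⟨g, k, prodVertex_inj.2 ⟨rfl, h1⟩, prodVertex_inj.2 ⟨QuotientGroup.eq.2 ?_, h3⟩⟩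
  rw [inv_mul_cancel_left]
  exact B.val_mem k

theorem action_eq_one (F : A.Interchange B) {g : Γ}
    {v : (prod (A.cosetGraph B.subgroup) (B.cosetGraph A.subgroup)).V}
    (h : action A B g • v = v) : g = 1 := by
  obtain ⟨x, y, rfl⟩ := exists_prodVertex v
  obtain ⟨k, rfl, rfl⟩ := F.exists_vertex x y
  exact mul_eq_right.1 (F.vertex_injective h)

/-- Such a `g` is `k * s * k⁻¹` and fixes `k` when squared, so `s * s = 1`. This excludes inversions
of edges, with `s` a letter, and half-turns of squares, with `s` the product along two sides. -/
theorem not_swap (F : A.Interchange B) {g k s : Γ} (hs : s * s ≠ 1)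
    (h1 : action A B g • vertex A B k = vertex A B (k * s))
    (h2 : action A B g • vertex A B (k * s) = vertex A B k) : False := by
  rw [action_smul_vertex] at h1 h2
  have h3 := F.vertex_injective h1
  have h4 := F.vertex_injective h2
  rw [← mul_assoc, h3, mul_assoc, mul_eq_left] at h4
  exact hs h4

theorem val_mul_val_ne (A : Alphabet Γ I) (i : I) : A.val i * A.val i ≠ 1 :=
  fun h => A.val_ne i (eq_inv_of_mul_eq_one_left h)

theorem action_edge_ne (F : A.Interchange B) (g : Γ)
    (e : (prod (A.cosetGraph B.subgroup) (B.cosetGraph A.subgroup)).E) :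
    action A B g • e ≠ (prod _ _).inv e := by
  intro h
  have h1 := (src_smul (action A B g) e).symm.trans (congrArg (prod _ _).src h)
  have h2 := (tgt_smul (action A B g) e).symm.trans (congrArg (prod _ _).tgt h)
  rw [tgt_inv] at h2
  rcases prod_edge_cases e with ⟨e, y, rfl⟩ | ⟨x, f, rfl⟩
  · obtain ⟨k, i, h3, h4⟩ := F.exists_hE e y
    rw [src_hE] at h1 h2
    rw [tgt_hE] at h2
    change _ = prodVertex _ _ e.snd y at h1
    rw [h3, h4] at h1 h2
    exact F.not_swap (val_mul_val_ne A i) h1 h2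
  · obtain ⟨k, i, h3, h4⟩ := F.exists_vE x f
    rw [src_vE] at h1 h2
    rw [tgt_vE] at h2
    change _ = prodVertex _ _ x f.snd at h1
    rw [h3, h4] at h1 h2
    exact F.not_swap (val_mul_val_ne B i) h1 h2

theorem exists_corners (F : A.Interchange B)
    {a b c d : (prod (A.cosetGraph B.subgroup) (B.cosetGraph A.subgroup)).E}
    (h : (prod _ _).Sq a b c d) :
    ∃ k s, s * s ≠ 1 ∧ (prod _ _).src a = vertex A B k ∧
      (prod _ _).src c = vertex A B (k * s) := by
  have h0 := (Sq.tgt_eq h).2.1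
  rw [← h0]
  obtain ⟨e, f, ⟨rfl, rfl, rfl, rfl⟩ | ⟨rfl, rfl, rfl, rfl⟩⟩ := prod_sq_cases h
  · obtain ⟨k, i, h1, h2⟩ := F.exists_hE e f.fst
    obtain ⟨k', l, h3, h4⟩ := F.exists_vE e.snd f
    obtain rfl := F.vertex_injective (h3.symm.trans h2)
    exact ⟨k, A.val i * B.val l, F.sq_ne i l, h1, by rw [← mul_assoc]; exact h4⟩
  · obtain ⟨k, l, h1, h2⟩ := F.exists_vE e.fst f
    obtain ⟨k', i, h3, h4⟩ := F.exists_hE e f.snd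
    obtain rfl := F.vertex_injective (h3.symm.trans h2)
    exact ⟨k, B.val l * A.val i, F.symm.sq_ne l i, h1, by rw [← mul_assoc]; exact h4⟩

theorem isSome_hType_action (g : Γ)
    (e : (prod (A.cosetGraph B.subgroup) (B.cosetGraph A.subgroup)).E) :
    (hType (action A B g • e)).isSome = (hType e).isSome := by
  rcases prod_edge_cases e with ⟨e, y, rfl⟩ | ⟨x, f, rfl⟩ <;> rfl

theorem action_isFree (F : A.Interchange B) : IsFree (action A B) where
  vertex g hg x hx := hg (F.action_eq_one hx)
  edge g _ e := F.action_edge_ne g e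
  square g hg a b c d h hs := by
    have hab := (hType_sq h).2
    have hbc := (hType_sq ((prod _ _).sq_rot _ _ _ _ h)).1
    -- Horizontal edges stay horizontal and vertical ones vertical, so `a` cannot be sent to an edge
    -- of the type of `b`. Among the symmetries of a square this leaves the identity, the half-turn
    -- and the two reflections that invert an edge.
    have hne : ∀ e, hType e = hType b → action A B g • a ≠ e := by
      rintro e he rfl
      rw [← he, isSome_hType_action] at hab
      exact (not_iff_self hab.symm).elim
    rcases hs.cases_eq (prod _ _).inv_inv with h1 | h1 | h1 | h1 | h1 | h1 | h1 | h1
    · exact hg (F.action_eq_one ((src_smul _ _).symm.trans (congrArg (prod _ _).src h1.1)))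
    · exact hne _ rfl h1.1
    · obtain ⟨k, s, hs, h2, h3⟩ := F.exists_corners h
      have h4 := (src_smul _ _).symm.trans (congrArg (prod _ _).src h1.1)
      have h5 := (src_smul _ _).symm.trans (congrArg (prod _ _).src h1.2.2.1)
      rw [h2, h3] at h4 h5
      exact F.not_swap hs h4 h5
    · exact hne _ hbc h1.1
    · exact hne _ ((hType_inv d).trans hbc) h1.1
    · exact F.action_edge_ne g b h1.2.1
    · exact hne _ (hType_inv b) h1.1
    · exact F.action_edge_ne g a h1.1

theorem action_isCocompact [Finite I] [Finite J] (F : A.Interchange B) :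
    IsCocompact (action A B) := by
  refine isCocompact_of_transitive (prod_finite_star F.splits.finite_neighborSet
    F.symm.splits.finite_neighborSet) (vertex A B 1) fun v => ?_
  obtain ⟨x, y, rfl⟩ := exists_prodVertex v
  obtain ⟨k, rfl, rfl⟩ := F.exists_vertex x y
  refine ⟨k⁻¹, ?_⟩
  have h : action A B k⁻¹ • vertex A B k = vertex A B (k⁻¹ * k) := rfl
  rwa [inv_mul_cancel] at h

theorem isAntiTorus (F : A.Interchange B) {i : I} {l : J}
    (h : ∀ p q : ℤ, p ≠ 0 → q ≠ 0 → ¬ Commute (A.val i ^ p) (B.val l ^ q)) :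
    IsAntiTorus (action A B) (A.val i) (B.val l) (fun n => QuotientGroup.mk (A.val i ^ n))
      (fun n => QuotientGroup.mk (B.val l ^ n)) 1 1 where
  inj₁ p q hpq := by
    have h1 := QuotientGroup.eq.1 hpq
    rw [← zpow_neg, ← zpow_add] at h1
    linarith [F.splits.eq_zero_of_zpow_mem h1]
  inj₂ p q hpq := by
    have h1 := QuotientGroup.eq.1 hpq
    rw [← zpow_neg, ← zpow_add] at h1
    linarith [F.symm.splits.eq_zero_of_zpow_mem h1]
  adj₁ n := F.splits.adj_mk.2 ⟨i, by rw [zpow_add_one]⟩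
  adj₂ n := F.symm.splits.adj_mk.2 ⟨l, by rw [zpow_add_one]⟩
  pos₁ := one_pos
  pos₂ := one_pos
  translate₁ n := by
    refine prodVertex_inj.2 ⟨?_, QuotientGroup.eq.2 ?_⟩
    · rw [Nat.cast_one, add_comm, zpow_one_add]
      rfl
    · simpa using A.val_mem i
  translate₂ n := by
    refine prodVertex_inj.2 ⟨QuotientGroup.eq.2 ?_, ?_⟩
    · simpa using B.val_mem l
    · rw [Nat.cast_one, add_comm, zpow_one_add]
      rfl
  not_commute := h

theorem exists_not_isAcylindrical {Γ : Type} [Group Γ] {I J : Type*} [Finite I] [Finite J]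
    {A : Alphabet Γ I} {B : Alphabet Γ J} (F : A.Interchange B) {i : I} {l : J}
    (h : ∀ p q : ℤ, p ≠ 0 → q ≠ 0 → ¬ Commute (A.val i ^ p) (B.val l ^ q)) :
    ∃ (G : Type) (_ : Group G) (X : SquareComplex.{0}) (ρ : G →* X.Aut),
      X.IsCAT0 ∧ IsProper ρ ∧ IsCocompact ρ ∧ ¬ IsAcylindricalOnContactGraph ρ := by
  obtain ⟨h1, φ, h2, h3, h4⟩ := (F.isAntiTorus h).isCAT0_and_exists_mulEquiv_deck F.splits.isTree F.symm.splits.isTree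
    F.splits.finite_neighborSet F.symm.splits.finite_neighborSet F.action_isFree
    F.action_isCocompact
  exact ⟨_, _, _, _, h1, fun x => (Set.finite_singleton 1).subset
    fun g hg => by_contra fun hne => h2.vertex g hne x hg, h3, h4⟩

end Alphabet.Interchange

/-! ### Two families of rational rotations -/

namespace RotationLattice

open Matrix

/-- The sign given by a truth value. -/
def sgn (b : Bool) : ℤ := if b then 1 else -1

/-- Three times the rotation given by the quaternion `1 ± j ± k`. -/
def matA (i : Bool × Bool) : Matrix (Fin 3) (Fin 3) ℤ :=
  !![-1, -2 * sgn i.2, 2 * sgn i.1; 2 * sgn i.2, 1, 2 * sgn i.1 * sgn i.2;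
    -2 * sgn i.1, 2 * sgn i.1 * sgn i.2, 1]

/-- Five times the rotation given by the quaternion `1 ± 2 i`, `1 ± 2 j` or `1 ± 2 k`. -/
def matB : Fin 3 × Bool → Matrix (Fin 3) (Fin 3) ℤ
  | (0, s) => !![5, 0, 0; 0, -3, -4 * sgn s; 0, 4 * sgn s, -3]
  | (1, s) => !![-3, 0, 4 * sgn s; 0, 5, 0; -4 * sgn s, 0, -3]
  | (2, s) => !![-3, -4 * sgn s, 0; 4 * sgn s, -3, 0; 0, 0, 5]

/-- The index of the inverse. -/
def barA (i : Bool × Bool) : Bool × Bool := (!i.1, !i.2)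

/-- The index of the inverse. -/
def barB (k : Fin 3 × Bool) : Fin 3 × Bool := (k.1, !k.2)

theorem matA_barA : ∀ i, matA (barA i) = (matA i)ᵀ := by decide +kernel

theorem matB_barB : ∀ k, matB (barB k) = (matB k)ᵀ := by decide +kernel

theorem matA_mul_transpose : ∀ i, matA i * (matA i)ᵀ = (3 ^ 2 : ℤ) • 1 := by decide +kernel

theorem matB_mul_transpose : ∀ i, matB i * (matB i)ᵀ = (5 ^ 2 : ℤ) • 1 := by decide +kernel

theorem matA_ne : ∀ i, matA i ≠ (matA i)ᵀ := by decide +kernel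

theorem matB_ne : ∀ i, matB i ≠ (matB i)ᵀ := by decide +kernel

/-- A finite check of 24 products, reflecting the fact that integral quaternions of norm 15 factor
through norms 3 and 5 in either order. -/
theorem matA_mul_matB : ∀ i k, ∃ l j, matA i * matB k = matB l * matA j := by decide +kernel

theorem matA_mul_matB_sq :
    ∀ i k, matA i * matB k * (matA i * matB k) ≠ (15 ^ 2 : ℤ) • 1 := by decide +kernel

/-- Modulo 3, the matrices `matA` have rank one. -/
theorem matA_mod : ∃ u v : Bool × Bool → Fin 3 → ZMod 3,
    (∀ i, (matA i).map (Int.cast : ℤ → ZMod 3) = vecMulVec (u i) (v i)) ∧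
      (∀ i, u i ≠ 0) ∧ (∀ i, v i ≠ 0) ∧ ∀ i j, v i ⬝ᵥ u j = 0 → j = barA i :=
  ⟨fun i => ![-1, -sgn i.2, sgn i.1], fun i => ![1, -sgn i.2, sgn i.1],
    by decide +kernel, by decide +kernel, by decide +kernel, by decide +kernel⟩

/-- Modulo 5, the matrices `matB` have rank one. -/
theorem matB_mod : ∃ u v : Fin 3 × Bool → Fin 3 → ZMod 5,
    (∀ i, (matB i).map (Int.cast : ℤ → ZMod 5) = vecMulVec (u i) (v i)) ∧
      (∀ i, u i ≠ 0) ∧ (∀ i, v i ≠ 0) ∧ ∀ i j, v i ⬝ᵥ u j = 0 → j = barB i :=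
  ⟨fun k => match k with
      | (0, s) => ![0, 1, 2 * sgn s]
      | (1, s) => ![1, 0, -2 * sgn s]
      | (2, s) => ![1, 2 * sgn s, 0],
    fun k => match k with
      | (0, s) => ![0, 2, sgn s]
      | (1, s) => ![2, 0, -sgn s]
      | (2, s) => ![2, sgn s, 0],
    by decide +kernel, by decide +kernel, by decide +kernel, by decide +kernel⟩

/-! ### Words in families of integral matrices -/

section Words

variable {I : Type*} {p : ℕ} [Fact p.Prime] {M : I → Matrix (Fin 3) (Fin 3) ℤ} {bar : I → I}
  {u v : I → Fin 3 → ZMod p}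

/-- The ring homomorphism from integral to rational matrices. -/
abbrev toRat : Matrix (Fin 3) (Fin 3) ℤ →+* Matrix (Fin 3) (Fin 3) ℚ :=
  (Int.castRingHom ℚ).mapMatrix

theorem toRat_injective : Function.Injective toRat :=
  Matrix.map_injective Int.cast_injective

/-- A product of matrices that have rank one modulo `p` does not vanish modulo `p` unless two
consecutive factors are inverse to each other. -/
theorem map_prod_ne_zero (hM : ∀ i, (M i).map (Int.cast : ℤ → ZMod p) = vecMulVec (u i) (v i))
    (hu : ∀ i, u i ≠ 0) (hv : ∀ i, v i ≠ 0) (huv : ∀ i j, v i ⬝ᵥ u j = 0 → j = bar i)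
    {w : List I} (hw : w ≠ []) (hr : w.IsChain (fun i j => j ≠ bar i)) :
    (Int.castRingHom (ZMod p)).mapMatrix (w.map M).prod ≠ 0 := by
  have key : ∀ i, ∀ w : List I, (i :: w).IsChain (fun i j => j ≠ bar i) → ∃ y, y ≠ 0 ∧
      (Int.castRingHom (ZMod p)).mapMatrix ((i :: w).map M).prod = vecMulVec (u i) y := by
    intro i w
    induction w generalizing i with
    | nil =>
      intro _
      exact ⟨v i, hv i, by simpa using hM i⟩
    | cons j w ih =>
      intro h
      obtain ⟨hij, h⟩ := List.isChain_cons_cons.1 h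
      obtain ⟨y, hy, h'⟩ := ih j h
      refine ⟨(v i ⬝ᵥ u j) • y, smul_ne_zero (fun h0 => hij (huv i j h0)) hy, ?_⟩
      rw [List.map_cons, List.prod_cons, map_mul, h']
      change (M i).map (Int.cast : ℤ → ZMod p) * _ = _
      rw [hM, vecMulVec_mul_vecMulVec]
  rcases w with _ | ⟨i, w⟩
  · exact absurd rfl hw
  · obtain ⟨y, hy, h⟩ := key i w hr
    rw [h]
    intro h0
    obtain ⟨a, ha⟩ := Function.ne_iff.1 (hu i)
    obtain ⟨b, hb⟩ := Function.ne_iff.1 hy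
    have h1 := congrFun (congrFun h0 a) b
    rw [vecMulVec_apply] at h1
    exact mul_ne_zero ha hb h1

theorem smul_toRat_prod {Γ : Type*} [Group Γ] (φ : Γ →* Matrix (Fin 3) (Fin 3) ℚ)
    {A : Alphabet Γ I} {d : ℚ} {M : I → Matrix (Fin 3) (Fin 3) ℤ}
    (hφ : ∀ i, d • φ (A.val i) = toRat (M i)) (w : List I) :
    d ^ w.length • φ (A.word w) = toRat (w.map M).prod := by
  induction w with
  | nil => simp [A.word_nil]
  | cons i w ih =>
    rw [A.word_cons, List.length_cons, List.map_cons, List.prod_cons, map_mul, map_mul, ← ih,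
      ← hφ, smul_mul_smul_comm, pow_succ']

/-- If a word in one alphabet equals a word in the other, clearing denominators gives an equation of
integral matrices. Modulo `p` the side with the factor `p ^ w.length` vanishes, while the other is a
unit times a product of rank-one matrices, which is non-zero for a reduced word. -/
theorem word_notMem {Γ J : Type*} [Group Γ] (φ : Γ →* Matrix (Fin 3) (Fin 3) ℚ)
    {A : Alphabet Γ I} {B : Alphabet Γ J} {q : ℕ} (hq : (q : ZMod p) ≠ 0)
    {N : J → Matrix (Fin 3) (Fin 3) ℤ}
    (hA : ∀ i, (p : ℚ) • φ (A.val i) = toRat (M i)) (hB : ∀ i, (q : ℚ) • φ (B.val i) = toRat (N i))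
    (hM : ∀ i, (M i).map (Int.cast : ℤ → ZMod p) = vecMulVec (u i) (v i))
    (hu : ∀ i, u i ≠ 0) (hv : ∀ i, v i ≠ 0) (huv : ∀ i j, v i ⬝ᵥ u j = 0 → j = A.bar i)
    (w : List I) (hw : w ≠ []) (hr : A.Reduced w) : A.word w ∉ B.subgroup := by
  rintro ⟨w', h⟩
  have h1 := smul_toRat_prod φ hA w
  have h2 := smul_toRat_prod φ hB w'
  rw [h] at h2
  have h3 : ((q : ℤ) ^ w'.length) • (w.map M).prod = ((p : ℤ) ^ w.length) • (w'.map N).prod := by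
    apply toRat_injective
    rw [map_zsmul, map_zsmul, ← h1, ← h2, ← Int.cast_smul_eq_zsmul ℚ, ← Int.cast_smul_eq_zsmul ℚ,
      smul_smul, smul_smul]
    push_cast
    rw [mul_comm]
  have h4 := congrArg (Int.castRingHom (ZMod p)).mapMatrix h3
  rw [map_zsmul, map_zsmul, ← Int.cast_smul_eq_zsmul (ZMod p),
    ← Int.cast_smul_eq_zsmul (ZMod p)] at h4
  push_cast at h4
  rw [ZMod.natCast_self, zero_pow (by simpa using hw), zero_smul] at h4
  rcases smul_eq_zero.1 h4 with h5 | h5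
  · exact absurd h5 (pow_ne_zero _ hq)
  · refine map_prod_ne_zero hM hu hv huv hw (List.IsChain.imp (fun i j hij hj => hij ?_) hr) h5
    rw [hj, A.val_bar]

end Words

/-! ### The lattice -/

/-- The rotation given by an integral matrix. -/
def rotation (M : Matrix (Fin 3) (Fin 3) ℤ) (d : ℕ) (hd : 0 < d)
    (h : M * Mᵀ = ((d : ℤ) ^ 2) • 1) : orthogonalGroup (Fin 3) ℚ :=
  ⟨(d : ℚ)⁻¹ • toRat M, by
    have h1 := congrArg toRat h
    rw [map_mul, map_zsmul, map_one, ← Int.cast_smul_eq_zsmul ℚ] at h1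
    have h2 : toRat Mᵀ = (toRat M)ᵀ := rfl
    rw [mem_orthogonalGroup_iff, transpose_smul, smul_mul_smul_comm, ← h2, h1, smul_smul]
    have : (d : ℚ) ≠ 0 := by positivity
    push_cast
    rw [show (d : ℚ)⁻¹ * (d : ℚ)⁻¹ * (d : ℚ) ^ 2 = 1 by field_simp, one_smul]⟩

theorem smul_rotation {M : Matrix (Fin 3) (Fin 3) ℤ} {d : ℕ} (hd : 0 < d)
    (h : M * Mᵀ = ((d : ℤ) ^ 2) • 1) : (d : ℚ) • (rotation M d hd h).1 = toRat M := by
  have : (d : ℚ) ≠ 0 := by positivity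
  change (d : ℚ) • (d : ℚ)⁻¹ • toRat M = _
  rw [smul_smul, mul_inv_cancel₀ this, one_smul]

/-- The rotations given by `1 ± j ± k`. -/
def rotA (i : Bool × Bool) : orthogonalGroup (Fin 3) ℚ :=
  rotation (matA i) 3 (by norm_num) (matA_mul_transpose i)

/-- The rotations given by `1 ± 2 i`, `1 ± 2 j`, `1 ± 2 k`. -/
def rotB (k : Fin 3 × Bool) : orthogonalGroup (Fin 3) ℚ :=
  rotation (matB k) 5 (by norm_num) (matB_mul_transpose k)

/-- The group generated by the two families of rotations. -/
def lattice : Subgroup (orthogonalGroup (Fin 3) ℚ) :=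
  Subgroup.closure (Set.range rotA ∪ Set.range rotB)

theorem rotation_eq_inv {M M' : Matrix (Fin 3) (Fin 3) ℤ} {d : ℕ} (hd : 0 < d)
    (h : M * Mᵀ = ((d : ℤ) ^ 2) • 1) (h' : M' * M'ᵀ = ((d : ℤ) ^ 2) • 1) :
    rotation M d hd h = (rotation M' d hd h')⁻¹ ↔ M = M'ᵀ := by
  have hd' : (d : ℚ)⁻¹ ≠ 0 := by positivity
  rw [Subtype.ext_iff]
  change (d : ℚ)⁻¹ • toRat M = star ((d : ℚ)⁻¹ • toRat M') ↔ _
  rw [star_eq_conjTranspose, conjTranspose_eq_transpose_of_trivial, transpose_smul,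
    (smul_right_injective _ hd').eq_iff]
  exact toRat_injective.eq_iff (b := M'ᵀ)

/-- The rotations `rotA` as elements of the lattice. -/
def alphabetA : Alphabet lattice (Bool × Bool) where
  val i := ⟨rotA i, Subgroup.subset_closure (.inl ⟨i, rfl⟩)⟩
  bar := barA
  val_bar i := Subtype.ext ((rotation_eq_inv (by norm_num) (matA_mul_transpose _)
    (matA_mul_transpose i)).2 (matA_barA i))
  val_ne i h := matA_ne i ((rotation_eq_inv (by norm_num) (matA_mul_transpose i)
    (matA_mul_transpose i)).1 (congrArg Subtype.val h))

/-- The rotations `rotB` as elements of the lattice. -/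
def alphabetB : Alphabet lattice (Fin 3 × Bool) where
  val i := ⟨rotB i, Subgroup.subset_closure (.inr ⟨i, rfl⟩)⟩
  bar := barB
  val_bar i := Subtype.ext ((rotation_eq_inv (by norm_num) (matB_mul_transpose _)
    (matB_mul_transpose i)).2 (matB_barB i))
  val_ne i h := matB_ne i ((rotation_eq_inv (by norm_num) (matB_mul_transpose i)
    (matB_mul_transpose i)).1 (congrArg Subtype.val h))

/-- The matrices of the elements of the lattice. -/
def toMatrix : lattice →* Matrix (Fin 3) (Fin 3) ℚ :=
  (Submonoid.subtype _).comp lattice.subtype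

theorem toMatrix_injective : Function.Injective toMatrix :=
  Subtype.val_injective.comp Subtype.val_injective

theorem smul_toMatrix_A (i : Bool × Bool) :
    ((3 : ℕ) : ℚ) • toMatrix (alphabetA.val i) = toRat (matA i) :=
  smul_rotation (by norm_num) (matA_mul_transpose i)

theorem smul_toMatrix_B (i : Fin 3 × Bool) :
    ((5 : ℕ) : ℚ) • toMatrix (alphabetB.val i) = toRat (matB i) :=
  smul_rotation (by norm_num) (matB_mul_transpose i)

theorem smul_toMatrix_AB (i : Bool × Bool) (k : Fin 3 × Bool) :
    (15 : ℚ) • toMatrix (alphabetA.val i * alphabetB.val k) = toRat (matA i * matB k) := by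
  rw [map_mul, map_mul, ← smul_toMatrix_A, ← smul_toMatrix_B, smul_mul_smul_comm]
  norm_num

theorem smul_toMatrix_BA (i : Bool × Bool) (k : Fin 3 × Bool) :
    (15 : ℚ) • toMatrix (alphabetB.val k * alphabetA.val i) = toRat (matB k * matA i) := by
  rw [map_mul, map_mul, ← smul_toMatrix_A, ← smul_toMatrix_B, smul_mul_smul_comm]
  norm_num

instance : Fact (Nat.Prime 5) := ⟨Nat.prime_five⟩

theorem interchange : alphabetA.Interchange alphabetB where
  swap i k := by
    obtain ⟨l, j, h⟩ := matA_mul_matB i k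
    refine ⟨l, j, toMatrix_injective (smul_right_injective _ (show (15 : ℚ) ≠ 0 by norm_num) ?_)⟩
    change (15 : ℚ) • toMatrix _ = (15 : ℚ) • toMatrix _
    rw [smul_toMatrix_AB, smul_toMatrix_BA, h]
  not_mem_left := by
    obtain ⟨u, v, h1, h2, h3, h4⟩ := matA_mod
    exact word_notMem toMatrix (by decide) smul_toMatrix_A smul_toMatrix_B h1 h2 h3 h4
  not_mem_right := by
    obtain ⟨u, v, h1, h2, h3, h4⟩ := matB_mod
    exact word_notMem toMatrix (by decide) smul_toMatrix_B smul_toMatrix_A h1 h2 h3 h4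
  gen := by
    refine Eq.trans ?_ 
      (Subgroup.closure_closure_coe_preimage (k := Set.range rotA ∪ Set.range rotB))
    rw [Set.preimage_union]
    congr 2
    · ext x
      exact ⟨fun ⟨i, hi⟩ => ⟨i, congrArg Subtype.val hi⟩, fun ⟨i, hi⟩ => ⟨i, Subtype.ext hi⟩⟩
    · ext x
      exact ⟨fun ⟨i, hi⟩ => ⟨i, congrArg Subtype.val hi⟩, fun ⟨i, hi⟩ => ⟨i, Subtype.ext hi⟩⟩
  sq_ne i k h := by
    have h1 := smul_toMatrix_AB i k
    refine matA_mul_matB_sq i k (toRat_injective ?_)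
    rw [map_mul, ← h1, smul_mul_smul_comm, ← map_mul, h, map_one, map_zsmul, map_one,
      ← Int.cast_smul_eq_zsmul ℚ]
    norm_num

theorem toMatrix_mul_transpose (g : lattice) : toMatrix g * (toMatrix g)ᵀ = 1 :=
  (mem_orthogonalGroup_iff _ _).1 g.1.2

/-- The two given rotations have the distinct axes (0,1,1) and (1,0,0), and `S` and `R` inherit
their shape from commuting with them. Rotations about different axes commute only in degenerate
cases: here one of `S`, `R` is symmetric, and a symmetric orthogonal matrix is an involution. -/
theorem mul_self_of_commute {S R : Matrix (Fin 3) (Fin 3) ℚ} (hS : S * Sᵀ = 1) (hR : R * Rᵀ = 1)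
    (hSA : Commute S (toRat (matA (true, true)))) (hRB : Commute R (toRat (matB (0, true))))
    (hSR : Commute S R) : S * S = 1 ∨ R * R = 1 := by
  have e1 := fun i j => congrFun (congrFun hSA.eq i) j
  have e2 := fun i j => congrFun (congrFun hRB.eq i) j
  have e3 := fun i j => congrFun (congrFun hSR.eq i) j
  simp only [toRat, matA, matB, sgn, RingHom.mapMatrix_apply, Matrix.mul_apply, Fin.sum_univ_three,
    Matrix.map_apply] at e1 e2 e3
  have a00 := e1 0 0; have a01 := e1 0 1; have a02 := e1 0 2
  have a10 := e1 1 0; have a11 := e1 1 1; have a12 := e1 1 2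
  have a20 := e1 2 0; have a21 := e1 2 1; have a22 := e1 2 2
  have b00 := e2 0 0; have b01 := e2 0 1; have b02 := e2 0 2
  have b10 := e2 1 0; have b11 := e2 1 1; have b12 := e2 1 2
  have b20 := e2 2 0; have b21 := e2 2 1; have b22 := e2 2 2
  have c10 := e3 1 0; have c20 := e3 2 0
  clear e1 e2 e3
  simp at a00 a01 a02 a10 a11 a12 a20 a21 a22 b00 b01 b02 b10 b11 b12 b20 b21 b22
  have s1 : S 0 1 = -S 1 0 := by linarith
  have s2 : S 0 2 = S 1 0 := by linarith
  have s3 : S 2 0 = -S 1 0 := by linarith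
  have s4 : S 1 2 = S 2 1 := by linarith
  have r1 : R 0 1 = 0 := by linarith
  have r2 : R 0 2 = 0 := by linarith
  have r3 : R 1 0 = 0 := by linarith
  have r4 : R 2 0 = 0 := by linarith
  have r5 : R 1 2 = -R 2 1 := by linarith
  have r6 : R 2 2 = R 1 1 := by linarith
  -- The skew-symmetric part of `S` is `S 1 0` times the generator of the rotations about (0,1,1).
  -- If it vanishes then `S` is symmetric; otherwise the first column of the commutation relation
  -- kills the skew-symmetric part of `R`, which is governed by `R 2 1`.
  by_cases hy : S 1 0 = 0
  · left
    have : Sᵀ = S := by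
      ext i j
      fin_cases i <;> fin_cases j <;> simp [s1, s2, s3, s4, hy]
    rwa [this] at hS
  · right
    rw [r3, r4, s3, r5] at c10
    rw [r3, r4, s3, r6] at c20
    have t1 : R 0 0 = R 1 1 + R 2 1 := mul_left_cancel₀ hy (by linarith)
    have t2 : R 0 0 = R 1 1 - R 2 1 := mul_left_cancel₀ hy (by linarith)
    have t3 : R 2 1 = 0 := by linarith
    have t4 : R 0 0 = R 1 1 := by linarith
    have : Rᵀ = R := by
      ext i j
      fin_cases i <;> fin_cases j <;> simp [r1, r2, r3, r4, r5, t3]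
    rwa [this] at hR

theorem not_commute (p q : ℤ) (hp : p ≠ 0) (hq : q ≠ 0) :
    ¬ Commute (alphabetA.val (true, true) ^ p) (alphabetB.val (0, true) ^ q) := by
  intro h
  have hA : Commute (toMatrix (alphabetA.val (true, true) ^ p)) (toRat (matA (true, true))) := by
    rw [← smul_toMatrix_A]
    exact (((Commute.refl _).zpow_left p).map toMatrix).smul_right _
  have hB : Commute (toMatrix (alphabetB.val (0, true) ^ q)) (toRat (matB (0, true))) := by
    rw [← smul_toMatrix_B]
    exact (((Commute.refl _).zpow_left q).map toMatrix).smul_right _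
  rcases mul_self_of_commute (toMatrix_mul_transpose _) (toMatrix_mul_transpose _) hA hB
    (h.map toMatrix) with h1 | h1
  -- The square of a power of a letter is again a power of that letter, and letters have infinite
  -- order because their non-trivial powers stay outside the other subgroup.
  · rw [← map_mul, ← map_one toMatrix, toMatrix_injective.eq_iff, ← _root_.zpow_add] at h1
    have := interchange.splits.eq_zero_of_zpow_mem (h1 ▸ one_mem _)
    omega
  · rw [← map_mul, ← map_one toMatrix, toMatrix_injective.eq_iff, ← _root_.zpow_add] at h1
    have := interchange.symm.splits.eq_zero_of_zpow_mem (h1 ▸ one_mem _)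
    omega

end RotationLattice

/-! ### The main theorem -/

open SquareComplex in
theorem mainTheorem2 :
    (∃ (G : Type) (_ : Group G) (X : SquareComplex.{0}) (ρ : G →* X.Aut),
      X.IsCAT0 ∧ IsProper ρ ∧ IsCocompact ρ ∧ ¬ IsAcylindricalOnContactGraph ρ) ∧
    (∀ {V₁ V₂ : Type u} {Γ : Type v} [Group Γ] (T₁ : SimpleGraph V₁) (T₂ : SimpleGraph V₂)
      (_ : T₁.IsTree) (_ : T₂.IsTree)
      (_ : ∀ x, (T₁.neighborSet x).Finite) (_ : ∀ x, (T₂.neighborSet x).Finite)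
      (ρ : Γ →* (SquareComplex.prod T₁ T₂).Aut) (hfree : IsFree ρ) (_ : IsCocompact ρ)
      (g₁ g₂ : Γ) (ℓ₁ : ℤ → V₁) (ℓ₂ : ℤ → V₂) (m₁ m₂ : ℕ)
      (h : IsAntiTorus ρ g₁ g₂ ℓ₁ ℓ₂ m₁ m₂)
      (_ : ¬ IsProperPower g₁) (_ : ¬ IsProperPower g₂),
      (h.Y hfree).IsCAT0 ∧
      ∃ φ : HNNExtension Γ (Subgroup.zpowers g₁) (Subgroup.zpowers g₁) (MulEquiv.refl _) ≃*
          h.deck hfree,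
        IsFree ((h.deck hfree).subtype.comp φ.toMonoidHom) ∧
        IsCocompact ((h.deck hfree).subtype.comp φ.toMonoidHom) ∧
        ¬ IsAcylindricalOnContactGraph ((h.deck hfree).subtype.comp φ.toMonoidHom)) := by
  exact ⟨RotationLattice.interchange.exists_not_isAcylindrical RotationLattice.not_commute,
    fun T₁ T₂ hT₁ hT₂ hfin₁ hfin₂ ρ hfree hcoc g₁ g₂ ℓ₁ ℓ₂ m₁ m₂ h _ _ =>
      h.isCAT0_and_exists_mulEquiv_deck hT₁ hT₂ hfin₁ hfin₂ hfree hcoc⟩
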